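/- Let $X$ be a metric space homeomorphic to $\mathbb{R}^2$ whose Hausdorff $2$-measure $\mathcal{H}^2$ (normalized by the factor $\pi/4$, so that it is Lebesgue measure in $\mathbb{R}^2$) is finite on compact sets. A path in a metric space is a continuous map from a nonempty interval into it, and $|\gamma|$ is the image of the path $\gamma$. The modulus of a family $\Gamma$ of paths in $X$ is $$\operatorname{mod}\Gamma=\inf_\rho\int_X\rho^2\,d\mathcal{H}^2,$$ the infimum being over all Borel functions $\rho:X\to[0,\infty]$ with $\int_\gamma\rho\,ds\ge 1$ for all locally rectifiable $\gamma\in\Gamma$. The modulus of a path family in $\mathbb{R}^2$ is defined in the same way with Lebesgue measure. For $E,F,G\subset X$ let $\operatorname{mod}(E,F;G)$ be the modulus of the family of all paths $\gamma$ with $|\gamma|\subset G$ that meet both $E$ and $F$. Let $0<\kappa<\infty$, and suppose that $X$ satisfies the lower reciprocality bound with constant $\kappa$: whenever $Q\subset X$ is homeomorphic to a closed square, with boundary edges $\zeta_1,\zeta_2,\zeta_3,\zeta_4$ in cyclic order, $$\operatorname{mod}(\zeta_1,\zeta_3;Q)\cdot\operatorname{mod}(\zeta_2,\zeta_4;Q)\ge\kappa^{-1}.$$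 Let $\Omega\subset X$ be a domain (a nonempty connected open set), and let $F:\Omega\to\Omega'\subset\mathbb{R}^2$ be a homeomorphism for which there is $0\le K<\infty$ such that $$\operatorname{mod}\Gamma\le K\operatorname{mod}(F\Gamma)\quad\text{for every path family }\Gamma\text{ in }\Omega,\qquad F\Gamma=\{F\circ\gamma:\gamma\in\Gamma\}.$$ For $y=(y_1,y_2)\in\Omega'$ let $$J_{F^{-1}}(y)=\limsup_{r\to0}\frac{\mathcal{H}^2\big(F^{-1}(R(y,r))\big)}{4r^2},\qquad R(y,r)=[y_1-r,y_1+r]\times[y_2-r,y_2+r].$$ Then the following hold. 1. The function $g=(2\kappa K J_{F^{-1}})^{1/2}$ is a weak upper gradient of $F^{-1}:\Omega'\to\Omega\subset X$. That is, $g$ is Borel, and there is a family $\Gamma_0$ of paths in $\Omega'$ with $\operatorname{mod}\Gamma_0=0$ such that $$d_X\big(F^{-1}(a),F^{-1}(b)\big)\le\int_\gamma g\,ds$$ for every locally rectifiable path $\gamma\notin\Gamma_0$ in $\Omega'$ and all $a,b\in|\gamma|$. 2. For every path family $\Gamma$ in $\Omega$, $$\operatorname{mod}(F\Gamma)\le 2\kappa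 K\operatorname{mod}\Gamma.$$ -/

import Mathlib

open MeasureTheory Set Filter Topology
open scoped ENNReal NNReal MeasureTheory

/-- The Euclidean plane. -/
abbrev Plane : Type := EuclideanSpace ℝ (Fin 2)

/-- The Hausdorff `2`-measure with the normalization `a₂ = π / 4`, i.e. the limit as `δ → 0` of the
infimum of `∑ (π / 4) * diam (A j) ^ 2` over countable covers by sets of diameter at most `δ`.
(Mathlib's `μH[2]` is the same with the factor `1` in place of `π / 4`.) -/
noncomputable def hausdorffTwo (X : Type*) [MetricSpace X] [MeasurableSpace X] [BorelSpace X] :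
    Measure X :=
  ENNReal.ofReal (Real.pi / 4) • (μH[2] : Measure X)

/-- A continuous path in `Y`: a continuous map to `Y` from a nonempty interval of the real line,
which may be open, closed, half-open, bounded or unbounded. The values of `toFun` outside `dom`
play no role. -/
structure IntervalPath (Y : Type*) [TopologicalSpace Y] where
  dom : Set ℝ
  nonempty : dom.Nonempty
  ordConnected : dom.OrdConnected
  toFun : ℝ → Y
  continuousOn : ContinuousOn toFun dom

namespace IntervalPath

/-- The composition `f ∘ γ` of a path with a continuous map. -/
def map {Y Z : Type*} [TopologicalSpace Y] [TopologicalSpace Z] (f : Y → Z) (hf : Continuous f)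
    (γ : IntervalPath Y) : IntervalPath Z where
  dom := γ.dom
  nonempty := γ.nonempty
  ordConnected := γ.ordConnected
  toFun := f ∘ γ.toFun
  continuousOn := hf.comp_continuousOn γ.continuousOn

/-- The image `|γ|` of a path. -/
def trace {Y : Type*} [TopologicalSpace Y] (γ : IntervalPath Y) : Set Y :=
  γ.toFun '' γ.dom

/-- A path is locally rectifiable if its restriction to every compact subinterval of its domain
has finite length. -/
def LocallyRectifiable {Y : Type*} [MetricSpace Y] (γ : IntervalPath Y) : Prop :=
  LocallyBoundedVariationOn γ.toFun γ.dom

/-- The integral of `ρ` over the restriction of `γ` to `[a, b]`, which is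
`∫₀^ℓ ρ (γₛ t) dt`, where `ℓ` is the length of this restriction and `γₛ : [0, ℓ] → Y` its
parametrization by arc length. It is used for rectifiable restrictions only. -/
noncomputable def compactIntegral {Y : Type*} [MetricSpace Y] (γ : IntervalPath Y)
    (ρ : Y → ℝ≥0∞) (a b : ℝ) : ℝ≥0∞ :=
  ∫⁻ t in Icc (0 : ℝ) (eVariationOn γ.toFun (Icc a b)).toReal,
    ρ (naturalParameterization γ.toFun (Icc a b) a t)

/-- The integral `∫_γ ρ ds` of `ρ` over a locally rectifiable path `γ`: the supremum of the
integrals over the restrictions of `γ` to the compact subintervals of its domain. -/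
noncomputable def lineIntegral {Y : Type*} [MetricSpace Y] (γ : IntervalPath Y)
    (ρ : Y → ℝ≥0∞) : ℝ≥0∞ :=
  ⨆ (a ∈ γ.dom) (b ∈ γ.dom) (_ : a ≤ b), γ.compactIntegral ρ a b

end IntervalPath

/-- A nonnegative Borel function `ρ` is admissible for the path family `Γ` if its integral over
every locally rectifiable path of `Γ` is at least `1`. -/
def IsAdmissible {Y : Type*} [MetricSpace Y] [MeasurableSpace Y]
    (Γ : Set (IntervalPath Y)) (ρ : Y → ℝ≥0∞) : Prop :=
  Measurable ρ ∧ ∀ γ ∈ Γ, γ.LocallyRectifiable → 1 ≤ γ.lineIntegral ρ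

/-- The (conformal) modulus of the path family `Γ` in `Y`, with respect to the measure `μ`. -/
noncomputable def modulus {Y : Type*} [MetricSpace Y] [MeasurableSpace Y] (μ : Measure Y)
    (Γ : Set (IntervalPath Y)) : ℝ≥0∞ :=
  ⨅ (ρ : Y → ℝ≥0∞) (_ : IsAdmissible Γ ρ), ∫⁻ y, ρ y ^ 2 ∂μ

/-- The family `Δ(E, F; G)` of all paths in `G` joining `E` and `F`, i.e. meeting both. -/
def joiningPaths {Y : Type*} [TopologicalSpace Y] (E F G : Set Y) : Set (IntervalPath Y) :=
  {γ | γ.trace ⊆ G ∧ (γ.trace ∩ E).Nonempty ∧ (γ.trace ∩ F).Nonempty}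

/-- The lower reciprocality bound with constant `κ`: for each `Q ⊆ X` homeomorphic to a closed
square, with boundary edges `ζ₁, ζ₂, ζ₃, ζ₄` in cyclic order,
`mod (ζ₁, ζ₃; Q) * mod (ζ₂, ζ₄; Q) ≥ κ⁻¹`. Here `Q` is the image of the closed unit square under a
continuous injection `φ` (a homeomorphism onto `Q`, by compactness), and the edges are the images
of the sides. -/
def LowerReciprocal (X : Type*) [MetricSpace X] [MeasurableSpace X] [BorelSpace X] (κ : ℝ≥0) :
    Prop :=
  ∀ φ : unitInterval × unitInterval → X, Continuous φ → Function.Injective φ →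
    (κ : ℝ≥0∞)⁻¹ ≤
      modulus (hausdorffTwo X)
          (joiningPaths (φ '' {p | p.1 = 0}) (φ '' {p | p.1 = 1}) (range φ)) *
        modulus (hausdorffTwo X)
          (joiningPaths (φ '' {p | p.2 = 0}) (φ '' {p | p.2 = 1}) (range φ))

/-- `g` is a weak upper gradient of the map `f : A → Z`, where `A ⊆ Y` and `Y` carries the measure
`μ`: `g` is Borel, and, outside a family `Γ₀` of paths in `A` of modulus zero, every locally
rectifiable path `γ` in `A` satisfies `d (f x, f y) ≤ ∫_γ g ds` for all points `x`, `y` on `γ`. -/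
def IsWeakUpperGradientOn {Y Z : Type*} [MetricSpace Y] [MeasurableSpace Y] [MetricSpace Z]
    (μ : Measure Y) (A : Set Y) (f : A → Z) (g : A → ℝ≥0∞) : Prop :=
  Measurable g ∧
    ∃ Γ₀ : Set (IntervalPath A),
      modulus μ (IntervalPath.map Subtype.val continuous_subtype_val '' Γ₀) = 0 ∧
      ∀ γ : IntervalPath A, γ ∉ Γ₀ → γ.LocallyRectifiable →
        ∀ x ∈ γ.trace, ∀ y ∈ γ.trace, edist (f x) (f y) ≤ γ.lineIntegral g

/-- The closed axis-parallel square `R(y, r)` with center `y` and side length `2 r`. -/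
def planeSquare (y : Plane) (r : ℝ) : Set Plane :=
  {z | |z 0 - y 0| ≤ r ∧ |z 1 - y 1| ≤ r}

/-- The volume derivative `J_{F⁻¹}(y) = limsup_{r → 0} H² (F⁻¹ (R(y, r))) / (4 r²)` of the inverse
of a homeomorphism `F : Ω → Ω'` with `Ω ⊆ X` and `Ω' ⊆ ℝ²`. -/
noncomputable def inverseJacobian {X : Type*} [MetricSpace X] [MeasurableSpace X] [BorelSpace X]
    {Ω : Set X} {Ω' : Set Plane} (F : Ω ≃ₜ Ω') (y : Ω') : ℝ≥0∞ :=
  limsup (fun r : ℝ =>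
      hausdorffTwo X (Subtype.val '' {x : Ω | (F x : Plane) ∈ planeSquare y r}) /
        ENNReal.ofReal (4 * r ^ 2))
    (𝓝[>] 0)

/-! Write `f` for the inverse of `F`, `μ` for the measure on `Ω'` obtained by transporting `H²`
through `F`, `J` for its upper density on squares, and `C = κ K`.

Geometry enters once, in `horizontalBound_of_lowerReciprocal`. Let `R ⊆ Ω'` be a rectangle of width
`w` and height `h`, and suppose that the images of its vertical sides have mutual distances at least
`δ`. The constant density `1 / δ` bounds the modulus of the paths in `f(R)` joining these images by
`μ(R) / δ²`. The hypothesis on `F` and the density `1 / h` bound the modulus for the other two sides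
by `K w / h`. Lower reciprocality bounds the product from below, whence `δ² h ≤ C w μ(R)`. Cutting
`R` into thin strips turns this into an `L²` bound for the horizontal increments of `f`
(`HorizontalBound.lintegral_sq_le`). By Cauchy–Schwarz on small squares, the mean increment per unit
length is at most the mean of the square roots of `C` times the densities of `μ` on these squares.

In the limit these means are controlled by `(C J)^{1/2}`, even if `μ` has a singular part: the
square roots are bounded in `L²`, so no mass concentrates
(`limsup_lintegral_sqrt_squareDensity_le`). Hence for `u = d(f(·), x₀)` the integrals of `u` over
squares of fixed size have horizontal and, by symmetry, vertical slopes at most the integral of `(C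
J)^{1/2}` over the same square. A curve of unit Euclidean speed has `ℓ¹` speed at most `√2`, which
is the origin of the factor `2 = (√2)²`. When the squares shrink, the averages of `(C J)^{1/2}`
along the curve converge, except on curves over which one fixed `L²` function has infinite integral.
These curves form a family of modulus zero, by the argument of Fuglede's lemma
(`exists_seq_average_le`, `exists_upper_gradient_along`). So `g = (2 C J)^{1/2}` is a weak upper
gradient of `f`.

For the modulus inequality, let `ρ` be admissible in `X`. Off the exceptional curves the image under
`f` of a curve has metric speed at most `g`, so `(ρ ∘ f) g` is admissible for `F Γ` up to a family
of modulus zero (`IntervalPath.lineIntegral_map_le_of_forall_lipschitz`). Its energy is `2 C ∫ (ρ ∘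
f)² J`, which is at most `2 C ∫ ρ² dH²` because `J` is almost everywhere the density of the
absolutely continuous part of `μ` (`lintegral_mul_upperDensity_le`). -/

/-! ### Invariance of domain in the plane, by continuous logarithms; it gives that `Ω'` is open. -/

section InvarianceOfDomain

open Complex

/-- Along a homotopy of nowhere vanishing functions the existence of a continuous logarithm is
preserved. -/
theorem exists_log_of_homotopy {A : Type*} [TopologicalSpace A] (H : unitInterval × A → ℂ)
    (hH : Continuous H) (h0 : ∀ p, H p ≠ 0) (g : A → ℂ) (hg : Continuous g)
    (hgH : ∀ a, exp (g a) = H (0, a)) :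
    ∃ k : A → ℂ, Continuous k ∧ ∀ a, exp (k a) = H (1, a) := by
  let H' : C(unitInterval × A, {z : ℂ // z ≠ 0}) := ⟨fun p => ⟨H p, h0 p⟩, by fun_prop⟩
  let g' : C(A, ℂ) := ⟨g, hg⟩
  have e0 : ∀ a, H' (0, a) = (fun z : ℂ ↦ (⟨_, z.exp_ne_zero⟩ : {z : ℂ // z ≠ 0})) (g' a) :=
    fun a => Subtype.ext (hgH a).symm
  let L := isCoveringMap_exp.liftHomotopy H' g' e0
  refine ⟨fun a => L (1, a), by fun_prop, fun a => ?_⟩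
  have := congr_fun (isCoveringMap_exp.liftHomotopy_lifts H' g' e0) (1, a)
  exact congr_arg Subtype.val this

/-- If `k` were a logarithm of an odd function, `exp (k (-z) - k z)` would be `-1`. But the
imaginary part of the exponent is odd in `z`, so it vanishes somewhere on the connected circle, and
there the exponential is positive. -/
theorem not_exists_log_of_odd (ψ : Metric.sphere (0 : ℂ) 1 → ℂ) (hodd : ∀ z, ψ (-z) = -ψ z)
    (k : Metric.sphere (0 : ℂ) 1 → ℂ) (hk : Continuous k) (hkψ : ∀ z, exp (k z) = ψ z) : False := by
  have hpre : PreconnectedSpace (Metric.sphere (0 : ℂ) 1) :=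
    Subtype.preconnectedSpace (isPreconnected_sphere (by simp) 0 1)
  let m : Metric.sphere (0 : ℂ) 1 → ℝ := fun z => (k (-z) - k z).im
  have hm : Continuous m := by
    have : Continuous fun z : Metric.sphere (0 : ℂ) 1 => -z := continuous_neg
    fun_prop
  have hneg : ∀ z, m (-z) = -m z := fun z => by simp [m]
  let z0 : Metric.sphere (0 : ℂ) 1 := ⟨1, by simp⟩
  obtain ⟨z, hz⟩ : ∃ z, m z = 0 := by
    rcases le_total (m z0) 0 with h | h
    · exact mem_range_of_exists_le_of_exists_ge hm ⟨z0, h⟩ ⟨-z0, by rw [hneg]; linarith⟩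
    · exact mem_range_of_exists_le_of_exists_ge hm ⟨-z0, by rw [hneg]; linarith⟩ ⟨z0, h⟩
  have h1 : exp (k (-z) - k z) = -1 := by
    rw [exp_sub, hkψ, hkψ, hodd, neg_div, div_self]
    rw [← hkψ]; exact exp_ne_zero _
  have h2 := congr_arg re h1
  rw [exp_re] at h2
  simp only [m] at hz
  rw [hz] at h2
  simp only [Real.cos_zero, mul_one, neg_re, one_re] at h2
  linarith [Real.exp_pos (k (-z) - k z).re]

/-- A continuous injection of the closed unit disc to the plane maps the center to an interior point
of the image. -/
theorem mem_interior_image_closedBall {f : ℂ → ℂ} (hf : ContinuousOn f (Metric.closedBall 0 1))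
    (hinj : InjOn f (Metric.closedBall 0 1)) :
    f 0 ∈ interior (f '' Metric.closedBall 0 1) := by
  let S := Metric.sphere (0 : ℂ) 1
  have hS : ∀ z : S, ‖(z : ℂ)‖ = 1 := fun z => by simp
  have hcomp : ∀ φ : unitInterval × S → ℂ, Continuous φ → (∀ p, ‖φ p‖ ≤ 1) →
      Continuous fun p => f (φ p) := fun φ hφ h =>
    hf.comp_continuous hφ fun p => by simpa using h p
  by_contra hint
  have hcompact : IsCompact S := isCompact_sphere 0 1
  obtain ⟨z₁, hz₁, hmin⟩ := hcompact.exists_isMinOn (f := fun z => ‖f z - f 0‖)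
    ⟨1, by simp [S]⟩
    (((hf.mono Metric.sphere_subset_closedBall).sub continuousOn_const).norm)
  have hz₁n : ‖z₁‖ = 1 := hS ⟨z₁, hz₁⟩
  have hpos : 0 < ‖f z₁ - f 0‖ := by
    rw [norm_pos_iff, sub_ne_zero]
    intro h
    have := hinj (by simp [hz₁n]) (by simp) h
    rw [this] at hz₁n; simp at hz₁n
  obtain ⟨p, hp, hpd⟩ : ∃ p, p ∉ f '' Metric.closedBall 0 1 ∧ ‖p - f 0‖ < ‖f z₁ - f 0‖ := by
    by_contra! h
    apply hint
    rw [mem_interior_iff_mem_nhds, Metric.mem_nhds_iff]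
    refine ⟨_, hpos, fun p hp => ?_⟩
    by_contra hp'
    have := h p hp'
    rw [Metric.mem_ball, dist_eq_norm] at hp
    linarith
  have hI : ∀ s : unitInterval, (0 : ℝ) ≤ s ∧ (s : ℝ) ≤ 1 := fun s => s.2
  -- the function `f - p` extends to the disc without zeros
  have key1 : ∃ k : S → ℂ, Continuous k ∧ ∀ a : S, exp (k a) = f a - p := by
    obtain ⟨k, hk, hk'⟩ := exists_log_of_homotopy (A := S)
      (fun q => f (((q.1 : ℝ) : ℂ) * (q.2 : ℂ)) - p)
      ((hcomp _ (by fun_prop) fun q => by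
        rw [norm_mul, hS, mul_one, Complex.norm_real, Real.norm_eq_abs, abs_of_nonneg (hI q.1).1]
        exact (hI q.1).2).sub continuous_const)
      (fun q h => hp ⟨_, by
        rw [mem_closedBall_zero_iff, norm_mul, hS, mul_one, Complex.norm_real, Real.norm_eq_abs,
          abs_of_nonneg (hI q.1).1]
        exact (hI q.1).2, sub_eq_zero.1 h⟩)
      (fun _ => log (f 0 - p)) continuous_const
      (fun a => by
        rw [exp_log]
        · simp
        · rw [sub_ne_zero]
          intro h
          exact hp ⟨0, by simp, h⟩)
    exact ⟨k, hk, fun a => by rw [hk']; simp⟩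
  obtain ⟨k1, hk1, hk1'⟩ := key1
  -- Slide `p` to `f 0` along the segment. No zero appears, since `‖p - f 0‖` is less than the
  -- distance from `f 0` to the image of the circle.
  have key2 : ∃ k : S → ℂ, Continuous k ∧ ∀ a : S, exp (k a) = f a - f 0 := by
    obtain ⟨k, hk, hk'⟩ := exists_log_of_homotopy (A := S)
      (fun q => f (q.2 : ℂ) - p + ((q.1 : ℝ) : ℂ) * (p - f 0))
      (((hcomp (fun q => (q.2 : ℂ)) (by fun_prop) fun q => (hS _).le).sub
        continuous_const).add (by fun_prop))
      (fun q h => by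
        have h1 : f q.2 - f 0 = (1 - ((q.1 : ℝ) : ℂ)) * (p - f 0) := by linear_combination h
        have h2 : ‖f q.2 - f 0‖ ≤ ‖p - f 0‖ := by
          rw [h1, norm_mul]
          have : ‖(1 - ((q.1 : ℝ) : ℂ))‖ ≤ 1 := by
            rw [← Complex.ofReal_one, ← Complex.ofReal_sub, Complex.norm_real, Real.norm_eq_abs,
              abs_of_nonneg (by linarith [(hI q.1).2])]
            linarith [(hI q.1).1]
          exact mul_le_of_le_one_left (norm_nonneg _) this
        have h3 : ‖f z₁ - f 0‖ ≤ ‖f q.2 - f 0‖ := hmin q.2.2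
        linarith)
      k1 hk1 (fun a => by simp [hk1'])
    exact ⟨k, hk, fun a => by rw [hk']; simp⟩
  obtain ⟨k2, hk2, hk2'⟩ := key2
  have h1s : ∀ s : unitInterval, (1 + ((s : ℝ) : ℂ)) ≠ 0 := fun s h => by
    have := congr_arg re h
    simp at this
    linarith [(hI s).1]
  have hn1 : ∀ s : unitInterval, ‖(1 + ((s : ℝ) : ℂ))‖ = 1 + s := fun s => by
    rw [← Complex.ofReal_one, ← Complex.ofReal_add, Complex.norm_real, Real.norm_eq_abs,
              abs_of_nonneg (by linarith [(hI s).1])]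
  have hb1 : ∀ q : unitInterval × S, ‖(q.2 : ℂ) / (1 + ((q.1 : ℝ) : ℂ))‖ ≤ 1 := fun q => by
    rw [norm_div, hS, hn1]
    exact div_le_one_of_le₀ (by linarith [(hI q.1).1]) (by linarith [(hI q.1).1])
  have hb2 : ∀ q : unitInterval × S,
      ‖-(((q.1 : ℝ) : ℂ) * (q.2 : ℂ)) / (1 + ((q.1 : ℝ) : ℂ))‖ ≤ 1 := fun q => by
    rw [norm_div, norm_neg, norm_mul, hS, hn1, Complex.norm_real, Real.norm_eq_abs,
      abs_of_nonneg (hI q.1).1]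
    exact div_le_one_of_le₀ (by linarith [(hI q.1).1]) (by linarith [(hI q.1).1])
  -- This homotopy runs from `f z - f 0` to the odd function `f (z / 2) - f (-z / 2)`. Its two
  -- arguments differ by `z`, so injectivity excludes zeros.
  obtain ⟨k3, hk3, hk3'⟩ := exists_log_of_homotopy (A := S)
      (fun q => f ((q.2 : ℂ) / (1 + ((q.1 : ℝ) : ℂ))) -
        f (-(((q.1 : ℝ) : ℂ) * (q.2 : ℂ)) / (1 + ((q.1 : ℝ) : ℂ))))
      ((hcomp _ (Continuous.div (by fun_prop) (by fun_prop) fun q => h1s _) hb1).sub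
        (hcomp _ (Continuous.div (by fun_prop) (by fun_prop) fun q => h1s _) hb2))
      (fun q h => by
        have h1 := hinj (mem_closedBall_zero_iff.2 (hb1 q)) (mem_closedBall_zero_iff.2 (hb2 q))
          (sub_eq_zero.1 h)
        rw [div_left_inj' (h1s _)] at h1
        have h2 : (q.2 : ℂ) * (1 + ((q.1 : ℝ) : ℂ)) = 0 := by linear_combination h1
        rcases mul_eq_zero.1 h2 with h3 | h3
        · have := hS q.2
          rw [h3] at this; simp at this
        · exact h1s _ h3)
      k2 hk2 (fun a => by simp [hk2'])
  exact not_exists_log_of_odd _ (fun z => by simp [hk3', neg_div]) k3 hk3 (fun z => rfl)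

/-- Invariance of domain in the complex plane. -/
theorem isOpen_image_of_injOn {f : ℂ → ℂ} {U : Set ℂ} (hU : IsOpen U) (hf : ContinuousOn f U)
    (hinj : InjOn f U) : IsOpen (f '' U) := by
  rw [isOpen_iff_mem_nhds]
  rintro _ ⟨z, hz, rfl⟩
  obtain ⟨r, hr, hball⟩ := Metric.nhds_basis_closedBall.mem_iff.1 (hU.mem_nhds hz)
  have hr' : (r : ℂ) ≠ 0 := by exact_mod_cast hr.ne'
  have hmaps : MapsTo (fun w : ℂ => z + r * w) (Metric.closedBall 0 1) U := fun w hw => by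
    apply hball
    rw [mem_closedBall_zero_iff] at hw
    rw [mem_closedBall_iff_norm, add_sub_cancel_left, norm_mul, Complex.norm_real,
      Real.norm_eq_abs, abs_of_pos hr]
    exact mul_le_of_le_one_right hr.le hw
  have h := mem_interior_image_closedBall (f := fun w => f (z + r * w))
    (hf.comp (by fun_prop) hmaps)
    (fun a ha b hb hab => mul_left_cancel₀ hr' (add_left_cancel (hinj (hmaps ha) (hmaps hb) hab)))
  rw [mem_interior_iff_mem_nhds] at h
  simp only [mul_zero, add_zero] at h
  refine mem_of_superset h ?_
  rintro _ ⟨w, hw, rfl⟩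
  exact ⟨_, hmaps hw, rfl⟩

/-- A subset of the plane that is homeomorphic to an open subset of a topological plane is open. -/
theorem isOpen_of_homeomorph_of_isOpen {X : Type*} [TopologicalSpace X] (e : X ≃ₜ Plane)
    {Ω : Set X} (hΩ : IsOpen Ω) {Ω' : Set Plane} (F : Ω ≃ₜ Ω') : IsOpen Ω' := by
  let c : Plane ≃ₜ ℂ := (Complex.orthonormalBasisOneI.repr.toHomeomorph).symm
  let a : X ≃ₜ ℂ := e.trans c
  have hU : IsOpen (a '' Ω) := a.isOpen_image.2 hΩ
  let i : a '' Ω → Ω := fun z => ⟨a.symm z, by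
    obtain ⟨_, x, hx, rfl⟩ := z; simpa using hx⟩
  have hi : Continuous i := by fun_prop
  let b : a '' Ω → ℂ := fun z => c (F (i z))
  have hb : Continuous b := by fun_prop
  have hbi : Function.Injective b := fun z w h => by
    have h1 := F.injective (Subtype.val_injective (c.injective h))
    exact Subtype.ext (a.symm.injective (congr_arg Subtype.val h1))
  let f : ℂ → ℂ := Function.extend Subtype.val b 0
  have hfb : ∀ z : a '' Ω, f z = b z := fun z => Subtype.val_injective.extend_apply _ _ _
  have hopen := isOpen_image_of_injOn (f := f) hU
    (continuousOn_iff_continuous_domRestrict.2 (by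
      convert hb using 1
      ext z
      exact hfb z))
    (fun z hz w hw h => by
      have := hbi (a₁ := ⟨z, hz⟩) (a₂ := ⟨w, hw⟩) (by rw [← hfb, ← hfb]; exact h)
      exact congr_arg Subtype.val this)
  have : f '' (a '' Ω) = c '' Ω' := by
    ext w
    constructor
    · rintro ⟨z, hz, rfl⟩
      exact ⟨F (i ⟨z, hz⟩), Subtype.coe_prop _, (hfb ⟨z, hz⟩).symm⟩
    · rintro ⟨y, hy, rfl⟩
      have hz : a (F.symm ⟨y, hy⟩) ∈ a '' Ω := ⟨_, Subtype.coe_prop _, rfl⟩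
      refine ⟨_, hz, ?_⟩
      rw [hfb ⟨_, hz⟩]
      have : i ⟨_, hz⟩ = F.symm ⟨y, hy⟩ := Subtype.ext (by simp [i])
      simp [b, this]
  rw [this] at hopen
  exact c.isOpen_image.1 hopen

end InvarianceOfDomain

/-! ### Arc length parametrization and integrals along reparametrized curves. -/

section ArcLength

variable {Y : Type*} [MetricSpace Y] {γ : ℝ → Y} {a b : ℝ}

/-- The one-sided jumps of the variation function are those of the curve. For a continuous curve it
is therefore continuous, and the intermediate value theorem applies. -/
theorem image_variationOnFromTo_Icc (hab : a ≤ b) (hc : ContinuousOn γ (Icc a b))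
    (hv : BoundedVariationOn γ (Icc a b)) :
    variationOnFromTo γ (Icc a b) a '' Icc a b = Icc 0 (eVariationOn γ (Icc a b)).toReal := by
  have hl := hv.locallyBoundedVariationOn
  have ha : a ∈ Icc a b := left_mem_Icc.2 hab
  have hb : b ∈ Icc a b := right_mem_Icc.2 hab
  have hend : variationOnFromTo γ (Icc a b) a b = (eVariationOn γ (Icc a b)).toReal := by
    rw [variationOnFromTo.eq_of_le _ _ hab, inter_self]
  have hmono := variationOnFromTo.monotoneOn hl ha
  have hcont : ContinuousOn (variationOnFromTo γ (Icc a b) a) (Icc a b) := by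
    intro x hx
    have h1 : ContinuousWithinAt (variationOnFromTo γ (Icc a b) a) (Icc a b ∩ Iio x) x := by
      have := variationOnFromTo.tendsto_left ha hx hl
        (((hc x hx).mono inter_subset_left : ContinuousWithinAt γ (Icc a b ∩ Iio x) x))
      rwa [dist_self, sub_zero] at this
    have h2 : ContinuousWithinAt (variationOnFromTo γ (Icc a b) a) (Icc a b ∩ Ioi x) x := by
      have := variationOnFromTo.tendsto_right ha hx hl
        (((hc x hx).mono inter_subset_left : ContinuousWithinAt γ (Icc a b ∩ Ioi x) x))
      rwa [dist_self, add_zero] at this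
    rw [← continuousWithinAt_sdiff_singleton]
    refine (h1.union h2).mono fun y hy => ?_
    rcases lt_or_gt_of_ne hy.2 with h | h
    · exact Or.inl ⟨hy.1, h⟩
    · exact Or.inr ⟨hy.1, h⟩
  rw [← hend, ← variationOnFromTo.self γ (Icc a b) a]
  refine Subset.antisymm ?_ (intermediate_value_Icc hab hcont)
  rintro _ ⟨t, ht, rfl⟩
  exact ⟨hmono ha ht ht.1, hmono ht hb ht.2⟩

/-- The parametrization by arc length, extended to a Lipschitz curve on the real line. -/
theorem exists_arcLength_extension (hab : a ≤ b) (hc : ContinuousOn γ (Icc a b))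
    (hv : BoundedVariationOn γ (Icc a b)) :
    ∃ c : ℝ → Y, LipschitzWith 1 c ∧ (∀ t, c t ∈ γ '' Icc a b) ∧
      (∀ t ∈ Icc 0 (eVariationOn γ (Icc a b)).toReal,
        naturalParameterization γ (Icc a b) a t = c t) ∧
      ∀ t ∈ Icc a b, c (variationOnFromTo γ (Icc a b) a t) = γ t := by
  have hl := hv.locallyBoundedVariationOn
  have ha : a ∈ Icc a b := left_mem_Icc.2 hab
  have him := image_variationOnFromTo_Icc hab hc hv
  set L := (eVariationOn γ (Icc a b)).toReal
  have hL : (0 : ℝ) ≤ L := ENNReal.toReal_nonneg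
  have hus := has_unit_speed_naturalParameterization γ hl ha
  rw [him] at hus
  have hval : ∀ t ∈ Icc a b,
      naturalParameterization γ (Icc a b) a (variationOnFromTo γ (Icc a b) a t) = γ t :=
    fun t ht => edist_eq_zero.1 (edist_naturalParameterization_eq_zero hl ha ht)
  refine ⟨fun t => naturalParameterization γ (Icc a b) a (projIcc 0 L hL t), ?_, ?_, ?_, ?_⟩
  · have h1 : LipschitzOnWith 1 (naturalParameterization γ (Icc a b) a) (Icc 0 L) := by
      have key : ∀ x ∈ Icc 0 L, ∀ y ∈ Icc 0 L, x ≤ y →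
          edist (naturalParameterization γ (Icc a b) a x)
            (naturalParameterization γ (Icc a b) a y) ≤ edist x y := fun x hx y hy hxy => by
        have h := hus hx hy
        have h2 := eVariationOn.edist_le (naturalParameterization γ (Icc a b) a)
          (s := Icc 0 L ∩ Icc x y) ⟨hx, le_rfl, hxy⟩ ⟨hy, hxy, le_rfl⟩
        rw [h] at h2
        rw [edist_comm x y, edist_dist y x, Real.dist_eq, abs_of_nonneg (sub_nonneg.2 hxy)]
        simpa using h2
      intro x hx y hy
      rw [ENNReal.coe_one, one_mul]
      rcases le_total x y with h | h
      · exact key x hx y hy h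
      · rw [edist_comm, edist_comm x]; exact key y hy x hx h
    have h2 : LipschitzWith 1 (fun t => ((projIcc 0 L hL t : Icc 0 L) : ℝ)) := 
      LipschitzWith.projIcc hL
    intro x y
    have := h1 (projIcc 0 L hL x).2 (projIcc 0 L hL y).2
    rw [ENNReal.coe_one, one_mul] at this
    refine this.trans ?_
    exact h2 x y
  · intro t
    have hm := (projIcc 0 L hL t).2
    obtain ⟨s, hs, hs'⟩ := him.symm.subset hm
    refine ⟨s, hs, ?_⟩
    rw [← hval s hs, hs']
  · intro t ht
    simp only [projIcc_of_mem hL ht]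
  · intro t ht
    have : variationOnFromTo γ (Icc a b) a t ∈ Icc 0 L := him ▸ mem_image_of_mem _ ht
    simp only [projIcc_of_mem hL this]
    exact hval t ht

/-- If the increments of a curve are controlled by the integral of `G`, then so are the lengths of
its arcs. -/
theorem eVariationOn_Icc_le_lintegral {c : ℝ → Y} {G : ℝ → ℝ≥0∞} {s t : ℝ}
    (h : ∀ x ∈ Icc s t, ∀ y ∈ Icc s t, x ≤ y → edist (c x) (c y) ≤ ∫⁻ u in Icc x y, G u) :
    eVariationOn c (Icc s t) ≤ ∫⁻ u in Icc s t, G u := by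
  refine iSup_le fun p => ?_
  obtain ⟨n, u, hu, hus⟩ := p
  simp only
  have hd : Pairwise (Function.onFun Disjoint fun i : ℕ => Ioc (u i) (u (i + 1))) :=
    hu.pairwise_disjoint_on_Ioc_succ
  calc ∑ i ∈ Finset.range n, edist (c (u (i + 1))) (c (u i))
      ≤ ∑ i ∈ Finset.range n, ∫⁻ x in Ioc (u i) (u (i + 1)), G x := by
        refine Finset.sum_le_sum fun i _ => ?_
        rw [edist_comm, restrict_Ioc_eq_restrict_Icc]
        exact h _ (hus i) _ (hus (i + 1)) (hu i.le_succ)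
    _ = ∫⁻ x in ⋃ i ∈ Finset.range n, Ioc (u i) (u (i + 1)), G x := by
        rw [lintegral_biUnion_finset (fun i _ j _ hij => hd hij) (fun i _ => measurableSet_Ioc)]
    _ ≤ ∫⁻ u in Icc s t, G u := by
        refine lintegral_mono_set (iUnion₂_subset fun i _ x hx => ?_)
        exact ⟨(hus i).1.trans hx.1.le, hx.2.trans (hus (i + 1)).2⟩

/-- A measure on the line that is absolutely continuous and dominated by a locally finite measure on
closed intervals is dominated on all sets. -/
theorem measure_le_of_forall_Icc_le {m n : Measure ℝ} [IsLocallyFiniteMeasure n]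
    (hm : m ≪ volume) (h : ∀ x y, x ≤ y → m (Icc x y) ≤ n (Icc x y)) : m ≤ n := by
  rw [Measure.le_iff']
  intro s
  -- Closed balls of the line are intervals, so the Besicovitch covering theorem passes from
  -- intervals to all sets.
  refine (Besicovitch.vitaliFamily (volume : Measure ℝ)).measure_le_of_frequently_le n hm s
    fun x _ => ?_
  refine (Besicovitch.tendsto_filterAt volume x).frequently (Eventually.frequently ?_)
  filter_upwards [self_mem_nhdsWithin] with r hr
  rw [Real.closedBall_eq_Icc]
  have : (0 : ℝ) < r := hr
  exact h _ _ (by linarith)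

/-- The integral of `ρ` over a curve whose increments are controlled by the integral of `G` is at
most the integral of `ρ G` with respect to the parameter. -/
theorem lintegral_naturalParameterization_le {c : ℝ → Y} [MeasurableSpace Y] [BorelSpace Y]
    (hc : Continuous c) {G : ℝ → ℝ≥0∞}
    (hG : Measurable G) {l : ℝ} (hl : 0 ≤ l) (hfin : ∫⁻ u in Icc 0 l, G u < ∞)
    (h : ∀ x ∈ Icc 0 l, ∀ y ∈ Icc 0 l, x ≤ y → edist (c x) (c y) ≤ ∫⁻ u in Icc x y, G u)
    {ρ : Y → ℝ≥0∞} (hρ : Measurable ρ) :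
    ∫⁻ σ in Icc 0 (eVariationOn c (Icc 0 l)).toReal, ρ (naturalParameterization c (Icc 0 l) 0 σ) ≤
      ∫⁻ s in Icc 0 l, ρ (c s) * G s := by
  have hsub : ∀ x ∈ Icc 0 l, ∀ y ∈ Icc 0 l,
      eVariationOn c (Icc x y) ≤ ∫⁻ u in Icc x y, G u := fun x hx y hy =>
    eVariationOn_Icc_le_lintegral fun p hp q hq hpq =>
      h p ⟨hx.1.trans hp.1, hp.2.trans hy.2⟩ q ⟨hx.1.trans hq.1, hq.2.trans hy.2⟩ hpq
  have h0 : (0 : ℝ) ∈ Icc 0 l := left_mem_Icc.2 hl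
  have h1 : l ∈ Icc 0 l := right_mem_Icc.2 hl
  have hv : BoundedVariationOn c (Icc 0 l) := ((hsub 0 h0 l h1).trans_lt hfin).ne
  have hlv := hv.locallyBoundedVariationOn
  have him := image_variationOnFromTo_Icc hl hc.continuousOn hv
  set L := (eVariationOn c (Icc 0 l)).toReal
  set V := variationOnFromTo c (Icc 0 l) 0
  have hVm : MonotoneOn V (Icc 0 l) := variationOnFromTo.monotoneOn hlv h0
  let V' : ℝ → ℝ := fun s => V (projIcc 0 l hl s)
  have hV'm : Monotone V' := fun s t hst =>
    hVm (projIcc 0 l hl s).2 (projIcc 0 l hl t).2 (monotone_projIcc hl hst)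
  have hV'e : ∀ s ∈ Icc 0 l, V' s = V s := fun s hs => by simp [V', projIcc_of_mem hl hs]
  let ν : Measure ℝ := (volume.restrict (Icc 0 l)).withDensity G
  have : IsFiniteMeasure ν := isFiniteMeasure_withDensity hfin.ne
  have : IsFiniteMeasure (ν.map V') := Measure.isFiniteMeasure_map _ _
  -- Arc length is dominated by the image of `G ds` under the variation function: the interval from
  -- `V s` to `V t` has as length the variation of `c` on `[s, t]`, which is at most the integral of
  -- `G` there.
  have hle : (volume.restrict (Icc 0 L) : Measure ℝ) ≤ ν.map V' := by
    refine measure_le_of_forall_Icc_le Measure.absolutelyContinuous_restrict ?_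
    intro x y hxy
    rw [Measure.restrict_apply measurableSet_Icc, Icc_inter_Icc]
    rcases lt_or_ge (y ⊓ L) (x ⊔ 0) with hlt | hge
    · rw [Icc_eq_empty (not_le.2 hlt)]; simp
    have hxm : x ⊔ 0 ∈ Icc 0 L := ⟨le_sup_right, hge.trans inf_le_right⟩
    have hym : y ⊓ L ∈ Icc 0 L := ⟨le_sup_right.trans hge, inf_le_right⟩
    obtain ⟨s, hs, hsx⟩ := him.symm ▸ hxm
    obtain ⟨t, ht, hty⟩ := him.symm ▸ hym
    rw [Measure.map_apply hV'm.measurable measurableSet_Icc]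
    rcases lt_or_ge t s with hts | hst
    · have : y ⊓ L = x ⊔ 0 := le_antisymm (by rw [← hsx, ← hty]; exact hVm ht hs hts.le) hge
      rw [this]; simp
    calc volume (Icc (x ⊔ 0) (y ⊓ L)) = ENNReal.ofReal (V t - V s) := by
          rw [Real.volume_Icc, hty, hsx]
      _ ≤ ∫⁻ u in Icc s t, G u := by
          have e : V t - V s = variationOnFromTo c (Icc 0 l) s t :=
            variationOnFromTo.sub_right hlv h0 ht hs
          have e2 : Icc 0 l ∩ Icc s t = Icc s t :=
            inter_eq_right.2 (Icc_subset_Icc hs.1 ht.2)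
          rw [e, variationOnFromTo.eq_of_le _ _ hst, ENNReal.ofReal_toReal (hlv s t hs ht), e2]
          exact hsub s hs t ht
      _ ≤ ν (V' ⁻¹' Icc x y) := by
          rw [withDensity_apply _ (hV'm.measurable measurableSet_Icc),
            Measure.restrict_restrict (hV'm.measurable measurableSet_Icc)]
          refine lintegral_mono_set fun u hu => ?_
          have hu' : u ∈ Icc 0 l := ⟨hs.1.trans hu.1, hu.2.trans ht.2⟩
          refine ⟨?_, hu'⟩
          rw [mem_preimage, hV'e u hu']
          exact ⟨(le_sup_left.trans hsx.ge).trans (hVm hs hu' hu.1),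
            (hVm hu' ht hu.2).trans (hty.le.trans inf_le_left)⟩
  calc ∫⁻ σ in Icc 0 L, ρ (naturalParameterization c (Icc 0 l) 0 σ)
      ≤ ∫⁻ σ, ρ (naturalParameterization c (Icc 0 l) 0 σ) ∂(ν.map V') :=
        lintegral_mono' hle le_rfl
    _ ≤ ∫⁻ s, ρ (naturalParameterization c (Icc 0 l) 0 (V' s)) ∂ν := lintegral_map_le _ _
    _ = ∫⁻ s, ρ (c s) ∂ν := by
        refine lintegral_congr_ae ?_
        have : ∀ᵐ s ∂(volume.restrict (Icc 0 l)), s ∈ Icc 0 l := ae_restrict_mem measurableSet_Icc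
        filter_upwards [withDensity_absolutelyContinuous _ G this] with s hs
        rw [hV'e s hs, edist_eq_zero.1 (edist_naturalParameterization_eq_zero hlv h0 hs)]
    _ = ∫⁻ s in Icc 0 l, ρ (c s) * G s := by
        rw [lintegral_withDensity_eq_lintegral_mul _ hG (g := fun s => ρ (c s))
          (hρ.comp hc.measurable)]
        simp only [Pi.mul_apply, mul_comm]

/-- Arc length parametrization is invariant under monotone reparametrization. -/
theorem naturalParameterization_comp_of_monotoneOn {c : ℝ → Y} {v : ℝ → ℝ} {l : ℝ} (hl : 0 ≤ l)
    (hab : a ≤ b)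
    (hvm : MonotoneOn v (Icc a b)) (hva : v a = 0) (him : v '' Icc a b = Icc 0 l)
    (hc : ContinuousOn c (Icc 0 l)) (hbv : BoundedVariationOn c (Icc 0 l))
    (hγ : EqOn γ (c ∘ v) (Icc a b)) {σ : ℝ}
    (hσ : σ ∈ Icc 0 (eVariationOn c (Icc 0 l)).toReal) :
    naturalParameterization γ (Icc a b) a σ = naturalParameterization c (Icc 0 l) 0 σ := by
  have hlv := hbv.locallyBoundedVariationOn
  have h0 : (0 : ℝ) ∈ Icc 0 l := left_mem_Icc.2 hl
  have ha : a ∈ Icc a b := left_mem_Icc.2 hab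
  obtain ⟨s, hs, rfl⟩ := (image_variationOnFromTo_Icc hl hc hbv).symm ▸ hσ
  obtain ⟨t, ht, rfl⟩ := him.symm ▸ hs
  have hγv : BoundedVariationOn γ (Icc a b) := by
    unfold BoundedVariationOn
    rw [eVariationOn.congr hγ, eVariationOn.comp_eq_of_monotoneOn _ _ hvm, him]
    exact hbv
  have e : variationOnFromTo γ (Icc a b) a t = variationOnFromTo c (Icc 0 l) 0 (v t) := by
    have h1 := variationOnFromTo.comp_eq_of_monotoneOn c v hvm ha ht
    rw [him, hva] at h1
    rw [← h1, variationOnFromTo.eq_of_le _ _ ht.1, variationOnFromTo.eq_of_le _ _ ht.1,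
      eVariationOn.congr (hγ.mono inter_subset_left)]
  have h2 := edist_eq_zero.1
    (edist_naturalParameterization_eq_zero hγv.locallyBoundedVariationOn ha ht)
  rw [e] at h2
  rw [h2, edist_eq_zero.1 (edist_naturalParameterization_eq_zero hlv h0 hs)]
  exact hγ ht

end ArcLength

/-! ### Elementary properties of modulus. -/

section Modulus

variable {Y : Type*} [MetricSpace Y] [MeasurableSpace Y]

theorem modulus_mono (μ : Measure Y) {Γ Γ' : Set (IntervalPath Y)} (h : Γ ⊆ Γ') :
    modulus μ Γ ≤ modulus μ Γ' :=
  le_iInf₂ fun ρ hρ => iInf₂_le ρ ⟨hρ.1, fun γ hγ => hρ.2 γ (h hγ)⟩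

theorem IntervalPath.Icc_subset_dom {Y : Type*} [TopologicalSpace Y] (γ : IntervalPath Y) {a b : ℝ}
    (ha : a ∈ γ.dom) (hb : b ∈ γ.dom) : Icc a b ⊆ γ.dom := γ.ordConnected.out ha hb

theorem IntervalPath.LocallyRectifiable.boundedVariationOn {Y : Type*} [MetricSpace Y] {γ : IntervalPath Y}
    (h : γ.LocallyRectifiable) {a b : ℝ} (ha : a ∈ γ.dom) (hb : b ∈ γ.dom) :
    BoundedVariationOn γ.toFun (Icc a b) := by
  have := h a b ha hb
  rwa [inter_eq_right.2 (γ.Icc_subset_dom ha hb)] at this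

theorem IntervalPath.compactIntegral_le_lineIntegral {Y : Type*} [MetricSpace Y]
    (γ : IntervalPath Y) (ρ : Y → ℝ≥0∞) {a b : ℝ}
    (ha : a ∈ γ.dom) (hb : b ∈ γ.dom) (hab : a ≤ b) :
    γ.compactIntegral ρ a b ≤ γ.lineIntegral ρ :=
  le_iSup₂_of_le a ha (le_iSup₂_of_le b hb (le_iSup_of_le hab le_rfl))

/-- The constant density `d⁻¹` on `G` is admissible, because each joining path has length at least
`d`. -/
theorem modulus_joiningPaths_le (μ : Measure Y) {E F G : Set Y} (hG : MeasurableSet G) {d : ℝ≥0∞}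
    (hd : d ≠ 0) (hd' : d ≠ ∞) (h : ∀ x ∈ E, ∀ y ∈ F, d ≤ edist x y) :
    modulus μ (joiningPaths E F G) ≤ μ G / d ^ 2 := by
  refine (iInf₂_le (G.indicator fun _ => d⁻¹) ⟨measurable_const.indicator hG, ?_⟩).trans ?_
  swap
  · rintro γ ⟨hγG, ⟨_, ⟨s, hs, rfl⟩, hsE⟩, ⟨_, ⟨t, ht, rfl⟩, htF⟩⟩ hrect
    have key : ∀ a ∈ γ.dom, ∀ b ∈ γ.dom, a ≤ b → d ≤ edist (γ.toFun a) (γ.toFun b) →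
        1 ≤ γ.lineIntegral (G.indicator fun _ => d⁻¹) := by
      intro a ha b hb hab hdist
      refine le_trans ?_ (γ.compactIntegral_le_lineIntegral _ ha hb hab)
      have hbv := hrect.boundedVariationOn ha hb
      obtain ⟨c, -, hc, hceq, -⟩ := exists_arcLength_extension hab
        (γ.continuousOn.mono (γ.Icc_subset_dom ha hb)) hbv
      have : γ.compactIntegral (G.indicator fun _ => d⁻¹) a b =
          ∫⁻ _ in Icc (0 : ℝ) (eVariationOn γ.toFun (Icc a b)).toReal, d⁻¹ := by
        refine setLIntegral_congr_fun measurableSet_Icc fun u hu => ?_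
        rw [hceq u hu, indicator_of_mem]
        exact hγG (image_mono (γ.Icc_subset_dom ha hb) (hc u))
      rw [this, setLIntegral_const, Real.volume_Icc, sub_zero, ENNReal.ofReal_toReal hbv]
      calc (1 : ℝ≥0∞) = d⁻¹ * d := (ENNReal.inv_mul_cancel hd hd').symm
        _ ≤ d⁻¹ * eVariationOn γ.toFun (Icc a b) := by
            gcongr
            exact hdist.trans
              (eVariationOn.edist_le _ (left_mem_Icc.2 hab) (right_mem_Icc.2 hab))
    rcases le_total s t with hst | hst
    · exact key s hs t ht hst (h _ hsE _ htF)
    · exact key t ht s hs hst (by rw [edist_comm]; exact h _ hsE _ htF)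
  · have : (fun y => (G.indicator (fun _ => d⁻¹) y) ^ 2) = G.indicator fun _ => (d ^ 2)⁻¹ := by
      ext y
      by_cases hy : y ∈ G
      · simp [hy, ENNReal.inv_pow]
      · simp [hy]
    rw [this, lintegral_indicator hG, setLIntegral_const, mul_comm, div_eq_mul_inv]

theorem IntervalPath.one_le_lineIntegral_const_mul {Y : Type*} [MetricSpace Y]
    (γ : IntervalPath Y) {ρ : Y → ℝ≥0∞}
    (h : γ.lineIntegral ρ = ∞) {ε : ℝ≥0∞} (hε : ε ≠ 0) (hε' : ε ≠ ∞) :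
    1 ≤ γ.lineIntegral fun y => ε * ρ y := by
  have hlt : ε⁻¹ < γ.lineIntegral ρ := by rw [h]; exact ENNReal.inv_lt_top.2 (pos_iff_ne_zero.2 hε)
  simp only [IntervalPath.lineIntegral, lt_iSup_iff] at hlt
  obtain ⟨a, ha, b, hb, hab, hlt⟩ := hlt
  refine le_trans ?_ (γ.compactIntegral_le_lineIntegral _ ha hb hab)
  unfold IntervalPath.compactIntegral at hlt ⊢
  rw [lintegral_const_mul' _ _ hε', ← ENNReal.mul_inv_cancel hε hε']
  gcongr

/-- The paths over which a square integrable function has infinite integral form a family of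
modulus zero. -/
theorem modulus_eq_zero_of_lineIntegral_eq_top (μ : Measure Y) {Γ : Set (IntervalPath Y)}
    {ρ : Y → ℝ≥0∞} (hρ : Measurable ρ) (hfin : ∫⁻ y, ρ y ^ 2 ∂μ ≠ ∞)
    (h : ∀ γ ∈ Γ, γ.lineIntegral ρ = ∞) : modulus μ Γ = 0 := by
  -- Every multiple `ε ρ` is admissible, an infinite integral remaining infinite after scaling.
  have key : ∀ ε : ℝ≥0, 0 < ε → modulus μ Γ ≤ (ε : ℝ≥0∞) ^ 2 * ∫⁻ y, ρ y ^ 2 ∂μ := by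
    intro ε hε
    have hε0 : (ε : ℝ≥0∞) ≠ 0 := by exact_mod_cast hε.ne'
    refine (iInf₂_le (fun y => (ε : ℝ≥0∞) * ρ y) ⟨hρ.const_mul _, fun γ hγ _ =>
      γ.one_le_lineIntegral_const_mul (h γ hγ) hε0 ENNReal.coe_ne_top⟩).trans_eq ?_
    simp only [mul_pow]
    rw [lintegral_const_mul' _ _ (by simp)]
  have hlim : Tendsto (fun ε : ℝ≥0 => (ε : ℝ≥0∞) ^ 2 * ∫⁻ y, ρ y ^ 2 ∂μ) (𝓝[>] 0) (𝓝 0) := by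
    have : Tendsto (fun ε : ℝ≥0 => (ε : ℝ≥0∞) ^ 2 * ∫⁻ y, ρ y ^ 2 ∂μ) (𝓝 0)
        (𝓝 ((0 : ℝ≥0∞) ^ 2 * ∫⁻ y, ρ y ^ 2 ∂μ)) := by
      refine ENNReal.Tendsto.mul_const ?_ (Or.inr hfin)
      have h2 : Continuous fun ε : ℝ≥0 => ((ε ^ 2 : ℝ≥0) : ℝ≥0∞) :=
        ENNReal.continuous_coe.comp (continuous_pow 2)
      simpa using h2.tendsto 0
    simp only [ne_eq, OfNat.ofNat_ne_zero, not_false_eq_true, zero_pow, zero_mul] at this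
    exact this.mono_left nhdsWithin_le_nhds
  refine le_antisymm (ge_of_tendsto hlim ?_) bot_le
  filter_upwards [self_mem_nhdsWithin] with ε hε using key ε hε

theorem IntervalPath.lineIntegral_map_val {Y : Type*} [MetricSpace Y] {A : Set Y}
    (γ : IntervalPath A) (ρ : Y → ℝ≥0∞) :
    (γ.map Subtype.val continuous_subtype_val).lineIntegral ρ =
      γ.lineIntegral fun y => ρ y := rfl

end Modulus

/-! ### Two integral inequalities: Cauchy–Schwarz and averaging over windows. -/

section Integrals

theorem sq_lintegral_le {α : Type*} [MeasurableSpace α] (μ : Measure α) {f : α → ℝ≥0∞}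
    (hf : AEMeasurable f μ) : (∫⁻ x, f x ∂μ) ^ 2 ≤ μ univ * ∫⁻ x, f x ^ 2 ∂μ := by
  have h := ENNReal.lintegral_mul_le_Lp_mul_Lq μ Real.HolderConjugate.two_two hf
    (aemeasurable_const (b := (1 : ℝ≥0∞)))
  simp only [Pi.mul_apply, mul_one, ENNReal.one_rpow, lintegral_const, one_mul] at h
  calc (∫⁻ x, f x ∂μ) ^ 2
      ≤ ((∫⁻ x, f x ^ (2 : ℝ) ∂μ) ^ (1 / 2 : ℝ) * μ univ ^ (1 / 2 : ℝ)) ^ 2 := by gcongr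
    _ = μ univ * ∫⁻ x, f x ^ 2 ∂μ := by
        rw [mul_pow, ← ENNReal.rpow_mul_natCast, ← ENNReal.rpow_mul_natCast]
        norm_num [mul_comm]

/-- Tonelli: each `t` in `[c, d]` lies in the window around `s` for all `s` in `[t - ρ, t + ρ]`, a
set of length `2 ρ` contained in the outer domain. -/
theorem lintegral_le_lintegral_average {q : ℝ → ℝ≥0∞} {c d ρ : ℝ}
    (hq : AEMeasurable q (volume.restrict (Icc c d))) :
    ENNReal.ofReal (2 * ρ) * ∫⁻ t in Icc c d, q t ≤
      ∫⁻ s in Icc (c - ρ) (d + ρ), ∫⁻ t in Icc (s - ρ) (s + ρ) ∩ Icc c d, q t := by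
  let S : Set (ℝ × ℝ) := {p | |p.1 - p.2| ≤ ρ}
  have hS : MeasurableSet S :=
    (isClosed_le (by fun_prop) continuous_const).measurableSet
  have hF : AEMeasurable (Function.uncurry fun s t : ℝ => S.indicator (fun p => q p.2) (s, t))
      ((volume.restrict (Icc (c - ρ) (d + ρ))).prod (volume.restrict (Icc c d))) :=
    (hq.comp_quasiMeasurePreserving Measure.quasiMeasurePreserving_snd).indicator hS
  have h1 : ∀ s, ∫⁻ t in Icc (s - ρ) (s + ρ) ∩ Icc c d, q t =
      ∫⁻ t in Icc c d, S.indicator (fun p => q p.2) (s, t) := fun s => by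
    rw [← Measure.restrict_restrict measurableSet_Icc, ← lintegral_indicator measurableSet_Icc]
    refine lintegral_congr fun t => ?_
    have : t ∈ Icc (s - ρ) (s + ρ) ↔ (s, t) ∈ S := by
      simp only [S, mem_ofPred_eq, mem_Icc, abs_le]
      constructor <;> rintro ⟨h1, h2⟩ <;> constructor <;> linarith
    by_cases h : t ∈ Icc (s - ρ) (s + ρ)
    · rw [indicator_of_mem h, indicator_of_mem (this.1 h)]
    · rw [indicator_of_notMem h, indicator_of_notMem (fun h' => h (this.2 h'))]
  simp only [h1]
  rw [lintegral_lintegral_swap hF, ← lintegral_const_mul' _ _ ENNReal.ofReal_ne_top]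
  refine setLIntegral_mono' measurableSet_Icc fun t ht => le_of_eq ?_
  have h2 : ∀ s, S.indicator (fun p => q p.2) (s, t) =
      (Icc (t - ρ) (t + ρ)).indicator (fun _ => q t) s := fun s => by
    have : s ∈ Icc (t - ρ) (t + ρ) ↔ (s, t) ∈ S := by
      simp only [S, mem_ofPred_eq, mem_Icc, abs_le]
      constructor <;> rintro ⟨h1, h2⟩ <;> constructor <;> linarith
    by_cases h : s ∈ Icc (t - ρ) (t + ρ)
    · rw [indicator_of_mem h, indicator_of_mem (this.1 h)]
    · rw [indicator_of_notMem h, indicator_of_notMem (fun h' => h (this.2 h'))]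
  simp only [h2]
  rw [lintegral_indicator measurableSet_Icc, setLIntegral_const,
    Measure.restrict_apply measurableSet_Icc, inter_eq_left.2, Real.volume_Icc, mul_comm]
  · congr 2; ring
  · exact Icc_subset_Icc (by linarith [ht.1]) (by linarith [ht.2])

end Integrals

/-! ### Mean densities on squares, which are the closed balls of the sup metric on `ℝ × ℝ`. -/

section Densities

/-- The mean density of `μ` on the square with center `y` and side length `2 r`. -/
noncomputable def squareDensity (μ : Measure (ℝ × ℝ)) (r : ℝ) (y : ℝ × ℝ) : ℝ≥0∞ :=
  μ (Metric.closedBall y r) / ENNReal.ofReal (4 * r ^ 2)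

/-- The upper density of `μ` at `y` with respect to centered squares. -/
noncomputable def upperDensity (μ : Measure (ℝ × ℝ)) (y : ℝ × ℝ) : ℝ≥0∞ :=
  limsup (fun r => squareDensity μ r y) (𝓝[>] 0)

theorem measurable_measure_closedBall (μ : Measure (ℝ × ℝ)) [SFinite μ] (r : ℝ) :
    Measurable fun y => μ (Metric.closedBall y r) := by
  have : MeasurableSet {p : (ℝ × ℝ) × (ℝ × ℝ) | dist p.2 p.1 ≤ r} :=
    (isClosed_le (by fun_prop) continuous_const).measurableSet
  exact measurable_measure_prodMk_left this

theorem measurable_squareDensity (μ : Measure (ℝ × ℝ)) [SFinite μ] (r : ℝ) :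
    Measurable (squareDensity μ r) :=
  (measurable_measure_closedBall μ r).div_const _

theorem volume_closedBall_prod (y : ℝ × ℝ) {r : ℝ} (hr : 0 ≤ r) :
    volume (Metric.closedBall y r) = ENNReal.ofReal (4 * r ^ 2) := by
  rw [← closedBall_prod_same, Measure.volume_eq_prod, Measure.prod_prod, Real.volume_closedBall,
    Real.volume_closedBall, ← ENNReal.ofReal_mul (by linarith)]
  congr 1; ring

/-- Tonelli for the symmetric relation `dist ≤ r`: each point of mass is counted on a square of area
`4 r²`. -/
theorem lintegral_squareDensity (μ : Measure (ℝ × ℝ)) [SFinite μ] {r : ℝ} (hr : 0 < r) :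
    ∫⁻ y, squareDensity μ r y = μ univ := by
  have hS : MeasurableSet {p : (ℝ × ℝ) × (ℝ × ℝ) | dist p.2 p.1 ≤ r} :=
    (isClosed_le (by fun_prop) continuous_const).measurableSet
  have h0 : ENNReal.ofReal (4 * r ^ 2) ≠ 0 := by simpa using by positivity
  unfold squareDensity
  simp only [div_eq_mul_inv]
  rw [lintegral_mul_const _ (measurable_measure_closedBall μ r)]
  have h1 : ∫⁻ y : ℝ × ℝ, μ (Metric.closedBall y r) =
      (volume.prod μ) {p : (ℝ × ℝ) × (ℝ × ℝ) | dist p.2 p.1 ≤ r} := by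
    rw [Measure.prod_apply hS]; rfl
  have h2 : (volume.prod μ) {p : (ℝ × ℝ) × (ℝ × ℝ) | dist p.2 p.1 ≤ r} =
      ∫⁻ z, ENNReal.ofReal (4 * r ^ 2) ∂μ := by
    rw [Measure.prod_apply_symm hS]
    refine lintegral_congr fun z => ?_
    rw [← volume_closedBall_prod z hr.le]
    congr 1
    ext y
    simp [dist_comm]
  rw [h1, h2, lintegral_const, mul_comm, ← mul_assoc,
    ENNReal.inv_mul_cancel h0 ENNReal.ofReal_ne_top, one_mul]

/-- Square roots of mean densities have no concentration of mass in the limit. -/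
theorem limsup_lintegral_sqrt_squareDensity_le (μ : Measure (ℝ × ℝ)) [IsFiniteMeasure μ] (C : ℝ≥0)
    {S : Set (ℝ × ℝ)} (hfin : volume S ≠ ∞) {r : ℕ → ℝ}
    (hr : Tendsto r atTop (𝓝[>] 0)) :
    limsup (fun n => ∫⁻ y in S, (C * squareDensity μ (r n) y) ^ (1 / 2 : ℝ)) atTop ≤
      ∫⁻ y in S, (C * upperDensity μ y) ^ (1 / 2 : ℝ) := by
  have hpos : ∀ᶠ n in atTop, 0 < r n := hr.eventually self_mem_nhdsWithin
  let h : ℕ → ℝ × ℝ → ℝ≥0∞ := fun n y => (C * squareDensity μ (r n) y) ^ (1 / 2 : ℝ)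
  have hmeas : ∀ n, Measurable (h n) := fun n =>
    ((measurable_squareDensity μ (r n)).const_mul _).pow_const _
  have hlim : ∀ y, limsup (fun n => h n y) atTop ≤ (C * upperDensity μ y) ^ (1 / 2 : ℝ) := by
    intro y
    have h1 : limsup (fun n => squareDensity μ (r n) y) atTop ≤ upperDensity μ y :=
      limsup_le_limsup_of_le (f := map r atTop) (u := fun r => squareDensity μ r y) hr
        (by isBoundedDefault) (by isBoundedDefault)
    have hm : Monotone fun x : ℝ≥0∞ => (C * x) ^ (1 / 2 : ℝ) := fun a b hab => by
      simp only; gcongr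
    have hc : Continuous fun x : ℝ≥0∞ => (C * x) ^ (1 / 2 : ℝ) :=
      ENNReal.continuous_rpow_const.comp (ENNReal.continuous_const_mul ENNReal.coe_ne_top)
    calc limsup (fun n => h n y) atTop
        = (C * limsup (fun n => squareDensity μ (r n) y) atTop) ^ (1 / 2 : ℝ) :=
          (hm.map_limsup_of_continuousAt (fun n => squareDensity μ (r n) y) hc.continuousAt).symm
      _ ≤ _ := hm h1
  have hsq : ∀ᶠ n in atTop, ∫⁻ y, h n y ^ 2 ≤ C * μ univ := by
    filter_upwards [hpos] with n hn
    have : ∀ y, h n y ^ 2 = C * squareDensity μ (r n) y := fun y => by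
      simp only [h]
      rw [← ENNReal.rpow_mul_natCast]; norm_num
    simp only [this]
    rw [lintegral_const_mul' _ _ ENNReal.coe_ne_top, lintegral_squareDensity μ hn]
  -- Truncate at `M`. Where `h n` exceeds `M` it is at most `(h n)² / M`, which contributes at most
  -- `C μ(univ) / M` uniformly in `n`. The truncated functions are dominated by a constant on a set
  -- of finite area, so the reverse Fatou lemma applies to them.
  have key : ∀ M : ℝ≥0, 0 < M → limsup (fun n => ∫⁻ y in S, h n y) atTop ≤
      (∫⁻ y in S, (C * upperDensity μ y) ^ (1 / 2 : ℝ)) + C * μ univ * (M : ℝ≥0∞)⁻¹ := by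
    intro M hM
    have hM0 : (M : ℝ≥0∞) ≠ 0 := by exact_mod_cast hM.ne'
    have h1 : ∀ᶠ n in atTop, ∫⁻ y in S, h n y ≤
        (∫⁻ y in S, min (h n y) M) + C * μ univ * (M : ℝ≥0∞)⁻¹ := by
      filter_upwards [hsq] with n hn
      calc ∫⁻ y in S, h n y ≤ ∫⁻ y in S, (min (h n y) M + h n y ^ 2 * (M : ℝ≥0∞)⁻¹) := by
            refine lintegral_mono fun y => ?_
            rcases le_total (h n y) M with hle | hle
            · rw [min_eq_left hle]; exact le_self_add
            · refine le_trans ?_ le_add_self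
              calc h n y = h n y * (M * (M : ℝ≥0∞)⁻¹) := by
                    rw [ENNReal.mul_inv_cancel hM0 ENNReal.coe_ne_top, mul_one]
                _ ≤ h n y * (h n y * (M : ℝ≥0∞)⁻¹) := by gcongr
                _ = _ := by ring
        _ = (∫⁻ y in S, min (h n y) M) + (∫⁻ y in S, h n y ^ 2) * (M : ℝ≥0∞)⁻¹ := by
            rw [lintegral_add_left ((hmeas n).min measurable_const),
              lintegral_mul_const _ ((hmeas n).pow_const 2)]
        _ ≤ _ := by
            gcongr
            exact (setLIntegral_le_lintegral _ _).trans hn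
    calc limsup (fun n => ∫⁻ y in S, h n y) atTop
        ≤ limsup (fun n => (∫⁻ y in S, min (h n y) M) + C * μ univ * (M : ℝ≥0∞)⁻¹) atTop :=
          limsup_le_limsup h1
      _ = limsup (fun n => (∫⁻ y in S, min (h n y) M)) atTop + C * μ univ * (M : ℝ≥0∞)⁻¹ := by
          refine (Monotone.map_limsup_of_continuousAt (f := fun x => x +
            C * μ univ * (M : ℝ≥0∞)⁻¹) (fun a b hab => by simp only; gcongr)
            (fun n => (∫⁻ y in S, min (h n y) M)) ?_).symm
          exact (continuous_id.add continuous_const).continuousAt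
      _ ≤ _ := by
          gcongr
          refine (limsup_lintegral_le (μ := volume.restrict S) (fun _ => (M : ℝ≥0∞))
            (fun n => (hmeas n).min measurable_const)
            (fun n => Eventually.of_forall fun y => min_le_right _ _) ?_).trans ?_
          · rw [setLIntegral_const]; exact ENNReal.mul_ne_top ENNReal.coe_ne_top hfin
          · refine lintegral_mono fun y => le_trans ?_ (hlim y)
            exact limsup_le_limsup (Eventually.of_forall fun n => min_le_left _ _)
  have hlim2 : Tendsto (fun M : ℕ => (∫⁻ y in S, (C * upperDensity μ y) ^ (1 / 2 : ℝ)) +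
      C * μ univ * (((M : ℕ) : ℝ≥0) : ℝ≥0∞)⁻¹) atTop
      (𝓝 ((∫⁻ y in S, (C * upperDensity μ y) ^ (1 / 2 : ℝ)) + C * μ univ * 0)) := by
    refine Tendsto.const_add _ (ENNReal.Tendsto.const_mul ?_ (Or.inr
      (ENNReal.mul_ne_top ENNReal.coe_ne_top (measure_ne_top _ _))))
    simpa using ENNReal.tendsto_inv_nat_nhds_zero
  rw [mul_zero, add_zero] at hlim2
  refine ge_of_tendsto hlim2 ?_
  filter_upwards [eventually_gt_atTop 0] with M hM using key M (by exact_mod_cast hM)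

end Densities

/-! ### From the rectangle inequality to infinitesimal bounds for mean increments. -/

section HorizontalBound

variable {X : Type*} [MetricSpace X]

/-- The distance of the images of the vertical sides of a rectangle `R` in `D` is controlled by the
measure of `R`, with the scaling of conformal modulus. -/
def HorizontalBound (D : Set (ℝ × ℝ)) (f : ℝ × ℝ → X) (μ : Measure (ℝ × ℝ)) (C : ℝ≥0) : Prop :=
  ∀ a b c d : ℝ, a < b → c < d → Icc a b ×ˢ Icc c d ⊆ D → ∀ δ : ℝ≥0∞,
    (∀ t ∈ Icc c d, ∀ t' ∈ Icc c d, δ ≤ edist (f (a, t)) (f (b, t'))) →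
    δ ^ 2 * ENNReal.ofReal (d - c) ≤ C * ENNReal.ofReal (b - a) * μ (Icc a b ×ˢ Icc c d)

variable {D : Set (ℝ × ℝ)} {f : ℝ × ℝ → X} {μ : Measure (ℝ × ℝ)} {C : ℝ≥0}

/-- On a strip where `f` oscillates little along the two vertical sides, the supremum of the
truncated increments is a lower bound for all distances between points of these sides, so it may
serve as `δ`. -/
theorem HorizontalBound.lintegral_truncated_le_of_small (h : HorizontalBound D f μ C)
    {a b s t : ℝ} (hab : a < b) (hst : s ≤ t) (hD : Icc a b ×ˢ Icc s t ⊆ D) {η : ℝ≥0∞}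
    (hη : ∀ u ∈ Icc s t, ∀ u' ∈ Icc s t, ∀ u'' ∈ Icc s t,
      edist (f (a, u)) (f (b, u)) - η ≤ edist (f (a, u')) (f (b, u''))) :
    ∫⁻ u in Ioc s t, (edist (f (a, u)) (f (b, u)) - η) ^ 2 ≤
      C * ENNReal.ofReal (b - a) * μ (Icc a b ×ˢ Ioc s t) := by
  let S : ℝ≥0∞ := ⨆ u ∈ Icc s t, (edist (f (a, u)) (f (b, u)) - η)
  have hS : ∀ u' ∈ Icc s t, ∀ u'' ∈ Icc s t, S ≤ edist (f (a, u')) (f (b, u'')) :=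
    fun u' hu' u'' hu'' => iSup₂_le fun u hu => hη u hu u' hu' u'' hu''
  have hSfin : S ≠ ∞ := ((hS s (left_mem_Icc.2 hst) s (left_mem_Icc.2 hst)).trans_lt
    (edist_lt_top _ _)).ne
  have h1 : ∫⁻ u in Ioc s t, (edist (f (a, u)) (f (b, u)) - η) ^ 2 ≤
      S ^ 2 * ENNReal.ofReal (t - s) := by
    rw [← Real.volume_Ioc, ← setLIntegral_const]
    refine setLIntegral_mono' measurableSet_Ioc fun u hu => ?_
    gcongr
    exact le_iSup₂_of_le u (Ioc_subset_Icc_self hu) le_rfl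
  refine h1.trans ?_
  rcases hst.eq_or_lt with rfl | hlt
  · simp
  -- The hypothesis concerns closed rectangles, but strips that are to be added must be disjoint
  -- since `μ` may charge horizontal segments. The half-open strip is exhausted by closed ones as
  -- `s'` decreases to `s`.
  have h2 : Tendsto (fun s' => S ^ 2 * ENNReal.ofReal (t - s')) (𝓝[>] s)
      (𝓝 (S ^ 2 * ENNReal.ofReal (t - s))) := by
    refine ENNReal.Tendsto.const_mul ?_ (Or.inr (by finiteness))
    exact ((ENNReal.continuous_ofReal.comp (continuous_const.sub continuous_id)).tendsto
      s).mono_left nhdsWithin_le_nhds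
  refine le_of_tendsto h2 ?_
  filter_upwards [Ioo_mem_nhdsGT hlt] with s' hs'
  have hsub : Icc s' t ⊆ Icc s t := Icc_subset_Icc_left hs'.1.le
  refine (h a b s' t hab hs'.2 ((prod_mono_right hsub).trans hD) S
    fun u hu u' hu' => hS u (hsub hu) u' (hsub hu')).trans ?_
  gcongr
  exact hs'.1

/-- Uniform continuity makes thin strips satisfy the oscillation condition, `η` absorbing `η / 2`
from each side. Both members of the inequality are additive over half-open strips. -/
theorem HorizontalBound.lintegral_truncated_le (h : HorizontalBound D f μ C)
    (hf : ContinuousOn f D) {a b c d : ℝ} (hab : a < b) (hD : Icc a b ×ˢ Icc c d ⊆ D)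
    {η : ℝ≥0∞} (hη : η ≠ 0) :
    ∫⁻ u in Ioc c d, (edist (f (a, u)) (f (b, u)) - η) ^ 2 ≤
      C * ENNReal.ofReal (b - a) * μ (Icc a b ×ˢ Ioc c d) := by
  have hcont : ∀ x ∈ Icc a b, ContinuousOn (fun u => f (x, u)) (Icc c d) := fun x hx =>
    hf.comp (by fun_prop) fun u hu => hD ⟨hx, hu⟩
  have hη2 : 0 < η / 2 := ENNReal.half_pos hη
  obtain ⟨δ, hδ, hunif⟩ : ∃ δ > 0, ∀ x ∈ ({a, b} : Set ℝ), ∀ u ∈ Icc c d, ∀ u' ∈ Icc c d,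
      |u - u'| ≤ δ → edist (f (x, u)) (f (x, u')) ≤ η / 2 := by
    have aux : ∀ x ∈ Icc a b, ∃ δ > 0, ∀ u ∈ Icc c d, ∀ u' ∈ Icc c d, |u - u'| ≤ δ →
        edist (f (x, u)) (f (x, u')) ≤ η / 2 := by
      intro x hx
      have hu := isCompact_Icc.uniformContinuousOn_of_continuous (hcont x hx)
      rw [EMetric.uniformContinuousOn_iff] at hu
      obtain ⟨δ, hδ, hu⟩ := hu (η / 2) hη2
      obtain ⟨δ', hδ', hlt⟩ := ENNReal.lt_iff_exists_nnreal_btwn.1 hδ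
      refine ⟨δ', by exact_mod_cast hδ', fun u hu1 u' hu2 hle => (hu hu1 hu2 ?_).le⟩
      refine lt_of_le_of_lt ?_ hlt
      rw [edist_dist, Real.dist_eq]
      exact ENNReal.ofReal_le_of_le_toReal (by simpa using hle)
    obtain ⟨δ₁, h1, h1'⟩ := aux a (left_mem_Icc.2 hab.le)
    obtain ⟨δ₂, h2, h2'⟩ := aux b (right_mem_Icc.2 hab.le)
    refine ⟨min δ₁ δ₂, lt_min h1 h2, ?_⟩
    rintro x (rfl | rfl) u hu u' hu' hle
    · exact h1' u hu u' hu' (hle.trans (min_le_left _ _))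
    · exact h2' u hu u' hu' (hle.trans (min_le_right _ _))
  -- Bisect `n` times to reach height at most `δ`.
  have key : ∀ n : ℕ, ∀ s t, s ≤ t → Icc s t ⊆ Icc c d → t - s ≤ 2 ^ n * δ →
      ∫⁻ u in Ioc s t, (edist (f (a, u)) (f (b, u)) - η) ^ 2 ≤
        C * ENNReal.ofReal (b - a) * μ (Icc a b ×ˢ Ioc s t) := by
    intro n
    induction n with
    | zero =>
      intro s t hst hsub hle
      rw [pow_zero, one_mul] at hle
      refine h.lintegral_truncated_le_of_small hab hst ((prod_mono_right hsub).trans hD) ?_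
      intro u hu u' hu' u'' hu''
      have hclose : ∀ v ∈ Icc s t, ∀ v' ∈ Icc s t, |v - v'| ≤ δ := fun v hv v' hv' => by
        rw [abs_le]; constructor <;> linarith [hv.1, hv.2, hv'.1, hv'.2]
      rw [tsub_le_iff_right]
      calc edist (f (a, u)) (f (b, u))
          ≤ edist (f (a, u)) (f (a, u')) + edist (f (a, u')) (f (b, u'')) +
              edist (f (b, u'')) (f (b, u)) := edist_triangle4 _ _ _ _
        _ ≤ η / 2 + edist (f (a, u')) (f (b, u'')) + η / 2 := by
            gcongr
            · exact hunif a (by simp) u (hsub hu) u' (hsub hu') (hclose _ hu _ hu')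
            · exact hunif b (by simp) u'' (hsub hu'') u (hsub hu) (hclose _ hu'' _ hu)
        _ = edist (f (a, u')) (f (b, u'')) + (η / 2 + η / 2) := by ring
        _ = _ := by rw [ENNReal.add_halves]
    | succ n ih =>
      intro s t hst hsub hle
      have hle' : t - s ≤ 2 * (2 ^ n * δ) := by rw [pow_succ] at hle; linarith
      have hsm : s ≤ (s + t) / 2 := by linarith
      have hmt : (s + t) / 2 ≤ t := by linarith
      have i1 := ih s ((s + t) / 2) hsm ((Icc_subset_Icc_right hmt).trans hsub) (by linarith)
      have i2 := ih ((s + t) / 2) t hmt ((Icc_subset_Icc_left hsm).trans hsub) (by linarith)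
      rw [← Ioc_union_Ioc_eq_Ioc hsm hmt, lintegral_union measurableSet_Ioc
        (Ioc_disjoint_Ioc_of_le le_rfl), prod_union, measure_union _
        (measurableSet_Icc.prod measurableSet_Ioc), mul_add]
      · exact add_le_add i1 i2
      · exact Disjoint.set_prod_right (Ioc_disjoint_Ioc_of_le le_rfl) _ _
  rcases lt_or_ge d c with hdc | hcd
  · rw [Ioc_eq_empty (not_lt.2 hdc.le)]; simp
  obtain ⟨n, hn⟩ := pow_unbounded_of_one_lt ((d - c) / δ) (one_lt_two)
  exact key n c d hcd Subset.rfl ((div_lt_iff₀ hδ).1 hn).le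

/-- Let the truncation level `1 / n` tend to zero and apply Fatou's lemma. -/
theorem HorizontalBound.lintegral_sq_le (h : HorizontalBound D f μ C)
    (hf : ContinuousOn f D) {a b c d : ℝ} (hab : a < b) (hD : Icc a b ×ˢ Icc c d ⊆ D) :
    ∫⁻ u in Icc c d, edist (f (a, u)) (f (b, u)) ^ 2 ≤
      C * ENNReal.ofReal (b - a) * μ (Icc a b ×ˢ Icc c d) := by
  have hcont : ∀ x ∈ Icc a b, ContinuousOn (fun u => f (x, u)) (Icc c d) := fun x hx =>
    hf.comp (by fun_prop) fun u hu => hD ⟨hx, hu⟩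
  have hw : AEMeasurable (fun u => edist (f (a, u)) (f (b, u))) (volume.restrict (Ioc c d)) := by
    have : ContinuousOn (fun u => edist (f (a, u)) (f (b, u))) (Icc c d) := fun u hu =>
      ((hcont a (left_mem_Icc.2 hab.le) u hu).edist (hcont b (right_mem_Icc.2 hab.le) u hu))
    exact (this.mono Ioc_subset_Icc_self).aemeasurable measurableSet_Ioc
  have hlim : ∀ u, Tendsto (fun n : ℕ => (edist (f (a, u)) (f (b, u)) - (n : ℝ≥0∞)⁻¹) ^ 2) atTop
      (𝓝 (edist (f (a, u)) (f (b, u)) ^ 2)) := fun u => by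
    have := ENNReal.Tendsto.sub (tendsto_const_nhds (x := edist (f (a, u)) (f (b, u))))
      ENNReal.tendsto_inv_nat_nhds_zero (Or.inl (edist_ne_top _ _))
    rw [tsub_zero] at this
    exact ENNReal.Tendsto.pow this
  rw [← restrict_Ioc_eq_restrict_Icc]
  calc ∫⁻ u in Ioc c d, edist (f (a, u)) (f (b, u)) ^ 2
      = ∫⁻ u in Ioc c d,
          liminf (fun n : ℕ => (edist (f (a, u)) (f (b, u)) - (n : ℝ≥0∞)⁻¹) ^ 2) atTop :=
        lintegral_congr fun u => (hlim u).liminf_eq.symm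
    _ ≤ liminf (fun n : ℕ => ∫⁻ u in Ioc c d,
          (edist (f (a, u)) (f (b, u)) - (n : ℝ≥0∞)⁻¹) ^ 2) atTop :=
        lintegral_liminf_le' fun n => (hw.sub_const _).pow_const 2
    _ ≤ liminf (fun _ : ℕ => C * ENNReal.ofReal (b - a) * μ (Icc a b ×ˢ Icc c d)) atTop := by
        refine liminf_le_liminf (Eventually.of_forall fun n => ?_)
        refine (h.lintegral_truncated_le hf hab hD (by simp)).trans ?_
        gcongr
        exact Ioc_subset_Icc_self
    _ = _ := by simp

/-- Mean value estimate for the horizontal increments over the squares with side length `2 ρ`. -/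
theorem HorizontalBound.lintegral_edist_le (h : HorizontalBound D f μ C)
    (hf : ContinuousOn f D) {x s ρ : ℝ} (hρ : 0 < ρ) (hD : Metric.closedBall (x + ρ, s) ρ ⊆ D) :
    ∫⁻ t in Icc (s - ρ) (s + ρ), edist (f (x, t)) (f (x + 2 * ρ, t)) ≤
      ENNReal.ofReal (2 * ρ) ^ 2 * (C * squareDensity μ ρ (x + ρ, s)) ^ (1 / 2 : ℝ) := by
  have hball : Metric.closedBall (x + ρ, s) ρ = Icc x (x + 2 * ρ) ×ˢ Icc (s - ρ) (s + ρ) := by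
    rw [← closedBall_prod_same, Real.closedBall_eq_Icc, Real.closedBall_eq_Icc]
    congr 2 <;> ring
  have hx : x < x + 2 * ρ := by linarith
  rw [hball] at hD
  have h1 := h.lintegral_sq_le hf hx hD
  have hcont : ∀ y ∈ Icc x (x + 2 * ρ), ContinuousOn (fun u => f (y, u)) (Icc (s - ρ) (s + ρ)) :=
    fun y hy => hf.comp (by fun_prop) fun u hu => hD ⟨hy, hu⟩
  have hw : AEMeasurable (fun t => edist (f (x, t)) (f (x + 2 * ρ, t)))
      (volume.restrict (Icc (s - ρ) (s + ρ))) := by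
    have : ContinuousOn (fun t => edist (f (x, t)) (f (x + 2 * ρ, t))) (Icc (s - ρ) (s + ρ)) :=
      fun u hu => ((hcont x (left_mem_Icc.2 hx.le) u hu).edist
        (hcont _ (right_mem_Icc.2 hx.le) u hu))
    exact this.aemeasurable measurableSet_Icc
  have h2 := sq_lintegral_le _ hw
  have h0 : ENNReal.ofReal (4 * ρ ^ 2) ≠ 0 := by simpa using by positivity
  have hsq : ENNReal.ofReal (4 * ρ ^ 2) = ENNReal.ofReal (2 * ρ) ^ 2 := by
    rw [← ENNReal.ofReal_pow (by positivity)]; congr 1; ring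
  have hvol : volume.restrict (Icc (s - ρ) (s + ρ)) univ = ENNReal.ofReal (2 * ρ) := by
    rw [Measure.restrict_apply_univ, Real.volume_Icc]; congr 1; ring
  have hμ : μ (Icc x (x + 2 * ρ) ×ˢ Icc (s - ρ) (s + ρ)) =
      squareDensity μ ρ (x + ρ, s) * ENNReal.ofReal (2 * ρ) ^ 2 := by
    rw [squareDensity, ← hball, ← hsq, ENNReal.div_mul_cancel h0 ENNReal.ofReal_ne_top]
  have hr : x + 2 * ρ - x = 2 * ρ := by ring
  rw [hμ, hr] at h1
  rw [hvol] at h2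
  -- Compare squares: Cauchy–Schwarz costs a factor `2 ρ`, the `L²` bound gives another, and `μ` of
  -- the square is its density times `(2 ρ)²`.
  rw [← ENNReal.pow_le_pow_left_iff two_ne_zero]
  calc _ ≤ ENNReal.ofReal (2 * ρ) * (C * ENNReal.ofReal (2 * ρ) *
        (squareDensity μ ρ (x + ρ, s) * ENNReal.ofReal (2 * ρ) ^ 2)) := h2.trans (by gcongr)
    _ = (ENNReal.ofReal (2 * ρ) ^ 2) ^ 2 * (C * squareDensity μ ρ (x + ρ, s)) := by ring
    _ = _ := by
      rw [mul_pow, ← ENNReal.rpow_mul_natCast]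
      norm_num

/-- On each vertical line, average over windows of length `2 ρ` and use the estimate on the square
centered at `(x + ρ, s)`; a translation by `ρ` then centers the densities. The centers lie within `ε
+ ρ` of `z`, so the squares stay within `ε + 2 ρ`. -/
theorem HorizontalBound.lintegral_closedBall_edist_le [SFinite μ] (h : HorizontalBound D f μ C)
    (hf : ContinuousOn f D) {z : ℝ × ℝ} {ε ρ : ℝ} (hρ : 0 < ρ)
    (hD : Metric.closedBall z (ε + 2 * ρ) ⊆ D) :
    ∫⁻ y in Metric.closedBall z ε, edist (f y) (f (y + (2 * ρ, 0))) ≤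
      ENNReal.ofReal (2 * ρ) *
        ∫⁻ y in Metric.closedBall z (ε + 2 * ρ), (C * squareDensity μ ρ y) ^ (1 / 2 : ℝ) := by
  obtain ⟨z₁, z₂⟩ := z
  have hbox : ∀ e, Metric.closedBall (z₁, z₂) e = Icc (z₁ - e) (z₁ + e) ×ˢ Icc (z₂ - e) (z₂ + e) :=
    fun e => by rw [← closedBall_prod_same, Real.closedBall_eq_Icc, Real.closedBall_eq_Icc]
  have h2ρ : ENNReal.ofReal (2 * ρ) ≠ 0 := by simpa using hρ
  let H : ℝ × ℝ → ℝ≥0∞ := fun y => (C * squareDensity μ ρ y) ^ (1 / 2 : ℝ)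
  have hH : Measurable H := ((measurable_squareDensity μ ρ).const_mul _).pow_const _
  have hq : ContinuousOn (fun y => edist (f y) (f (y + (2 * ρ, 0))))
      (Metric.closedBall (z₁, z₂) ε) := by
    have hm1 : MapsTo (fun y : ℝ × ℝ => y) (Metric.closedBall (z₁, z₂) ε) D := fun y hy =>
      hD (Metric.closedBall_subset_closedBall (by linarith) hy)
    have hm2 : MapsTo (fun y : ℝ × ℝ => y + (2 * ρ, 0)) (Metric.closedBall (z₁, z₂) ε) D :=
      fun y hy => by
        apply hD
        rw [hbox, mem_prod, mem_Icc, mem_Icc] at hy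
        rw [hbox, mem_prod, mem_Icc, mem_Icc]
        simp only [Prod.fst_add, Prod.snd_add]
        refine ⟨⟨?_, ?_⟩, ?_, ?_⟩ <;> linarith [hy.1.1, hy.1.2, hy.2.1, hy.2.2]
    exact fun y hy => ((hf.comp continuousOn_id hm1) y hy).edist
      ((hf.comp (by fun_prop) hm2) y hy)
  have hqm := hq.aemeasurable (μ := volume) Metric.isClosed_closedBall.measurableSet
  have hcont : ∀ x ∈ Icc (z₁ - ε) (z₁ + ε),
      ContinuousOn (fun t => edist (f (x, t)) (f (x + 2 * ρ, t))) (Icc (z₂ - ε) (z₂ + ε)) := by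
    intro x hx
    have := hq.comp (f := fun t : ℝ => (x, t)) (s := Icc (z₂ - ε) (z₂ + ε)) (by fun_prop)
      (fun t ht => by rw [hbox]; exact ⟨hx, ht⟩)
    simpa [Function.comp_def] using this
  have hinner : ∀ x ∈ Icc (z₁ - ε) (z₁ + ε),
      ∫⁻ t in Icc (z₂ - ε) (z₂ + ε), edist (f (x, t)) (f (x + 2 * ρ, t)) ≤
        ENNReal.ofReal (2 * ρ) * ∫⁻ s in Icc (z₂ - ε - ρ) (z₂ + ε + ρ), H (x + ρ, s) := by
    intro x hx
    have h1 := lintegral_le_lintegral_average (ρ := ρ) ((hcont x hx).aemeasurable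
      (μ := volume) measurableSet_Icc)
    have h2 : ∫⁻ s in Icc (z₂ - ε - ρ) (z₂ + ε + ρ),
          ∫⁻ t in Icc (s - ρ) (s + ρ) ∩ Icc (z₂ - ε) (z₂ + ε),
            edist (f (x, t)) (f (x + 2 * ρ, t)) ≤
        ∫⁻ s in Icc (z₂ - ε - ρ) (z₂ + ε + ρ), ENNReal.ofReal (2 * ρ) ^ 2 * H (x + ρ, s) := by
      refine setLIntegral_mono' measurableSet_Icc fun s hs => ?_
      refine (lintegral_mono_set inter_subset_left).trans (h.lintegral_edist_le hf hρ ?_)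
      refine Subset.trans ?_ hD
      refine Metric.closedBall_subset_closedBall' ?_
      have : dist (x + ρ, s) (z₁, z₂) ≤ ε + ρ := by
        rw [Prod.dist_eq, max_le_iff, Real.dist_eq, Real.dist_eq, abs_le, abs_le]
        refine ⟨⟨?_, ?_⟩, ?_, ?_⟩ <;> simp only <;> linarith [hx.1, hx.2, hs.1, hs.2]
      linarith
    rw [lintegral_const_mul' _ _ (by finiteness)] at h2
    have h3 := h1.trans h2
    rw [pow_two, mul_assoc] at h3
    exact (ENNReal.mul_le_mul_iff_right h2ρ ENNReal.ofReal_ne_top).1 h3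
  have e1 : ∫⁻ y in Metric.closedBall (z₁, z₂) ε, edist (f y) (f (y + (2 * ρ, 0))) =
      ∫⁻ x in Icc (z₁ - ε) (z₁ + ε), ∫⁻ t in Icc (z₂ - ε) (z₂ + ε),
        edist (f (x, t)) (f (x + 2 * ρ, t)) := by
    rw [hbox, Measure.volume_eq_prod, ← Measure.prod_restrict] at hqm
    rw [hbox, Measure.volume_eq_prod, ← Measure.prod_restrict, lintegral_prod _ hqm]
    simp
  have e2 : ∫⁻ x in Icc (z₁ - ε) (z₁ + ε), ∫⁻ s in Icc (z₂ - ε - ρ) (z₂ + ε + ρ), H (x + ρ, s) =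
      ∫⁻ y in Icc (z₁ - ε) (z₁ + ε) ×ˢ Icc (z₂ - ε - ρ) (z₂ + ε + ρ), H (y + (ρ, 0)) := by
    rw [Measure.volume_eq_prod, ← Measure.prod_restrict, lintegral_prod]
    · simp
    · exact (hH.comp (measurable_id.add_const _)).aemeasurable
  rw [e1]
  refine (setLIntegral_mono' measurableSet_Icc hinner).trans ?_
  rw [lintegral_const_mul' _ _ ENNReal.ofReal_ne_top, e2]
  refine mul_le_mul' le_rfl ?_
  have hmp := measurePreserving_add_right (volume : Measure (ℝ × ℝ)) (ρ, 0)
  rw [← hmp.setLIntegral_comp_preimage Metric.isClosed_closedBall.measurableSet hH]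
  refine lintegral_mono_set fun y hy => ?_
  rw [mem_preimage, hbox, mem_prod, mem_Icc, mem_Icc]
  simp only [Prod.fst_add, Prod.snd_add]
  rw [mem_prod, mem_Icc, mem_Icc] at hy
  refine ⟨⟨?_, ?_⟩, ?_, ?_⟩ <;> linarith [hy.1.1, hy.1.2, hy.2.1, hy.2.2]

/-- Infinitesimal bound for the mean horizontal increments over a square. -/
theorem HorizontalBound.frequently_lintegral_edist_lt [IsFiniteMeasure μ]
    (h : HorizontalBound D f μ C) (hf : ContinuousOn f D) (hDo : IsOpen D) {z : ℝ × ℝ} {ε : ℝ}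
    (hD : Metric.closedBall z ε ⊆ D)
    (hloc : ∫⁻ y in Metric.closedBall z (ε + 1), (C * upperDensity μ y) ^ (1 / 2 : ℝ) ≠ ∞)
    {A : ℝ≥0∞}
    (hA : ∫⁻ y in Metric.closedBall z ε, (C * upperDensity μ y) ^ (1 / 2 : ℝ) < A) :
    ∃ᶠ r in 𝓝[>] (0 : ℝ), ∫⁻ y in Metric.closedBall z ε, edist (f y) (f (y + (r, 0))) ≤
      ENNReal.ofReal r * A := by
  let G : ℝ × ℝ → ℝ≥0∞ := fun y => (C * upperDensity μ y) ^ (1 / 2 : ℝ)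
  obtain ⟨e, he, heD⟩ : ∃ e > 0, Metric.closedBall z (ε + e) ⊆ D := by
    obtain ⟨e, he, hsub⟩ := (isCompact_closedBall z ε).exists_cthickening_subset_open hDo hD
    rcases lt_or_ge ε 0 with hneg | hnn
    · refine ⟨-ε / 2, by linarith, ?_⟩
      rw [Metric.closedBall_eq_empty.2 (by linarith)]; exact empty_subset _
    · refine ⟨e, he, ?_⟩
      rwa [cthickening_closedBall he.le hnn, add_comm] at hsub
  -- The integral of `G` over slightly larger squares is still below `A`, by continuity from above
  -- of a finite measure. This leaves room for the enlargement by `2 ρ`.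
  obtain ⟨k, hk0, hk1, hke, hkA⟩ : ∃ k > 0, k ≤ 1 ∧ k ≤ e ∧
      ∫⁻ y in Metric.closedBall z (ε + k), G y < A := by
    let s : ℕ → Set (ℝ × ℝ) := fun n => Metric.closedBall z (ε + 1 / ((n : ℝ) + 1))
    have hs : Antitone s := fun m n hmn =>
      Metric.closedBall_subset_closedBall (by gcongr)
    have hint : ⋂ n, s n = Metric.closedBall z ε := by
      refine Subset.antisymm (fun y hy => ?_) (subset_iInter fun n =>
        Metric.closedBall_subset_closedBall (by simp only [le_add_iff_nonneg_right]; positivity))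
      rw [Metric.mem_closedBall]
      have : Tendsto (fun n : ℕ => ε + 1 / ((n : ℝ) + 1)) atTop (𝓝 (ε + 0)) :=
        tendsto_one_div_add_atTop_nhds_zero_nat.const_add ε
      rw [add_zero] at this
      exact ge_of_tendsto' this fun n => mem_iInter.1 hy n
    let ν := (volume.restrict (Metric.closedBall z (ε + 1))).withDensity G
    have hν : IsFiniteMeasure ν := isFiniteMeasure_withDensity hloc
    have hνs : ∀ e' ≤ 1, ν (Metric.closedBall z (ε + e')) =
        ∫⁻ y in Metric.closedBall z (ε + e'), G y := fun e' he' => by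
      rw [withDensity_apply _ Metric.isClosed_closedBall.measurableSet,
        Measure.restrict_restrict Metric.isClosed_closedBall.measurableSet, inter_eq_left.2]
      exact Metric.closedBall_subset_closedBall (by linarith)
    have hlim := tendsto_measure_iInter_atTop (μ := ν) (s := s)
      (fun n => Metric.isClosed_closedBall.measurableSet.nullMeasurableSet) hs
      ⟨0, measure_ne_top _ _⟩
    have h0 := hνs 0 zero_le_one
    rw [add_zero] at h0
    rw [hint, h0] at hlim
    have hev := (hlim.eventually_lt_const hA).and
      ((tendsto_one_div_add_atTop_nhds_zero_nat (𝕜 := ℝ)).eventually_lt_const he)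
    obtain ⟨n, hn1, hn2⟩ := hev.exists
    have hle1 : 1 / ((n : ℝ) + 1) ≤ 1 := by
      rw [div_le_one (by positivity)]; linarith [(Nat.cast_nonneg n : (0 : ℝ) ≤ n)]
    refine ⟨1 / ((n : ℝ) + 1), by positivity, hle1, hn2.le, ?_⟩
    rw [← hνs _ hle1]; exact hn1
  let r : ℕ → ℝ := fun n => 1 / ((n : ℝ) + 1)
  have hr : Tendsto r atTop (𝓝[>] 0) := tendsto_nhdsWithin_iff.2
    ⟨tendsto_one_div_add_atTop_nhds_zero_nat, Eventually.of_forall fun n => by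
      simp only [r, mem_Ioi]; positivity⟩
  have hlt : limsup (fun n => ∫⁻ y in Metric.closedBall z (ε + k),
      (C * squareDensity μ (r n) y) ^ (1 / 2 : ℝ)) atTop < A :=
    (limsup_lintegral_sqrt_squareDensity_le μ C
      (isCompact_closedBall z (ε + k)).measure_lt_top.ne hr).trans_lt hkA
  have hev : ∀ᶠ n in atTop, ∫⁻ y in Metric.closedBall z ε, edist (f y) (f (y + (2 * r n, 0))) ≤
      ENNReal.ofReal (2 * r n) * A := by
    have hsmall : ∀ᶠ n in atTop, r n < k / 2 :=
      (tendsto_one_div_add_atTop_nhds_zero_nat (𝕜 := ℝ)).eventually_lt_const (by linarith)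
    filter_upwards [eventually_lt_of_limsup_lt hlt, hsmall] with n hn hn2
    have hrn : 0 < r n := by simp only [r]; positivity
    refine (h.lintegral_closedBall_edist_le hf hrn
      ((Metric.closedBall_subset_closedBall (by linarith)).trans heD)).trans ?_
    gcongr
    exact (lintegral_mono_set (Metric.closedBall_subset_closedBall (by linarith))).trans hn.le
  have h2r : Tendsto (fun n => 2 * r n) atTop (𝓝[>] 0) := by
    refine tendsto_nhdsWithin_iff.2 ⟨?_, Eventually.of_forall fun n => by
      simp only [r, mem_Ioi]; positivity⟩
    simpa [r] using (tendsto_one_div_add_atTop_nhds_zero_nat (𝕜 := ℝ)).const_mul 2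
  exact h2r.frequently hev.frequently

end HorizontalBound

/-! ### Measurability of the upper density and differentiation of measures. -/

section UpperDensity

/-- Rational radii suffice: the measure of the square increases with the radius and `4 r²` is
continuous, so a rational radius slightly above `r` loses arbitrarily little. This makes the upper
density Borel. -/
theorem upperDensity_eq_iInf_iSup (μ : Measure (ℝ × ℝ)) (y : ℝ × ℝ) :
    upperDensity μ y =
      ⨅ n : ℕ, ⨆ q : ℚ, ⨆ _ : 0 < (q : ℝ) ∧ (q : ℝ) < 1 / ((n : ℝ) + 1), squareDensity μ q y := by
  rw [upperDensity, (nhdsGT_basis (0 : ℝ)).limsup_eq_iInf_iSup]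
  apply le_antisymm
  · refine le_iInf fun n => (iInf₂_le (1 / ((n : ℝ) + 1)) (by positivity)).trans ?_
    refine iSup₂_le fun r hr => ?_
    by_contra! hlt
    have hc : Tendsto (fun x : ℝ => μ (Metric.closedBall y r) / ENNReal.ofReal (4 * x ^ 2)) (𝓝[>] r)
        (𝓝 (squareDensity μ r y)) := by
      have h4 : 0 < 4 * r ^ 2 := by have := hr.1; positivity
      refine ENNReal.Tendsto.const_div ?_ (Or.inl ENNReal.ofReal_ne_top)
      have : Continuous fun x : ℝ => ENNReal.ofReal (4 * x ^ 2) :=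
        ENNReal.continuous_ofReal.comp (by fun_prop)
      exact (this.tendsto r).mono_left nhdsWithin_le_nhds
    have hev := (hc.eventually_const_lt hlt).and (Ioo_mem_nhdsGT hr.2)
    obtain ⟨b, hb, hsub⟩ := mem_nhdsGT_iff_exists_Ioo_subset.1 hev
    obtain ⟨q, hq1, hq2⟩ := exists_rat_btwn (show r < b from hb)
    obtain ⟨h1, h2⟩ := hsub ⟨hq1, hq2⟩
    refine absurd h1 (not_lt.2 ?_)
    refine le_trans ?_ (le_iSup₂_of_le q ⟨hr.1.trans hq1, h2.2⟩ le_rfl)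
    unfold squareDensity
    gcongr
  · refine le_iInf₂ fun r hr => ?_
    obtain ⟨n, hn⟩ := exists_nat_one_div_lt hr
    refine (iInf_le _ n).trans (iSup₂_le fun q hq => ?_)
    exact le_iSup₂_of_le (q : ℝ) ⟨hq.1, hq.2.trans hn⟩ le_rfl

theorem measurable_upperDensity (μ : Measure (ℝ × ℝ)) [SFinite μ] : Measurable (upperDensity μ) := by
  have : upperDensity μ = fun y => ⨅ n : ℕ, ⨆ q : ℚ,
      ⨆ _ : 0 < (q : ℝ) ∧ (q : ℝ) < 1 / ((n : ℝ) + 1), squareDensity μ q y :=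
    funext (upperDensity_eq_iInf_iSup μ)
  rw [this]
  exact Measurable.iInf fun n => Measurable.iSup fun q => Measurable.iSup fun _ =>
    measurable_squareDensity μ q

theorem upperDensity_ae_eq_rnDeriv (μ : Measure (ℝ × ℝ)) [IsFiniteMeasure μ] :
    upperDensity μ =ᵐ[volume] μ.rnDeriv volume := by
  filter_upwards [Besicovitch.ae_tendsto_rnDeriv μ (volume : Measure (ℝ × ℝ))] with y hy
  rw [← hy.limsup_eq, upperDensity]
  refine limsup_congr ?_
  filter_upwards [self_mem_nhdsWithin] with r hr
  rw [squareDensity, volume_closedBall_prod y (le_of_lt hr)]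

/-- The upper density is almost everywhere the Radon–Nikodym derivative, so only the singular part
of `μ` is lost. -/
theorem withDensity_upperDensity_le (μ : Measure (ℝ × ℝ)) [IsFiniteMeasure μ] :
    (volume : Measure (ℝ × ℝ)).withDensity (upperDensity μ) ≤ μ := by
  rw [withDensity_congr_ae (upperDensity_ae_eq_rnDeriv μ)]
  exact Measure.withDensity_rnDeriv_le μ volume

theorem lintegral_sqrt_upperDensity_sq_ne_top (μ : Measure (ℝ × ℝ)) [IsFiniteMeasure μ] (C : ℝ≥0) :
    ∫⁻ y, ((C * upperDensity μ y) ^ (1 / 2 : ℝ)) ^ 2 ≠ ∞ := by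
  have : ∀ y, ((C * upperDensity μ y) ^ (1 / 2 : ℝ)) ^ 2 = C * upperDensity μ y := fun y => by
    rw [← ENNReal.rpow_mul_natCast]; norm_num
  simp only [this]
  rw [lintegral_const_mul' _ _ ENNReal.coe_ne_top]
  refine ENNReal.mul_ne_top ENNReal.coe_ne_top ?_
  rw [← setLIntegral_univ, ← withDensity_apply _ MeasurableSet.univ]
  exact ((Measure.le_iff'.1 (withDensity_upperDensity_le μ) univ).trans_lt
    (measure_lt_top μ univ)).ne

theorem upperDensity_congr {μ ν : Measure (ℝ × ℝ)} {U : Set (ℝ × ℝ)} (hU : IsOpen U)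
    (h : ∀ S ⊆ U, μ S = ν S) {y : ℝ × ℝ} (hy : y ∈ U) : upperDensity μ y = upperDensity ν y := by
  obtain ⟨r, hr, hsub⟩ := Metric.nhds_basis_closedBall.mem_iff.1 (hU.mem_nhds hy)
  refine limsup_congr ?_
  filter_upwards [Ioo_mem_nhdsGT hr] with s hs
  rw [squareDensity, squareDensity,
    h _ ((Metric.closedBall_subset_closedBall hs.2.le).trans hsub)]

theorem upperDensity_map_swap (μ : Measure (ℝ × ℝ)) (y : ℝ × ℝ) :
    upperDensity (μ.map Prod.swap) y = upperDensity μ y.swap := by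
  refine limsup_congr (Eventually.of_forall fun r => ?_)
  rw [squareDensity, squareDensity,
    Measure.map_apply measurable_swap Metric.isClosed_closedBall.measurableSet]
  congr 2
  ext z
  simp [Prod.dist_eq, and_comm]

end UpperDensity

/-! ### Pointwise control of averages over small squares. -/

section Averages

theorem squareDensity_withDensity (φ : ℝ × ℝ → ℝ≥0∞) (r : ℝ) (y : ℝ × ℝ) :
    squareDensity (volume.withDensity φ) r y =
      (∫⁻ z in Metric.closedBall y r, φ z) / ENNReal.ofReal (4 * r ^ 2) := by
  rw [squareDensity, withDensity_apply _ Metric.isClosed_closedBall.measurableSet]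

theorem squareDensity_withDensity_sq_le {φ : ℝ × ℝ → ℝ≥0∞} (hφ : Measurable φ) {r : ℝ} (hr : 0 < r)
    (y : ℝ × ℝ) : squareDensity (volume.withDensity φ) r y ^ 2 ≤
      squareDensity (volume.withDensity fun z => φ z ^ 2) r y := by
  have h0 : ENNReal.ofReal (4 * r ^ 2) ≠ 0 := by simpa using by positivity
  simp only [squareDensity_withDensity]
  have h := sq_lintegral_le (volume.restrict (Metric.closedBall y r)) hφ.aemeasurable
  rw [Measure.restrict_apply_univ, volume_closedBall_prod y hr.le] at h
  set V := ENNReal.ofReal (4 * r ^ 2)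
  have hV : V ≠ ∞ := ENNReal.ofReal_ne_top
  rw [div_eq_mul_inv, div_eq_mul_inv, mul_pow]
  calc (∫⁻ z in Metric.closedBall y r, φ z) ^ 2 * V⁻¹ ^ 2
      ≤ (V * ∫⁻ z in Metric.closedBall y r, φ z ^ 2) * V⁻¹ ^ 2 := by gcongr
    _ = (V * V⁻¹) * ((∫⁻ z in Metric.closedBall y r, φ z ^ 2) * V⁻¹) := by ring
    _ = _ := by rw [ENNReal.mul_inv_cancel h0 hV, one_mul]

theorem lintegral_squareDensity_withDensity_sq_le {φ : ℝ × ℝ → ℝ≥0∞} (hφ : Measurable φ) {r : ℝ}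
    (hr : 0 < r) :
    ∫⁻ y, squareDensity (volume.withDensity φ) r y ^ 2 ≤ ∫⁻ y, φ y ^ 2 := by
  refine (lintegral_mono fun y => squareDensity_withDensity_sq_le hφ hr y).trans_eq ?_
  rw [lintegral_squareDensity _ hr, withDensity_apply _ MeasurableSet.univ, setLIntegral_univ]

/-- Approximation of a square integrable function by its averages over small squares. -/
theorem exists_average_le_add {h : ℝ × ℝ → ℝ≥0∞} (hm : Measurable h)
    (hfin : ∫⁻ y, h y ^ 2 ≠ ∞) {δ : ℝ} (hδ : 0 < δ) {η θ : ℝ≥0} (hη : 0 < η) (hθ : 0 < θ) :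
    ∃ r, 0 < r ∧ r < δ ∧ ∃ E : ℝ × ℝ → ℝ≥0∞, Measurable E ∧ ∫⁻ y, E y ^ 2 ≤ η ∧
      ∀ y, squareDensity (volume.withDensity h) r y ≤ h y + E y + θ := by
  let g : ℝ × ℝ → ℝ := fun y => (h y).toReal
  have hgm : Measurable g := hm.ennreal_toReal
  have hae : ∀ᵐ y, h y = ENNReal.ofReal (g y) := by
    have : ∀ᵐ y, h y ^ 2 < ∞ := ae_lt_top (hm.pow_const 2) hfin
    filter_upwards [this] with y hy
    rw [ENNReal.ofReal_toReal]
    rintro h'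
    rw [h'] at hy
    simp at hy
  have henorm : ∀ φ : ℝ × ℝ → ℝ, eLpNorm φ 2 volume =
      (∫⁻ y, ‖φ y‖ₑ ^ 2) ^ (1 / 2 : ℝ) := fun φ => by
    rw [eLpNorm_eq_lintegral_rpow_enorm_toReal two_ne_zero ENNReal.ofNat_ne_top]
    simp
  have hg : MemLp g 2 volume := by
    refine ⟨hgm.aestronglyMeasurable, ?_⟩
    rw [henorm]
    refine ENNReal.rpow_lt_top_of_nonneg (by norm_num) ?_
    refine ne_top_of_le_ne_top hfin (lintegral_mono fun y => ?_)
    gcongr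
    rw [Real.enorm_eq_ofReal ENNReal.toReal_nonneg]
    exact ENNReal.ofReal_toReal_le
  -- The error `E` is `e` plus its average. Squaring costs a factor `2` on each, and both have
  -- squared norm at most `η / 4`.
  let s : ℝ≥0∞ := ((η / 4 : ℝ≥0) : ℝ≥0∞) ^ (1 / 2 : ℝ)
  have hs : s ≠ 0 := by
    have : (0 : ℝ≥0) < η / 4 := by positivity
    simp only [s, ne_eq, ENNReal.rpow_eq_zero_iff, not_or, not_and_or]
    exact ⟨Or.inl (by exact_mod_cast this.ne'), Or.inr (by norm_num)⟩
  -- With `ψ` continuous of compact support and `e = |g - ψ|`, the average of `h` is at most `ψ y +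
  -- θ` plus the average of `e`, by uniform continuity of `ψ`, while `ψ y ≤ h y + e y`.
  obtain ⟨ψ, hψs, hψn, hψc, -⟩ := hg.exists_hasCompactSupport_eLpNorm_sub_le
    ENNReal.ofNat_ne_top hs
  let e : ℝ × ℝ → ℝ≥0∞ := fun y => ‖(g - ψ) y‖ₑ
  have hem : Measurable e := (hgm.sub hψc.measurable).enorm
  have hes : ∫⁻ y, e y ^ 2 ≤ ((η / 4 : ℝ≥0) : ℝ≥0∞) := by
    rw [henorm] at hψn
    exact (ENNReal.rpow_le_rpow_iff (by norm_num)).1 hψn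
  have hunif := hψs.uniformContinuous_of_continuous hψc
  obtain ⟨r₀, hr₀, hr₀'⟩ := Metric.uniformContinuous_iff.1 hunif θ (by exact_mod_cast hθ)
  let r := min r₀ δ / 2
  have hr : 0 < r := by positivity
  have hrr₀ : r < r₀ := by
    have := min_le_left r₀ δ
    have : 0 < min r₀ δ := by positivity
    simp only [r]; linarith
  have hrδ : r < δ := by
    have := min_le_right r₀ δ
    have : 0 < min r₀ δ := by positivity
    simp only [r]; linarith
  refine ⟨r, hr, hrδ, fun y => e y + squareDensity (volume.withDensity e) r y,
    hem.add (measurable_squareDensity _ r), ?_, fun y => ?_⟩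
  · have h2 : ∀ y, (e y + squareDensity (volume.withDensity e) r y) ^ 2 ≤
        2 * e y ^ 2 + 2 * squareDensity (volume.withDensity e) r y ^ 2 := fun y => by
      rw [← mul_add]
      have := ENNReal.rpow_add_le_mul_rpow_add_rpow (e y)
        (squareDensity (volume.withDensity e) r y) (p := 2) (by norm_num)
      norm_num at this
      exact this
    refine (lintegral_mono h2).trans ?_
    rw [lintegral_add_left ((hem.pow_const 2).const_mul 2), lintegral_const_mul' _ _ (by simp),
      lintegral_const_mul' _ _ (by simp)]
    calc _ ≤ 2 * ((η / 4 : ℝ≥0) : ℝ≥0∞) + 2 * ((η / 4 : ℝ≥0) : ℝ≥0∞) := by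
          gcongr
          exact (lintegral_squareDensity_withDensity_sq_le hem hr).trans hes
      _ = (η : ℝ≥0∞) := by
          have : 2 * (η / 4) + 2 * (η / 4) = η := by
            ext; push_cast; ring
          exact_mod_cast congr_arg ((↑) : ℝ≥0 → ℝ≥0∞) this
  · have h0 : ENNReal.ofReal (4 * r ^ 2) ≠ 0 := by simpa using by positivity
    have habs : ∀ a b : ℝ, ENNReal.ofReal a ≤ ENNReal.ofReal b + ‖a - b‖ₑ := fun a b => by
      rw [← ofReal_norm]
      refine le_trans ?_ ENNReal.ofReal_add_le
      exact ENNReal.ofReal_le_ofReal (by linarith [Real.le_norm_self (a - b)])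
    have h1 : ∫⁻ z in Metric.closedBall y r, h z ≤
        (ENNReal.ofReal (ψ y) + θ) * ENNReal.ofReal (4 * r ^ 2) +
          ∫⁻ z in Metric.closedBall y r, e z := by
      rw [← volume_closedBall_prod y hr.le, ← setLIntegral_const,
        ← lintegral_add_left measurable_const]
      refine lintegral_mono_ae ?_
      filter_upwards [ae_restrict_of_ae hae, ae_restrict_mem
        (Metric.isClosed_closedBall (x := y) (ε := r)).measurableSet] with z hz hzb
      rw [hz]
      refine (habs (g z) (ψ z)).trans ?_
      refine add_le_add ?_ le_rfl
      have hlt := hr₀' ((Metric.mem_closedBall.1 hzb).trans_lt hrr₀)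
      refine (habs (ψ z) (ψ y)).trans ?_
      gcongr
      rw [← ofReal_norm, ← dist_eq_norm]
      exact ENNReal.ofReal_le_of_le_toReal (by simpa using hlt.le)
    have h2 : ENNReal.ofReal (ψ y) ≤ h y + e y := by
      refine (habs (ψ y) (g y)).trans ?_
      refine add_le_add ENNReal.ofReal_toReal_le (le_of_eq ?_)
      simp only [e, Pi.sub_apply]
      rw [← enorm_neg, neg_sub]
    simp only [squareDensity_withDensity]
    set V := ENNReal.ofReal (4 * r ^ 2)
    have hV : V ≠ ∞ := ENNReal.ofReal_ne_top
    calc (∫⁻ z in Metric.closedBall y r, h z) / V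
        ≤ ((ENNReal.ofReal (ψ y) + θ) * V + ∫⁻ z in Metric.closedBall y r, e z) / V := by gcongr
      _ = ENNReal.ofReal (ψ y) + θ + (∫⁻ z in Metric.closedBall y r, e z) / V := by
          rw [ENNReal.add_div, ENNReal.mul_div_cancel_right h0 hV]
      _ ≤ h y + e y + θ + (∫⁻ z in Metric.closedBall y r, e z) / V := by gcongr
      _ = _ := by ring

/-- With squared errors of integral at most `8⁻ⁿ`, the series `∑ 4ⁿ Eₙ²` is integrable. Its square
root `ρ` satisfies `Eₙ ≤ 2⁻ⁿ ρ`, so one square integrable function controls the convergence of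
averages on all curves. -/
theorem exists_seq_average_le {h : ℝ × ℝ → ℝ≥0∞} (hm : Measurable h) (hfin : ∫⁻ y, h y ^ 2 ≠ ∞) :
    ∃ (r : ℕ → ℝ) (ρ : ℝ × ℝ → ℝ≥0∞), (∀ n, 0 < r n) ∧ Tendsto r atTop (𝓝 0) ∧ Measurable ρ ∧
      ∫⁻ y, ρ y ^ 2 ≠ ∞ ∧ ∀ n y, squareDensity (volume.withDensity h) (r n) y ≤
        h y + ((1 / 2 : ℝ≥0) ^ n : ℝ≥0) * ρ y + ((1 / 2 : ℝ≥0) ^ n : ℝ≥0) := by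
  have hpos : ∀ n : ℕ, (0 : ℝ≥0) < (1 / 2) ^ n := fun n => by positivity
  choose r hr0 hr1 E hEm hE hrE using fun n : ℕ => exists_average_le_add hm hfin
    (δ := 1 / ((n : ℝ) + 1)) (by positivity) (pow_pos (hpos n) 3) (hpos n)
  let S : ℝ × ℝ → ℝ≥0∞ := fun y => ∑' n, ((4 ^ n : ℝ≥0) : ℝ≥0∞) * E n y ^ 2
  have hSm : Measurable S := Measurable.tsum fun n => ((hEm n).pow_const 2).const_mul _
  have hsq : ∀ y, (S y ^ (1 / 2 : ℝ)) ^ 2 = S y := fun y => by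
    rw [← ENNReal.rpow_mul_natCast]; norm_num
  refine ⟨r, fun y => S y ^ (1 / 2 : ℝ), hr0, ?_, hSm.pow_const _, ?_, fun n y => ?_⟩
  · exact squeeze_zero (fun n => (hr0 n).le) (fun n => (hr1 n).le)
      tendsto_one_div_add_atTop_nhds_zero_nat
  · simp only [hsq, S]
    rw [lintegral_tsum fun n => (((hEm n).pow_const 2).const_mul _).aemeasurable]
    have hle : ∀ n : ℕ, ∫⁻ y, ((4 ^ n : ℝ≥0) : ℝ≥0∞) * E n y ^ 2 ≤
        (((1 / 2 : ℝ≥0) ^ n : ℝ≥0) : ℝ≥0∞) := fun n => by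
      rw [lintegral_const_mul' _ _ ENNReal.coe_ne_top]
      refine (mul_le_mul' le_rfl (hE n)).trans_eq ?_
      rw [← ENNReal.coe_mul]
      congr 1
      rw [← pow_mul, mul_comm n 3, pow_mul, ← mul_pow]
      norm_num
    refine ne_top_of_le_ne_top ?_ (ENNReal.tsum_le_tsum hle)
    exact ENNReal.tsum_coe_ne_top_iff_summable.2
      (NNReal.summable_geometric (by rw [div_lt_one] <;> norm_num))
  · refine (hrE n y).trans ?_
    gcongr
    have h1 : ((4 ^ n : ℝ≥0) : ℝ≥0∞) * E n y ^ 2 ≤ S y := ENNReal.le_tsum n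
    have h2 : ((2 ^ n : ℝ≥0) : ℝ≥0∞) * E n y ≤ S y ^ (1 / 2 : ℝ) := by
      rw [← ENNReal.pow_le_pow_left_iff two_ne_zero, hsq, mul_pow]
      convert h1 using 2
      rw [← ENNReal.coe_pow, ← pow_mul, mul_comm n 2, pow_mul]
      norm_num
    calc E n y = (((1 / 2 : ℝ≥0) ^ n : ℝ≥0) : ℝ≥0∞) * (((2 ^ n : ℝ≥0) : ℝ≥0∞) * E n y) := by
          rw [← mul_assoc, ← ENNReal.coe_mul, ← mul_pow]
          simp
      _ ≤ _ := by gcongr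

end Averages

/-! ### Integrals over moving and shrinking squares. -/

section SquareIntegrals

theorem setLIntegral_ne_top_of_lintegral_sq_ne_top {h : ℝ × ℝ → ℝ≥0∞} (hm : Measurable h)
    (hfin : ∫⁻ y, h y ^ 2 ≠ ∞) {S : Set (ℝ × ℝ)} (hS : volume S ≠ ∞) : ∫⁻ y in S, h y ≠ ∞ := by
  intro htop
  have := sq_lintegral_le (volume.restrict S) hm.aemeasurable
  rw [htop, Measure.restrict_apply_univ] at this
  have h2 : volume S * ∫⁻ y in S, h y ^ 2 < ∞ :=
    ENNReal.mul_lt_top hS.lt_top ((setLIntegral_le_lintegral _ _).trans_lt hfin.lt_top)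
  simp only [ne_eq, OfNat.ofNat_ne_zero, not_false_eq_true, ENNReal.top_pow, top_le_iff] at this
  exact h2.ne this

theorem exists_closedBall_add_subset {D : Set (ℝ × ℝ)} (hDo : IsOpen D) {z : ℝ × ℝ} {ε : ℝ}
    (hε : 0 ≤ ε) (hD : Metric.closedBall z ε ⊆ D) : ∃ e > 0, Metric.closedBall z (ε + e) ⊆ D := by
  obtain ⟨e, he, hsub⟩ := (isCompact_closedBall z ε).exists_cthickening_subset_open hDo hD
  refine ⟨e, he, ?_⟩
  rwa [cthickening_closedBall he.le hε, add_comm] at hsub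

/-- The boundary of the square is null, and off it membership is stable under small moves of the
center. This is the pointwise convergence of indicators for dominated convergence. -/
theorem ae_eventually_mem_closedBall_iff (z : ℝ × ℝ) {ε : ℝ} (hε : 0 < ε) :
    ∀ᵐ y : ℝ × ℝ, ∀ᶠ w in 𝓝 z, (y ∈ Metric.closedBall w ε ↔ y ∈ Metric.closedBall z ε) := by
  have h0 : volume (Metric.sphere z ε) = 0 := Measure.addHaar_sphere_of_ne_zero _ z hε.ne'
  filter_upwards [measure_eq_zero_iff_ae_notMem.1 h0] with y hy
  have hc : Continuous fun w => dist y w := by fun_prop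
  rcases lt_or_gt_of_ne hy with h | h
  · filter_upwards [(hc.tendsto z).eventually_lt_const h] with w hw
    simp only [Metric.mem_closedBall, hw.le, h.le]
  · filter_upwards [(hc.tendsto z).eventually_const_lt h] with w hw
    simp only [Metric.mem_closedBall, hw.not_ge, (show ε < dist y z from h).not_ge]

theorem continuous_setLIntegral_closedBall {h : ℝ × ℝ → ℝ≥0∞} (hm : Measurable h)
    (hfin : ∫⁻ y, h y ^ 2 ≠ ∞) {ε : ℝ} (hε : 0 < ε) :
    Continuous fun z => ∫⁻ y in Metric.closedBall z ε, h y := by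
  rw [continuous_iff_continuousAt]
  intro z
  have hB : ∀ w r, MeasurableSet (Metric.closedBall (w : ℝ × ℝ) r) :=
    fun w r => Metric.isClosed_closedBall.measurableSet
  simp only [ContinuousAt, ← lintegral_indicator (hB _ _)]
  refine tendsto_lintegral_filter_of_dominated_convergence
    ((Metric.closedBall z (ε + 1)).indicator h) ?_ ?_ ?_ ?_
  · exact Eventually.of_forall fun w => hm.indicator (hB _ _)
  · filter_upwards [Metric.ball_mem_nhds z one_pos] with w hw
    refine Eventually.of_forall fun y => ?_
    refine indicator_le_indicator_of_subset (Metric.closedBall_subset_closedBall' ?_)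
      (fun _ => bot_le) y
    linarith [Metric.mem_ball.1 hw]
  · rw [lintegral_indicator (hB _ _)]
    exact setLIntegral_ne_top_of_lintegral_sq_ne_top hm hfin
      (isCompact_closedBall z (ε + 1)).measure_lt_top.ne
  · filter_upwards [ae_eventually_mem_closedBall_iff z hε] with y hy
    refine tendsto_const_nhds.congr' ?_
    filter_upwards [hy] with w hw
    by_cases h : y ∈ Metric.closedBall z ε
    · rw [indicator_of_mem h, indicator_of_mem (hw.2 h)]
    · rw [indicator_of_notMem h, indicator_of_notMem (fun h' => h (hw.1 h'))]

theorem continuousAt_integral_closedBall {D : Set (ℝ × ℝ)} (hDo : IsOpen D) {u : ℝ × ℝ → ℝ}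
    (hu : ContinuousOn u D) {z : ℝ × ℝ} {ε : ℝ} (hε : 0 < ε) (hD : Metric.closedBall z ε ⊆ D) :
    ContinuousAt (fun w => ∫ y in Metric.closedBall w ε, u y) z := by
  obtain ⟨e, he, heD⟩ := exists_closedBall_add_subset hDo hε.le hD
  have hB : ∀ w r, MeasurableSet (Metric.closedBall (w : ℝ × ℝ) r) :=
    fun w r => Metric.isClosed_closedBall.measurableSet
  have hcont := hu.mono heD
  have hint : IntegrableOn u (Metric.closedBall z (ε + e)) :=
    hcont.integrableOn_compact (isCompact_closedBall _ _)
  have hsub : ∀ w ∈ Metric.ball z e, Metric.closedBall w ε ⊆ Metric.closedBall z (ε + e) :=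
    fun w hw => Metric.closedBall_subset_closedBall' (by linarith [Metric.mem_ball.1 hw])
  simp only [ContinuousAt, ← integral_indicator (hB _ _)]
  refine tendsto_integral_filter_of_dominated_convergence
    ((Metric.closedBall z (ε + e)).indicator fun y => ‖u y‖) ?_ ?_ ?_ ?_
  · filter_upwards [Metric.ball_mem_nhds z he] with w hw
    exact ((hint.mono_set (hsub w hw)).integrable_indicator (hB _ _)).aestronglyMeasurable
  · filter_upwards [Metric.ball_mem_nhds z he] with w hw
    refine Eventually.of_forall fun y => ?_
    rw [norm_indicator_eq_indicator_norm]
    exact indicator_le_indicator_of_subset (hsub w hw) (fun _ => norm_nonneg _) y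
  · exact (integrable_indicator_iff (hB _ _)).2 hint.norm
  · filter_upwards [ae_eventually_mem_closedBall_iff z hε] with y hy
    refine tendsto_const_nhds.congr' ?_
    filter_upwards [hy] with w hw
    by_cases h : y ∈ Metric.closedBall z ε
    · rw [indicator_of_mem h, indicator_of_mem (hw.2 h)]
    · rw [indicator_of_notMem h, indicator_of_notMem (fun h' => h (hw.1 h'))]

theorem tendsto_average_closedBall {D : Set (ℝ × ℝ)} (hDo : IsOpen D) {u : ℝ × ℝ → ℝ}
    (hu : ContinuousOn u D) {z : ℝ × ℝ} (hz : z ∈ D) {r : ℕ → ℝ} (hr : ∀ n, 0 < r n)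
    (hr0 : Tendsto r atTop (𝓝 0)) :
    Tendsto (fun n => (∫ y in Metric.closedBall z (r n), u y) / (4 * r n ^ 2)) atTop (𝓝 (u z)) := by
  rw [Metric.tendsto_atTop']
  intro η hη
  have hca : ContinuousAt u z := hu.continuousAt (hDo.mem_nhds hz)
  obtain ⟨δ, hδ, hδ'⟩ := Metric.nhds_basis_closedBall.mem_iff.1
    (inter_mem (hDo.mem_nhds hz) (hca (Metric.closedBall_mem_nhds _ (half_pos hη))))
  obtain ⟨n₀, hn₀⟩ := eventually_atTop.1 (hr0.eventually_lt_const hδ)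
  refine ⟨n₀, fun n hn => ?_⟩
  have hsub : Metric.closedBall z (r n) ⊆ Metric.closedBall z δ :=
    Metric.closedBall_subset_closedBall (hn₀ n hn.le).le
  have hint : IntegrableOn u (Metric.closedBall z (r n)) :=
    (hu.mono fun y hy => (hδ' (hsub hy)).1).integrableOn_compact (isCompact_closedBall _ _)
  have hV : 0 < 4 * r n ^ 2 := by have := hr n; positivity
  have hvol : volume.real (Metric.closedBall z (r n)) = 4 * r n ^ 2 := by
    rw [Measure.real, volume_closedBall_prod z (hr n).le, ENNReal.toReal_ofReal hV.le]
  have h1 : ‖∫ y in Metric.closedBall z (r n), (u y - u z)‖ ≤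
      η / 2 * volume.real (Metric.closedBall z (r n)) := by
    refine norm_setIntegral_le_of_norm_le_const (isCompact_closedBall _ _).measure_lt_top
      fun y hy => ?_
    rw [← dist_eq_norm]
    exact (hδ' (hsub hy)).2
  rw [integral_sub hint (integrableOn_const (isCompact_closedBall _ _).measure_lt_top.ne),
    setIntegral_const, hvol, smul_eq_mul] at h1
  have h2 : (∫ y in Metric.closedBall z (r n), u y) / (4 * r n ^ 2) - u z =
      ((∫ y in Metric.closedBall z (r n), u y) - 4 * r n ^ 2 * u z) / (4 * r n ^ 2) := by
    rw [sub_div, mul_div_cancel_left₀ _ hV.ne']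
  rw [Real.dist_eq, h2, abs_div, abs_of_pos hV, div_lt_iff₀ hV]
  refine lt_of_le_of_lt h1 ?_
  gcongr
  linarith

end SquareIntegrals

/-! ### Averaged functions along curves and the upper gradient inequality. -/

section Curves

variable {X : Type*} [MetricSpace X] {D : Set (ℝ × ℝ)} {f : ℝ × ℝ → X} {μ : Measure (ℝ × ℝ)}
  {C : ℝ≥0}

theorem measurable_sqrt_upperDensity (μ : Measure (ℝ × ℝ)) [SFinite μ] (C : ℝ≥0) :
    Measurable fun y => (C * upperDensity μ y) ^ (1 / 2 : ℝ) :=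
  ((measurable_upperDensity μ).const_mul _).pow_const _

/-- The integral of `u` over a translated square has difference quotients at most the mean increment
of `f`, which is at most `A` for arbitrarily small shifts. A continuous function whose lower right
derivative is everywhere at most `A` grows at rate at most `A`; this is why frequent rather than
eventual bounds suffice. -/
theorem HorizontalBound.integral_sub_le [IsFiniteMeasure μ] (h : HorizontalBound D f μ C)
    (hf : ContinuousOn f D) (hDo : IsOpen D) {u : ℝ × ℝ → ℝ} (huc : ContinuousOn u D)
    (hu : ∀ y y', |u y - u y'| ≤ dist (f y) (f y')) {z : ℝ × ℝ} {s ε A : ℝ} (hε : 0 < ε)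
    (hs : 0 ≤ s) (hseg : ∀ σ ∈ Icc 0 s, Metric.closedBall (z + (σ, 0)) ε ⊆ D ∧
      ∫⁻ y in Metric.closedBall (z + (σ, 0)) ε, (C * upperDensity μ y) ^ (1 / 2 : ℝ) <
        ENNReal.ofReal A) :
    (∫ y in Metric.closedBall (z + (s, 0)) ε, u y) - ∫ y in Metric.closedBall z ε, u y ≤ A * s := by
  let U : ℝ × ℝ → ℝ := fun w => ∫ y in Metric.closedBall w ε, u y
  have hA : 0 < A := by
    have := (hseg 0 (left_mem_Icc.2 hs)).2
    by_contra hneg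
    rw [ENNReal.ofReal_of_nonpos (not_lt.1 hneg)] at this
    exact not_lt_bot this
  have hcont : ContinuousOn (fun σ : ℝ => U (z + (σ, 0)) - U z) (Icc 0 s) := fun σ hσ => by
    have h1 := continuousAt_integral_closedBall hDo huc hε (hseg σ hσ).1
    have h2 : ContinuousAt (fun σ : ℝ => z + ((σ, 0) : ℝ × ℝ)) σ := by fun_prop
    exact ((h1.comp (f := fun σ : ℝ => z + ((σ, 0) : ℝ × ℝ)) h2).sub
      continuousAt_const).continuousWithinAt
  have key := image_le_of_liminf_slope_right_le_deriv_boundary hcont (B := fun σ => A * σ)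
    (B' := fun _ => A) (by simp [U, ← Prod.zero_eq_mk]) (by fun_prop)
    (fun x _ => by simpa using ((hasDerivAt_id x).const_mul A).hasDerivWithinAt) ?_
    (right_mem_Icc.2 hs)
  · exact key
  intro σ hσ a ha
  have hσ' : σ ∈ Icc 0 s := Ico_subset_Icc_self hσ
  set w : ℝ × ℝ := z + (σ, 0)
  have hsub : Metric.closedBall w ε ⊆ D := (hseg σ hσ').1
  obtain ⟨e, he, heD⟩ := exists_closedBall_add_subset hDo hε.le hsub
  have hfreq := h.frequently_lintegral_edist_lt hf hDo hsub
    (setLIntegral_ne_top_of_lintegral_sq_ne_top (measurable_sqrt_upperDensity μ C)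
      (lintegral_sqrt_upperDensity_sq_ne_top μ C) (isCompact_closedBall _ _).measure_lt_top.ne)
    (hseg σ hσ').2
  have hfreq2 := hfreq.and_eventually (Ioo_mem_nhdsGT he)
  have htend : Tendsto (fun r : ℝ => σ + r) (𝓝[>] 0) (𝓝[>] σ) := by
    refine tendsto_nhdsWithin_iff.2 ⟨?_, ?_⟩
    · have : Continuous fun r : ℝ => σ + r := by fun_prop
      have h2 := this.tendsto 0
      rw [add_zero] at h2
      exact h2.mono_left nhdsWithin_le_nhds
    · filter_upwards [self_mem_nhdsWithin] with r hr
      simpa using hr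
  refine htend.frequently (hfreq2.mono fun r hr => ?_)
  obtain ⟨hr1, hr0, hre⟩ := hr
  rw [slope_def_field]
  have hden : σ + r - σ = r := by ring
  rw [hden, div_lt_iff₀ hr0]
  have hw' : z + (σ + r, 0) = w + (r, 0) := by
    simp only [w, add_assoc, Prod.mk_add_mk, add_zero]
  rw [hw']
  have hball : MapsTo (fun y : ℝ × ℝ => y + (r, 0)) (Metric.closedBall w ε) D := fun y hy => by
    apply heD
    rw [Metric.mem_closedBall] at hy ⊢
    refine (dist_triangle (y + (r, 0)) y w).trans ?_
    have : dist (y + (r, 0)) y = r := by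
      rw [dist_self_add_left]
      simp [Prod.norm_def, abs_of_pos hr0, hr0.le]
    linarith
  have i1 : IntegrableOn u (Metric.closedBall w ε) :=
    (huc.mono hsub).integrableOn_compact (isCompact_closedBall _ _)
  have hshift : ContinuousOn (fun y : ℝ × ℝ => u (y + (r, 0))) (Metric.closedBall w ε) :=
    huc.comp (by fun_prop) hball
  have i2 : IntegrableOn (fun y : ℝ × ℝ => u (y + (r, 0))) (Metric.closedBall w ε) :=
    hshift.integrableOn_compact (isCompact_closedBall _ _)
  have e1 : U (w + (r, 0)) = ∫ y in Metric.closedBall w ε, u (y + (r, 0)) := by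
    have hmp := measurePreserving_add_right (volume : Measure (ℝ × ℝ)) (r, 0)
    have hemb : MeasurableEmbedding fun y : ℝ × ℝ => y + (r, 0) :=
      measurableEmbedding_addRight _
    rw [show U (w + (r, 0)) = ∫ y in Metric.closedBall (w + (r, 0)) ε, u y from rfl,
      ← hmp.setIntegral_preimage_emb hemb]
    congr 2
    ext y
    simp
  have e2 : U (w + (r, 0)) - U w ≤ r * A := by
    rw [e1, show U w = ∫ y in Metric.closedBall w ε, u y from rfl, ← integral_sub i2 i1]
    refine (le_abs_self _).trans ?_
    rw [← Real.norm_eq_abs]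
    refine (norm_integral_le_lintegral_norm _).trans ?_
    refine ENNReal.toReal_le_of_le_ofReal (by positivity) ?_
    rw [ENNReal.ofReal_mul hr0.le]
    refine le_trans (lintegral_mono fun y => ?_) hr1
    rw [edist_dist, dist_comm]
    exact ENNReal.ofReal_le_ofReal (hu _ _)
  have e3 : U (w + (r, 0)) - U z - (U w - U z) = U (w + (r, 0)) - U w := by ring
  rw [e3]
  nlinarith

theorem HorizontalBound.abs_integral_sub_le [IsFiniteMeasure μ] (h : HorizontalBound D f μ C)
    (hf : ContinuousOn f D) (hDo : IsOpen D) {u : ℝ × ℝ → ℝ} (huc : ContinuousOn u D)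
    (hu : ∀ y y', |u y - u y'| ≤ dist (f y) (f y')) {z₀ : ℝ × ℝ} {δ ε A : ℝ} (hε : 0 < ε)
    (hball : ∀ w ∈ Metric.closedBall z₀ δ, Metric.closedBall w ε ⊆ D ∧
      ∫⁻ y in Metric.closedBall w ε, (C * upperDensity μ y) ^ (1 / 2 : ℝ) < ENNReal.ofReal A)
    {x x' t : ℝ} (hx : (x, t) ∈ Metric.closedBall z₀ δ) (hx' : (x', t) ∈ Metric.closedBall z₀ δ) :
    |(∫ y in Metric.closedBall (x', t) ε, u y) - ∫ y in Metric.closedBall (x, t) ε, u y| ≤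
      A * |x' - x| := by
  wlog hle : x ≤ x' generalizing x x'
  · rw [abs_sub_comm, abs_sub_comm x']
    exact this hx' hx (le_of_not_ge hle)
  have hpt : ∀ σ : ℝ, ((x, t) : ℝ × ℝ) + (σ, 0) = (x + σ, t) := fun σ => by simp
  have hseg : ∀ σ ∈ Icc 0 (x' - x), Metric.closedBall ((x, t) + (σ, 0)) ε ⊆ D ∧
      ∫⁻ y in Metric.closedBall ((x, t) + (σ, 0)) ε, (C * upperDensity μ y) ^ (1 / 2 : ℝ) <
        ENNReal.ofReal A := fun σ hσ => by
    apply hball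
    rw [hpt]
    rw [Metric.mem_closedBall, Prod.dist_eq, max_le_iff, Real.dist_eq, Real.dist_eq, abs_le] at *
    refine ⟨⟨?_, ?_⟩, hx.2⟩ <;> simp only at hx hx' ⊢ <;>
      linarith [hx.1.1, hx.1.2, hx'.1.1, hx'.1.2, hσ.1, hσ.2]
  have h1 := h.integral_sub_le hf hDo huc hu hε (sub_nonneg.2 hle) hseg
  have h2 := h.integral_sub_le hf hDo huc.neg (u := fun y => -u y)
    (fun y y' => by rw [← abs_neg]; simpa [add_comm, sub_eq_add_neg] using hu y y') hε
    (sub_nonneg.2 hle) hseg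
  rw [hpt, add_sub_cancel] at h1 h2
  rw [integral_neg, integral_neg] at h2
  rw [abs_of_nonneg (sub_nonneg.2 hle), abs_le]
  constructor <;> linarith

/-- Move horizontally, then vertically, through the corner `(x', t)`, which stays in the sup-metric
ball. The vertical step is the horizontal one after swapping coordinates. -/
theorem abs_integral_closedBall_sub_le [IsFiniteMeasure μ] (h : HorizontalBound D f μ C)
    (h' : HorizontalBound (Prod.swap ⁻¹' D) (f ∘ Prod.swap) (μ.map Prod.swap) C)
    (hf : ContinuousOn f D) (hDo : IsOpen D) {u : ℝ × ℝ → ℝ} (huc : ContinuousOn u D)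
    (hu : ∀ y y', |u y - u y'| ≤ dist (f y) (f y')) {z₀ : ℝ × ℝ} {δ ε A : ℝ} (hε : 0 < ε)
    (hball : ∀ w ∈ Metric.closedBall z₀ δ, Metric.closedBall w ε ⊆ D ∧
      ∫⁻ y in Metric.closedBall w ε, (C * upperDensity μ y) ^ (1 / 2 : ℝ) < ENNReal.ofReal A)
    {z w : ℝ × ℝ} (hz : z ∈ Metric.closedBall z₀ δ) (hw : w ∈ Metric.closedBall z₀ δ) :
    |(∫ y in Metric.closedBall w ε, u y) - ∫ y in Metric.closedBall z ε, u y| ≤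
      A * (|w.1 - z.1| + |w.2 - z.2|) := by
  obtain ⟨x, t⟩ := z
  obtain ⟨x', t'⟩ := w
  have hcorner : ((x', t) : ℝ × ℝ) ∈ Metric.closedBall z₀ δ := by
    rw [Metric.mem_closedBall, Prod.dist_eq, max_le_iff] at *
    exact ⟨hw.1, hz.2⟩
  have h1 := h.abs_integral_sub_le hf hDo huc hu hε hball hz hcorner
  have hswap : ∀ (w : ℝ × ℝ) r, Prod.swap ⁻¹' Metric.closedBall w r =
      Metric.closedBall w.swap r := fun w r => by
    ext y; simp [Prod.dist_eq, and_comm]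
  have hmp : MeasurePreserving (Prod.swap : ℝ × ℝ → ℝ × ℝ) volume volume :=
    Measure.measurePreserving_swap
  have hemb : MeasurableEmbedding (Prod.swap : ℝ × ℝ → ℝ × ℝ) :=
    MeasurableEquiv.prodComm.measurableEmbedding
  have hfin : IsFiniteMeasure (μ.map Prod.swap) := Measure.isFiniteMeasure_map _ _
  have h2 := h'.abs_integral_sub_le (hf.comp continuous_swap.continuousOn (mapsTo_preimage _ _))
    (hDo.preimage continuous_swap)
    (huc.comp continuous_swap.continuousOn (mapsTo_preimage _ _)) (u := u ∘ Prod.swap)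
    (fun y y' => hu _ _) (z₀ := z₀.swap) (δ := δ) (A := A) hε
    (fun w hw => by
      have hw' : w.swap ∈ Metric.closedBall z₀ δ := by
        have : w ∈ Prod.swap ⁻¹' Metric.closedBall z₀ δ := by rw [hswap]; exact hw
        exact this
      obtain ⟨k1, k2⟩ := hball _ hw'
      have e : Prod.swap ⁻¹' Metric.closedBall w.swap ε = Metric.closedBall w ε := by
        rw [hswap, Prod.swap_swap]
      refine ⟨by rw [← e]; exact preimage_mono k1, ?_⟩
      rw [← e]
      simp only [upperDensity_map_swap]
      rw [hmp.setLIntegral_comp_preimage_emb hemb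
        (fun y => (C * upperDensity μ y) ^ (1 / 2 : ℝ))]
      exact k2)
    (x := t) (x' := t') (t := x')
    (by rw [← hswap]; exact hcorner) (by rw [← hswap]; exact hw)
  have e : ∀ a b : ℝ, ∫ y in Metric.closedBall (b, a) ε, (u ∘ Prod.swap) y =
      ∫ y in Metric.closedBall (a, b) ε, u y := fun a b => by
    rw [← hmp.setIntegral_preimage_emb hemb u, hswap]; rfl
  rw [e, e] at h2
  calc |(∫ y in Metric.closedBall (x', t') ε, u y) - ∫ y in Metric.closedBall (x, t) ε, u y|
      ≤ |(∫ y in Metric.closedBall (x', t') ε, u y) - ∫ y in Metric.closedBall (x', t) ε, u y| +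
        |(∫ y in Metric.closedBall (x', t) ε, u y) - ∫ y in Metric.closedBall (x, t) ε, u y| :=
        abs_sub_le _ _ _
    _ ≤ A * |t' - t| + A * |x' - x| := add_le_add h2 h1
    _ = _ := by ring

/-- Increments of the averages of `u` along a curve. -/
theorem integral_closedBall_sub_le_along [IsFiniteMeasure μ] (h : HorizontalBound D f μ C)
    (h' : HorizontalBound (Prod.swap ⁻¹' D) (f ∘ Prod.swap) (μ.map Prod.swap) C)
    (hf : ContinuousOn f D) (hDo : IsOpen D) {u : ℝ × ℝ → ℝ} (huc : ContinuousOn u D)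
    (hu : ∀ y y', |u y - u y'| ≤ dist (f y) (f y')) {ε : ℝ} (hε : 0 < ε) {c : ℝ → ℝ × ℝ}
    (hcc : Continuous c)
    (hc : ∀ s t, |(c s).1 - (c t).1| + |(c s).2 - (c t).2| ≤ √2 * |s - t|) {s s' : ℝ}
    (hss : s ≤ s') (hcD : ∀ t ∈ Icc s s', Metric.closedBall (c t) ε ⊆ D) :
    ENNReal.ofReal ((∫ y in Metric.closedBall (c s') ε, u y) -
        ∫ y in Metric.closedBall (c s) ε, u y) ≤
      ENNReal.ofReal √2 * ∫⁻ t in Icc s s', ∫⁻ y in Metric.closedBall (c t) ε,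
        (C * upperDensity μ y) ^ (1 / 2 : ℝ) := by
  let U : ℝ × ℝ → ℝ := fun w => ∫ y in Metric.closedBall w ε, u y
  let H : ℝ × ℝ → ℝ≥0∞ := fun w =>
    ∫⁻ y in Metric.closedBall w ε, (C * upperDensity μ y) ^ (1 / 2 : ℝ)
  have hHc : Continuous H := continuous_setLIntegral_closedBall (measurable_sqrt_upperDensity μ C)
      (lintegral_sqrt_upperDensity_sq_ne_top μ C) hε
  have hHfin : ∀ w, H w ≠ ∞ := fun w =>
    setLIntegral_ne_top_of_lintegral_sq_ne_top (measurable_sqrt_upperDensity μ C)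
      (lintegral_sqrt_upperDensity_sq_ne_top μ C) (isCompact_closedBall _ _).measure_lt_top.ne
  -- Near `c t` the averaged function is Lipschitz for the `ℓ¹` distance with any constant above `H
  -- (c t)`, and `c` has `ℓ¹` speed at most `√2`.
  let G : ℝ → ℝ := fun t => √2 * (H (c t)).toReal
  have hGc : Continuous G := by
    have : Continuous fun t => (H (c t)).toReal :=
      continuous_iff_continuousAt.2 fun t =>
        (ENNReal.tendsto_toReal (hHfin _)).comp ((hHc.comp hcc).tendsto t)
    fun_prop
  have hcont : ContinuousOn (fun t => U (c t) - U (c s)) (Icc s s') := fun t ht =>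
    (((continuousAt_integral_closedBall hDo huc hε (hcD t ht)).comp hcc.continuousAt).sub
      continuousAt_const).continuousWithinAt
  have hderiv : ∀ x, HasDerivAt (fun t => ∫ τ in s..t, G τ) (G x) x := fun x =>
    hGc.integral_hasStrictDerivAt s x |>.hasDerivAt
  have key : U (c s') - U (c s) ≤ ∫ τ in s..s', G τ := by
    refine image_le_of_liminf_slope_right_le_deriv_boundary hcont
      (B := fun t => ∫ τ in s..t, G τ) (B' := G) (by simp)
      (fun x _ => (hderiv x).continuousAt.continuousWithinAt)
      (fun x _ => (hderiv x).hasDerivWithinAt) ?_ (right_mem_Icc.2 hss)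
    intro t ht a ha
    have ht' := Ico_subset_Icc_self ht
    have hs2 : 0 < √2 := by positivity
    let A := a / √2
    have hA : H (c t) < ENNReal.ofReal A := by
      rw [← ENNReal.ofReal_toReal (hHfin (c t))]
      have h1 : (H (c t)).toReal < A := by
        rw [lt_div_iff₀ hs2, mul_comm]; exact ha
      exact (ENNReal.ofReal_lt_ofReal_iff (ENNReal.toReal_nonneg.trans_lt h1)).2 h1
    obtain ⟨A', hA1, hA2⟩ : ∃ A' < A, H (c t) < ENNReal.ofReal A' := by
      rw [← ENNReal.ofReal_toReal (hHfin (c t)), ENNReal.ofReal_lt_ofReal_iff'] at hA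
      obtain ⟨A', h1, h2⟩ := exists_between hA.1
      refine ⟨A', h2, ?_⟩
      rw [← ENNReal.ofReal_toReal (hHfin (c t)), ENNReal.ofReal_lt_ofReal_iff']
      exact ⟨h1, ENNReal.toReal_nonneg.trans_lt h1⟩
    have hA'0 : 0 ≤ A' := by
      by_contra hneg
      rw [ENNReal.ofReal_of_nonpos (not_le.1 hneg).le] at hA2
      exact not_lt_bot hA2
    obtain ⟨e, he, heD⟩ := exists_closedBall_add_subset hDo hε.le (hcD t ht')
    have hev : ∀ᶠ w in 𝓝 (c t), Metric.closedBall w ε ⊆ D ∧ H w < ENNReal.ofReal A' := by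
      filter_upwards [Metric.ball_mem_nhds (c t) he, (hHc.tendsto (c t)).eventually_lt_const hA2]
        with w hw hw2
      refine ⟨(Metric.closedBall_subset_closedBall' ?_).trans heD, hw2⟩
      linarith [Metric.mem_ball.1 hw]
    obtain ⟨δ, hδ, hball⟩ := Metric.nhds_basis_closedBall.mem_iff.1 hev
    have hnear : ∀ᶠ t' in 𝓝[>] t, c t' ∈ Metric.closedBall (c t) δ :=
      (hcc.tendsto t).mono_left nhdsWithin_le_nhds (Metric.closedBall_mem_nhds _ hδ)
    refine Eventually.frequently ?_
    filter_upwards [hnear, self_mem_nhdsWithin] with t' h1 h2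
    have h2' : t < t' := h2
    rw [slope_def_field, div_lt_iff₀ (by linarith)]
    have h3 := abs_integral_closedBall_sub_le h h' hf hDo huc hu hε (fun w hw => hball hw)
      (Metric.mem_closedBall_self hδ.le) h1
    have h4 := hc t' t
    rw [abs_of_pos (sub_pos.2 h2')] at h4
    calc U (c t') - U (c s) - (U (c t) - U (c s)) = U (c t') - U (c t) := by ring
      _ ≤ A' * (√2 * (t' - t)) := (le_abs_self _).trans (h3.trans (by gcongr))
      _ < A * (√2 * (t' - t)) := by
          have : 0 < t' - t := sub_pos.2 h2'
          gcongr
      _ = a * (t' - t) := by simp only [A]; field_simp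
  refine (ENNReal.ofReal_le_ofReal key).trans ?_
  rw [intervalIntegral.integral_of_le hss, integral_const_mul, ENNReal.ofReal_mul (by positivity),
    ← integral_Icc_eq_integral_Ioc,
    ofReal_integral_eq_lintegral_ofReal]
  · gcongr with t
    rw [ENNReal.ofReal_toReal (hHfin _)]
  · have : Continuous fun t => (H (c t)).toReal :=
      continuous_iff_continuousAt.2 fun t =>
        (ENNReal.tendsto_toReal (hHfin _)).comp ((hHc.comp hcc).tendsto t)
    exact this.integrableOn_Icc
  · exact Eventually.of_forall fun t => ENNReal.toReal_nonneg

/-- Outside the curves over which a fixed square integrable function has infinite integral, the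
function `(2 C J)^{1/2}` is an upper gradient of `f`. -/
theorem exists_upper_gradient_along [IsFiniteMeasure μ] (h : HorizontalBound D f μ C)
    (h' : HorizontalBound (Prod.swap ⁻¹' D) (f ∘ Prod.swap) (μ.map Prod.swap) C)
    (hf : ContinuousOn f D) (hDo : IsOpen D) :
    ∃ ρ : ℝ × ℝ → ℝ≥0∞, Measurable ρ ∧ ∫⁻ y, ρ y ^ 2 ≠ ∞ ∧
      ∀ c : ℝ → ℝ × ℝ, Continuous c →
        (∀ s t, |(c s).1 - (c t).1| + |(c s).2 - (c t).2| ≤ √2 * |s - t|) →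
        ∀ s s', s ≤ s' → (∀ t ∈ Icc s s', c t ∈ D) → ∫⁻ t in Icc s s', ρ (c t) ≠ ∞ →
          edist (f (c s)) (f (c s')) ≤
            ENNReal.ofReal √2 * ∫⁻ t in Icc s s', (C * upperDensity μ (c t)) ^ (1 / 2 : ℝ) := by
  let H : ℝ × ℝ → ℝ≥0∞ := fun y => (C * upperDensity μ y) ^ (1 / 2 : ℝ)
  have hHm : Measurable H := measurable_sqrt_upperDensity μ C
  obtain ⟨r, ρ, hr, hr0, hρ, hρfin, hle⟩ := exists_seq_average_le hHm
    (lintegral_sqrt_upperDensity_sq_ne_top μ C)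
  refine ⟨ρ, hρ, hρfin, fun c hcc hc s s' hss hcD hfin => ?_⟩
  -- The increment of this function from `c s` to `c s'` is exactly the distance to be bounded.
  let u : ℝ × ℝ → ℝ := fun y => dist (f y) (f (c s))
  have huc : ContinuousOn u D := (continuous_id.dist continuous_const).comp_continuousOn hf
  have hu : ∀ y y', |u y - u y'| ≤ dist (f y) (f y') := fun y y' => abs_dist_sub_le _ _ _
  have hcpt : IsCompact (c '' Icc s s') := isCompact_Icc.image hcc
  obtain ⟨δ, hδ, hδD⟩ := hcpt.exists_cthickening_subset_open hDo (image_subset_iff.2 hcD)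
  have hsD : c s ∈ D := hcD s (left_mem_Icc.2 hss)
  have hsD' : c s' ∈ D := hcD s' (right_mem_Icc.2 hss)
  have hlhs : Tendsto (fun n => ENNReal.ofReal
      ((∫ y in Metric.closedBall (c s') (r n), u y) / (4 * r n ^ 2) -
        (∫ y in Metric.closedBall (c s) (r n), u y) / (4 * r n ^ 2))) atTop
      (𝓝 (edist (f (c s)) (f (c s')))) := by
    have e : edist (f (c s)) (f (c s')) = ENNReal.ofReal (u (c s') - u (c s)) := by
      rw [edist_dist, dist_comm]; simp [u]
    rw [e]
    exact (ENNReal.continuous_ofReal.tendsto _).comp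
      ((tendsto_average_closedBall hDo huc hsD' hr hr0).sub
        (tendsto_average_closedBall hDo huc hsD hr hr0))
  have hpow : Tendsto (fun n : ℕ => (((1 / 2 : ℝ≥0) ^ n : ℝ≥0) : ℝ≥0∞)) atTop (𝓝 0) := by
    have := NNReal.tendsto_pow_atTop_nhds_zero_of_lt_one
      (show (1 / 2 : ℝ≥0) < 1 by rw [div_lt_one] <;> norm_num)
    exact ENNReal.tendsto_coe.2 this
  -- The error terms tend to zero because the integral of `ρ` over the curve is finite; this is the
  -- only use of that condition.
  have hrhs : Tendsto (fun n : ℕ => ENNReal.ofReal √2 *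
      ((∫⁻ t in Icc s s', H (c t)) +
        ((((1 / 2 : ℝ≥0) ^ n : ℝ≥0) : ℝ≥0∞) * (∫⁻ t in Icc s s', ρ (c t)) +
          (((1 / 2 : ℝ≥0) ^ n : ℝ≥0) : ℝ≥0∞) * ENNReal.ofReal (s' - s)))) atTop
      (𝓝 (ENNReal.ofReal √2 * ((∫⁻ t in Icc s s', H (c t)) +
        (0 * (∫⁻ t in Icc s s', ρ (c t)) + 0 * ENNReal.ofReal (s' - s))))) := by
    refine ENNReal.Tendsto.const_mul (Tendsto.const_add _ (Tendsto.add ?_ ?_))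
      (Or.inr ENNReal.ofReal_ne_top)
    · exact ENNReal.Tendsto.mul_const hpow (Or.inr hfin)
    · exact ENNReal.Tendsto.mul_const hpow (Or.inr ENNReal.ofReal_ne_top)
  rw [zero_mul, zero_mul, add_zero, add_zero] at hrhs
  refine le_of_tendsto_of_tendsto hlhs hrhs ?_
  filter_upwards [hr0.eventually_lt_const hδ] with n hn
  have hballs : ∀ t ∈ Icc s s', Metric.closedBall (c t) (r n) ⊆ D := fun t ht =>
    ((Metric.closedBall_subset_closedBall hn.le).trans
      (Metric.closedBall_subset_cthickening (mem_image_of_mem c ht) δ)).trans hδD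
  have h1 := integral_closedBall_sub_le_along h h' hf hDo huc hu (hr n) hcc hc hss hballs
  have hV : 0 < 4 * r n ^ 2 := by have := hr n; positivity
  have hV0 : ENNReal.ofReal (4 * r n ^ 2) ≠ 0 := (ENNReal.ofReal_pos.2 hV).ne'
  rw [← sub_div, ENNReal.ofReal_div_of_pos hV]
  refine (ENNReal.div_le_div_right h1 _).trans ?_
  rw [mul_div_assoc]
  gcongr
  rw [div_eq_mul_inv, ← lintegral_mul_const' _ _ (ENNReal.inv_ne_top.2 hV0)]
  calc ∫⁻ t in Icc s s', (∫⁻ y in Metric.closedBall (c t) (r n), H y) *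
        (ENNReal.ofReal (4 * r n ^ 2))⁻¹
      ≤ ∫⁻ t in Icc s s', (H (c t) + ((((1 / 2 : ℝ≥0) ^ n : ℝ≥0) : ℝ≥0∞) * ρ (c t) +
          (((1 / 2 : ℝ≥0) ^ n : ℝ≥0) : ℝ≥0∞))) := by
        refine lintegral_mono fun t => ?_
        have := hle n (c t)
        rw [squareDensity_withDensity, div_eq_mul_inv] at this
        rw [← add_assoc]
        exact this
    _ = _ := by
        rw [lintegral_add_left (f := fun t => H (c t)) (hHm.comp hcc.measurable),
          lintegral_add_right _ measurable_const,
          lintegral_const_mul' _ _ ENNReal.coe_ne_top, setLIntegral_const, Real.volume_Icc]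

end Curves

/-! ### Independence of the values of a path off its domain. -/

section PathCongruence

variable {Y : Type*} [MetricSpace Y]

theorem IntervalPath.locallyRectifiable_congr {γ γ' : IntervalPath Y} (hdom : γ'.dom = γ.dom)
    (heq : EqOn γ.toFun γ'.toFun γ.dom) (h : γ.LocallyRectifiable) : γ'.LocallyRectifiable := by
  intro a b ha hb
  rw [hdom] at ha hb
  unfold BoundedVariationOn
  rw [hdom, ← eVariationOn.congr (heq.mono inter_subset_left)]
  exact h a b ha hb

/-- Lifting a path of `X` to `Ω` changes the values off the domain. The integrand only sees arc
length parameters attained on the domain, where the two parametrizations agree. -/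
theorem IntervalPath.lineIntegral_congr {γ γ' : IntervalPath Y} (hdom : γ'.dom = γ.dom)
    (heq : EqOn γ.toFun γ'.toFun γ.dom) (h : γ.LocallyRectifiable) (ρ : Y → ℝ≥0∞) :
    γ'.lineIntegral ρ = γ.lineIntegral ρ := by
  unfold IntervalPath.lineIntegral
  rw [hdom]
  refine iSup_congr fun a => iSup_congr fun ha => iSup_congr fun b => iSup_congr fun hb =>
    iSup_congr fun hab => ?_
  have hsub := γ.Icc_subset_dom ha hb
  have hE : EqOn γ.toFun γ'.toFun (Icc a b) := heq.mono hsub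
  have hbv := h.boundedVariationOn ha hb
  have hbv' : BoundedVariationOn γ'.toFun (Icc a b) := by
    unfold BoundedVariationOn; rw [← eVariationOn.congr hE]; exact hbv
  unfold IntervalPath.compactIntegral
  rw [← eVariationOn.congr hE]
  refine setLIntegral_congr_fun measurableSet_Icc fun σ hσ => ?_
  obtain ⟨t, ht, rfl⟩ := (image_variationOnFromTo_Icc hab (γ.continuousOn.mono hsub) hbv).symm ▸ hσ
  have ha' : a ∈ Icc a b := left_mem_Icc.2 hab
  have h1 := edist_eq_zero.1
    (edist_naturalParameterization_eq_zero hbv.locallyBoundedVariationOn ha' ht)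
  have h2 := edist_eq_zero.1
    (edist_naturalParameterization_eq_zero hbv'.locallyBoundedVariationOn ha' ht)
  have e : variationOnFromTo γ'.toFun (Icc a b) a t = variationOnFromTo γ.toFun (Icc a b) a t := by
    rw [variationOnFromTo.eq_of_le _ _ ht.1, variationOnFromTo.eq_of_le _ _ ht.1,
      eVariationOn.congr (hE.mono inter_subset_left)]
  rw [e] at h2
  simp only [h1, h2, hE ht]

theorem modulus_le_of_forall_exists_eqOn [MeasurableSpace Y] (μ : Measure Y)
    {Γ Γ' : Set (IntervalPath Y)}
    (h : ∀ γ ∈ Γ, ∃ γ' ∈ Γ', γ'.dom = γ.dom ∧ EqOn γ.toFun γ'.toFun γ.dom) :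
    modulus μ Γ ≤ modulus μ Γ' := by
  refine le_iInf₂ fun ρ hρ => iInf₂_le ρ ⟨hρ.1, fun γ hγ hrect => ?_⟩
  obtain ⟨γ', hγ', hdom, heq⟩ := h γ hγ
  rw [← IntervalPath.lineIntegral_congr hdom heq hrect]
  exact hρ.2 γ' hγ' (IntervalPath.locallyRectifiable_congr hdom heq hrect)

theorem IntervalPath.lineIntegral_mono (γ : IntervalPath Y) {ρ ρ' : Y → ℝ≥0∞} (h : ∀ y, ρ y ≤ ρ' y) :
    γ.lineIntegral ρ ≤ γ.lineIntegral ρ' :=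
  iSup₂_mono fun _ _ => iSup₂_mono fun _ _ => iSup_mono fun _ => lintegral_mono fun _ => h _

end PathCongruence

/-- Countably many exceptional families are described by one function: `σ² = ∑ dₙ ρₙ²`, with weights
`dₙ = 2⁻ⁿ / (∫ ρₙ² + 1)` making the sum integrable. -/
theorem exists_sq_integrable_ge_mul {α : Type*} [MeasurableSpace α] (μ : Measure α)
    {ρ : ℕ → α → ℝ≥0∞} (hm : ∀ n, Measurable (ρ n)) (hfin : ∀ n, ∫⁻ y, ρ n y ^ 2 ∂μ ≠ ∞) :
    ∃ σ : α → ℝ≥0∞, Measurable σ ∧ ∫⁻ y, σ y ^ 2 ∂μ ≠ ∞ ∧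
      ∀ n, ∃ c : ℝ≥0, 0 < c ∧ ∀ y, c * ρ n y ≤ σ y := by
  let a : ℕ → ℝ≥0 := fun n => (∫⁻ y, ρ n y ^ 2 ∂μ).toNNReal
  let d : ℕ → ℝ≥0 := fun n => (1 / 2) ^ n / (a n + 1)
  have hd : ∀ n, 0 < d n := fun n => by positivity
  let S : α → ℝ≥0∞ := fun y => ∑' n, (d n : ℝ≥0∞) * ρ n y ^ 2
  have hSm : Measurable S := Measurable.tsum fun n => ((hm n).pow_const 2).const_mul _
  have hsq : ∀ y, (S y ^ (1 / 2 : ℝ)) ^ 2 = S y := fun y => by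
    rw [← ENNReal.rpow_mul_natCast]; norm_num
  refine ⟨fun y => S y ^ (1 / 2 : ℝ), hSm.pow_const _, ?_, fun n =>
    ⟨NNReal.sqrt (d n), NNReal.sqrt_pos.2 (hd n), fun y => ?_⟩⟩
  · simp only [hsq, S]
    rw [lintegral_tsum fun n => (((hm n).pow_const 2).const_mul _).aemeasurable]
    have hle : ∀ n : ℕ, ∫⁻ y, (d n : ℝ≥0∞) * ρ n y ^ 2 ∂μ ≤
        (((1 / 2 : ℝ≥0) ^ n : ℝ≥0) : ℝ≥0∞) := fun n => by
      rw [lintegral_const_mul' _ _ ENNReal.coe_ne_top, ← ENNReal.coe_toNNReal (hfin n),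
        ← ENNReal.coe_mul]
      refine ENNReal.coe_le_coe.2 ?_
      rw [div_mul_eq_mul_div, div_le_iff₀ (by positivity)]
      gcongr
      exact le_self_add
    refine ne_top_of_le_ne_top ?_ (ENNReal.tsum_le_tsum hle)
    exact ENNReal.tsum_coe_ne_top_iff_summable.2
      (NNReal.summable_geometric (by rw [div_lt_one] <;> norm_num))
  · rw [← ENNReal.pow_le_pow_left_iff two_ne_zero, hsq, mul_pow, ← ENNReal.coe_pow,
      NNReal.sq_sqrt]
    exact ENNReal.le_tsum n

/-! ### Cartesian coordinates: the Euclidean plane against `ℝ × ℝ` with the sup metric. -/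

section PlaneCoordinates

/-- Cartesian coordinates on the plane. -/
noncomputable def planeCoord : Plane ≃ₜ ℝ × ℝ :=
  (PiLp.homeomorph 2 fun _ : Fin 2 => ℝ).trans Homeomorph.finTwoArrow

theorem planeCoord_apply (y : Plane) : planeCoord y = (y 0, y 1) := rfl

theorem measurePreserving_planeCoord :
    MeasurePreserving planeCoord (volume : Measure Plane) (volume : Measure (ℝ × ℝ)) :=
  (volume_preserving_finTwoArrow ℝ).comp (PiLp.volume_preserving_ofLp (Fin 2))

theorem preimage_planeCoord_closedBall (y : Plane) (r : ℝ) :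
    planeCoord ⁻¹' Metric.closedBall (planeCoord y) r = planeSquare y r := by
  ext z
  simp [planeSquare, planeCoord_apply, Prod.dist_eq, Real.dist_eq]

theorem abs_coord_sub_le_dist (y z : Plane) (i : Fin 2) : |y i - z i| ≤ dist y z := by
  rw [dist_eq_norm, ← Real.norm_eq_abs]
  exact PiLp.norm_apply_le (y - z) i

theorem abs_coord_add_abs_coord_le (y z : Plane) :
    |y 0 - z 0| + |y 1 - z 1| ≤ √2 * dist y z := by
  rw [EuclideanSpace.dist_eq, Fin.sum_univ_two, ← Real.sqrt_mul zero_le_two,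
    Real.dist_eq, Real.dist_eq]
  refine Real.le_sqrt_of_sq_le ?_
  nlinarith [sq_nonneg (|y 0 - z 0| - |y 1 - z 1|)]

end PlaneCoordinates

/-! ### The rectangle inequality from reciprocality. -/

section Rectangles

variable {X : Type*} [MetricSpace X] [MeasurableSpace X] [BorelSpace X] {Ω : Set X}
  {Ω' : Set Plane}

/-- The hypothesis on `F` speaks of paths in the subtype `Ω`, so joining paths in `f '' R`, which
lies in `Ω`, are lifted there first. -/
theorem modulus_joiningPaths_image_le (F : Ω ≃ₜ Ω') {K : ℝ≥0}
    (hK : ∀ Γ : Set (IntervalPath Ω),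
      modulus (hausdorffTwo X) (IntervalPath.map Subtype.val continuous_subtype_val '' Γ) ≤
        K * modulus (volume : Measure Plane)
          (IntervalPath.map (fun x : Ω => (F x : Plane))
            (continuous_subtype_val.comp F.continuous) '' Γ))
    {f : Plane → X} (hf : ∀ y : Ω', f y = F.symm y) {A B R : Set Plane} (hR : R ⊆ Ω')
    (hA : A ⊆ R) (hB : B ⊆ R) :
    modulus (hausdorffTwo X) (joiningPaths (f '' A) (f '' B) (f '' R)) ≤
      K * modulus (volume : Measure Plane) (joiningPaths A B R) := by
  let Γ : Set (IntervalPath Ω) := {γ | IntervalPath.map (fun x : Ω => (F x : Plane))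
    (continuous_subtype_val.comp F.continuous) γ ∈ joiningPaths A B R}
  have hmem : ∀ S ⊆ R, ∀ x ∈ f '' S, ∃ hx : x ∈ Ω, (F ⟨x, hx⟩ : Plane) ∈ S := by
    rintro S hS _ ⟨y, hy, rfl⟩
    have e := hf ⟨y, hR (hS hy)⟩
    have hx : f y ∈ Ω := by rw [e]; exact Subtype.coe_prop _
    refine ⟨hx, ?_⟩
    have : (⟨f y, hx⟩ : Ω) = F.symm ⟨y, hR (hS hy)⟩ := Subtype.ext e
    rw [this, F.apply_symm_apply]
    exact hy
  have h1 : modulus (hausdorffTwo X) (joiningPaths (f '' A) (f '' B) (f '' R)) ≤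
      modulus (hausdorffTwo X) (IntervalPath.map Subtype.val continuous_subtype_val '' Γ) := by
    refine modulus_le_of_forall_exists_eqOn _ fun γ hγ => ?_
    obtain ⟨hγR, ⟨_, ⟨s, hs, rfl⟩, hsA⟩, ⟨_, ⟨t, ht, rfl⟩, htB⟩⟩ := hγ
    have hΩ : ∀ u ∈ γ.dom, γ.toFun u ∈ Ω := fun u hu =>
      (hmem R Subset.rfl _ (hγR (mem_image_of_mem _ hu))).1
    classical
    let g : ℝ → Ω := fun u => if h : u ∈ γ.dom then ⟨γ.toFun u, hΩ u h⟩ else ⟨γ.toFun s, hΩ s hs⟩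
    have hg : ∀ u ∈ γ.dom, (g u : X) = γ.toFun u := fun u hu => by simp [g, hu]
    have hgF : ∀ S ⊆ R, ∀ u ∈ γ.dom, γ.toFun u ∈ f '' S → (F (g u) : Plane) ∈ S := by
      intro S hS u hu hx
      obtain ⟨hx', h⟩ := hmem S hS _ hx
      have : g u = ⟨γ.toFun u, hx'⟩ := Subtype.ext (hg u hu)
      rw [this]; exact h
    have hgc : ContinuousOn g γ.dom := by
      rw [continuousOn_iff_continuous_domRestrict]
      refine Continuous.subtype_mk (f := fun u : γ.dom => γ.toFun u)
        (continuousOn_iff_continuous_domRestrict.1 γ.continuousOn) (fun u => hΩ u u.2) |>.congr ?_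
      intro u
      exact Subtype.ext (hg u u.2).symm
    let γ' : IntervalPath Ω := ⟨γ.dom, γ.nonempty, γ.ordConnected, g, hgc⟩
    refine ⟨_, mem_image_of_mem _ (show γ' ∈ Γ from ?_), rfl, fun u hu => (hg u hu).symm⟩
    refine ⟨?_, ⟨_, mem_image_of_mem _ hs, hgF A hA s hs hsA⟩,
      ⟨_, mem_image_of_mem _ ht, hgF B hB t ht htB⟩⟩
    rintro _ ⟨u, hu, rfl⟩
    exact hgF R Subset.rfl u hu (hγR (mem_image_of_mem _ hu))
  refine h1.trans ((hK Γ).trans ?_)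
  refine mul_le_mul' le_rfl (modulus_mono _ ?_)
  rintro _ ⟨γ, hγ, rfl⟩
  exact hγ

/-- The lower reciprocality bound and the one-sided modulus inequality control the distance of the
images of opposite sides of a rectangle. -/
theorem horizontalBound_of_lowerReciprocal {κ : ℝ≥0} (hκ : 0 < κ) (hrec : LowerReciprocal X κ)
    (F : Ω ≃ₜ Ω') {K : ℝ≥0}
    (hK : ∀ Γ : Set (IntervalPath Ω),
      modulus (hausdorffTwo X) (IntervalPath.map Subtype.val continuous_subtype_val '' Γ) ≤
        K * modulus (volume : Measure Plane)
          (IntervalPath.map (fun x : Ω => (F x : Plane))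
            (continuous_subtype_val.comp F.continuous) '' Γ))
    {f : Plane → X} (hf : ∀ y : Ω', f y = F.symm y) {μ : Measure Plane}
    (hμ : ∀ S ⊆ Ω', IsCompact S → hausdorffTwo X (f '' S) ≤ μ S) (j : Plane ≃ₜ ℝ × ℝ)
    (hj : MeasurePreserving j volume volume) (hjd : ∀ y z, |(j y).2 - (j z).2| ≤ dist y z) :
    HorizontalBound (j.symm ⁻¹' Ω') (f ∘ j.symm) (μ.map j) (κ * K) := by
  intro a b c d hab hcd hD δ hδ
  rcases eq_or_ne δ 0 with rfl | hδ0
  · simp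
  have hδtop : δ ≠ ∞ := ((hδ c (left_mem_Icc.2 hcd.le) c (left_mem_Icc.2 hcd.le)).trans_lt
    (edist_lt_top _ _)).ne
  have hw : 0 < b - a := sub_pos.2 hab
  have hh : 0 < d - c := sub_pos.2 hcd
  let box : unitInterval × unitInterval → ℝ × ℝ := fun p =>
    (a + p.1 * (b - a), c + p.2 * (d - c))
  have hboxc : Continuous box := by fun_prop
  have hboxm : ∀ p, box p ∈ Icc a b ×ˢ Icc c d := fun p => by
    have h1 := p.1.2
    have h2 := p.2.2
    refine ⟨⟨?_, ?_⟩, ?_, ?_⟩ <;> simp only [box] <;> nlinarith [h1.1, h1.2, h2.1, h2.2]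
  have hboxs : ∀ q ∈ Icc a b ×ˢ Icc c d, ∃ p, box p = q := fun q hq => by
    refine ⟨(⟨(q.1 - a) / (b - a), ?_⟩, ⟨(q.2 - c) / (d - c), ?_⟩), ?_⟩
    · exact ⟨div_nonneg (by linarith [hq.1.1]) hw.le,
        div_le_one_of_le₀ (by linarith [hq.1.2]) hw.le⟩
    · exact ⟨div_nonneg (by linarith [hq.2.1]) hh.le,
        div_le_one_of_le₀ (by linarith [hq.2.2]) hh.le⟩
    · ext
      · simp only [box]; field_simp; ring
      · simp only [box]; field_simp; ring
  have hboxi : Function.Injective box := fun p q h => by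
    obtain ⟨h1, h2⟩ := Prod.mk.inj h
    have h1' := mul_right_cancel₀ hw.ne' (add_left_cancel h1)
    have h2' := mul_right_cancel₀ hh.ne' (add_left_cancel h2)
    exact Prod.ext (Subtype.ext h1') (Subtype.ext h2')
  let Q : Set Plane := j ⁻¹' (Icc a b ×ˢ Icc c d)
  have hQΩ : Q ⊆ Ω' := fun y hy => by
    have := hD hy
    simpa using this
  have hQc : IsCompact Q := j.isCompact_preimage.2 (isCompact_Icc.prod isCompact_Icc)
  have hψm : ∀ p, j.symm (box p) ∈ Ω' := fun p => hD (hboxm p)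
  let φ : unitInterval × unitInterval → X := fun p => f (j.symm (box p))
  have hφe : ∀ p, φ p = F.symm ⟨j.symm (box p), hψm p⟩ := fun p => hf ⟨_, hψm p⟩
  have hφc : Continuous φ := by
    have : φ = fun p => (F.symm ⟨j.symm (box p), hψm p⟩ : X) := funext hφe
    rw [this]
    exact continuous_subtype_val.comp (F.symm.continuous.comp
      (Continuous.subtype_mk (j.symm.continuous.comp hboxc) hψm))
  have hφi : Function.Injective φ := fun p q h => by
    rw [hφe, hφe] at h
    have h1 := F.symm.injective (Subtype.ext h)
    exact hboxi (j.symm.injective (congr_arg Subtype.val h1))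
  have himage : ∀ (P : ℝ × ℝ → Prop), φ '' {p | P (box p)} = f '' {y ∈ Q | P (j y)} := fun P => by
    ext x
    constructor
    · rintro ⟨p, hp, rfl⟩
      refine ⟨j.symm (box p), ⟨?_, ?_⟩, rfl⟩
      · simpa [Q] using hboxm p
      · rw [j.apply_symm_apply]; exact hp
    · rintro ⟨y, ⟨hy, hP⟩, rfl⟩
      obtain ⟨p, hp⟩ := hboxs _ hy
      refine ⟨p, ?_, ?_⟩
      · change P (box p); rw [hp]; exact hP
      · simp only [φ, hp, j.symm_apply_apply]
  have hrange : range φ = f '' Q := by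
    rw [← image_univ]
    simpa using himage fun _ => True
  have hL : φ '' {p | p.1 = 0} = f '' {y ∈ Q | (j y).1 = a} := by
    rw [← himage fun q => q.1 = a]
    congr 1; ext p
    simp only [mem_ofPred_eq, box, add_eq_left, mul_eq_zero, hw.ne', or_false]
    exact ⟨fun h => by rw [h]; rfl, fun h => Subtype.ext h⟩
  have hRt : φ '' {p | p.1 = 1} = f '' {y ∈ Q | (j y).1 = b} := by
    rw [← himage fun q => q.1 = b]
    congr 1; ext p
    simp only [mem_ofPred_eq, box]
    constructor
    · intro h; rw [h]; simp
    · intro h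
      have : ((p.1 : ℝ) - 1) * (b - a) = 0 := by linarith
      rcases mul_eq_zero.1 this with h' | h'
      · exact Subtype.ext (by simpa using sub_eq_zero.1 h')
      · exact absurd h' hw.ne'
  have hBt : φ '' {p | p.2 = 0} = f '' {y ∈ Q | (j y).2 = c} := by
    rw [← himage fun q => q.2 = c]
    congr 1; ext p
    simp only [mem_ofPred_eq, box, add_eq_left, mul_eq_zero, hh.ne', or_false]
    exact ⟨fun h => by rw [h]; rfl, fun h => Subtype.ext h⟩
  have hTp : φ '' {p | p.2 = 1} = f '' {y ∈ Q | (j y).2 = d} := by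
    rw [← himage fun q => q.2 = d]
    congr 1; ext p
    simp only [mem_ofPred_eq, box]
    constructor
    · intro h; rw [h]; simp
    · intro h
      have : ((p.2 : ℝ) - 1) * (d - c) = 0 := by linarith
      rcases mul_eq_zero.1 this with h' | h'
      · exact Subtype.ext (by simpa using sub_eq_zero.1 h')
      · exact absurd h' hh.ne'
  have hmain := hrec φ hφc hφi
  set w := ENNReal.ofReal (b - a)
  set h := ENNReal.ofReal (d - c)
  have hh0 : h ≠ 0 := by simpa [h] using hh
  have hhtop : h ≠ ∞ := ENNReal.ofReal_ne_top
  -- Paths joining the images of the vertical sides: density `1 / δ` in `X`.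
  have m1 : modulus (hausdorffTwo X)
      (joiningPaths (φ '' {p | p.1 = 0}) (φ '' {p | p.1 = 1}) (range φ)) ≤ μ Q / δ ^ 2 := by
    refine (modulus_joiningPaths_le _ (isCompact_range hφc).measurableSet hδ0 hδtop ?_).trans ?_
    · rw [hL, hRt]
      rintro _ ⟨y, ⟨hy, hya⟩, rfl⟩ _ ⟨z, ⟨hz, hzb⟩, rfl⟩
      have := hδ _ hy.2 _ hz.2
      rw [← hya, ← hzb] at this
      simpa using this
    · rw [hrange]
      gcongr
      exact hμ Q hQΩ hQc
  have hvol : (volume : Measure Plane) Q = w * h := by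
    rw [hj.measure_preimage (measurableSet_Icc.prod measurableSet_Icc).nullMeasurableSet,
      Measure.volume_eq_prod, Measure.prod_prod, Real.volume_Icc, Real.volume_Icc]
  -- Paths joining the other two sides: transfer to the plane at cost `K`, then use the density `1 /
  -- h`. Only the second coordinate needs to be 1-Lipschitz.
  have m2 : modulus (hausdorffTwo X)
      (joiningPaths (φ '' {p | p.2 = 0}) (φ '' {p | p.2 = 1}) (range φ)) ≤
        K * (w * h / h ^ 2) := by
    rw [hBt, hTp, hrange]
    refine (modulus_joiningPaths_image_le F hK hf hQΩ (sep_subset _ _) (sep_subset _ _)).trans ?_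
    refine mul_le_mul' le_rfl ?_
    rw [← hvol]
    refine modulus_joiningPaths_le _ hQc.measurableSet hh0 hhtop ?_
    rintro y ⟨-, hy⟩ z ⟨-, hz⟩
    rw [edist_dist]
    refine ENNReal.ofReal_le_ofReal (le_trans ?_ (hjd y z))
    rw [hy, hz, abs_sub_comm]
    exact le_abs_self _
  have hfinal := hmain.trans (mul_le_mul' m1 m2)
  have hκ0 : (κ : ℝ≥0∞) ≠ 0 := by exact_mod_cast hκ.ne'
  have hδ2 : δ ^ 2 ≠ 0 := pow_ne_zero 2 hδ0
  have hδ2' : δ ^ 2 ≠ ∞ := ENNReal.pow_ne_top hδtop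
  have hμQ : μ.map j (Icc a b ×ˢ Icc c d) = μ Q :=
    Measure.map_apply j.continuous.measurable (measurableSet_Icc.prod measurableSet_Icc)
  rw [hμQ]
  calc δ ^ 2 * h = (κ * (κ : ℝ≥0∞)⁻¹) * (δ ^ 2 * h) := by
        rw [ENNReal.mul_inv_cancel hκ0 ENNReal.coe_ne_top, one_mul]
    _ ≤ (κ * (μ Q / δ ^ 2 * (K * (w * h / h ^ 2)))) * (δ ^ 2 * h) := by gcongr
    _ = κ * K * w * μ Q * (δ ^ 2 * (δ ^ 2)⁻¹) * (h ^ 2 * (h ^ 2)⁻¹) := by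
        simp only [div_eq_mul_inv]; ring
    _ = κ * K * w * μ Q := by
        rw [ENNReal.mul_inv_cancel hδ2 hδ2', ENNReal.mul_inv_cancel (pow_ne_zero 2 hh0)
          (ENNReal.pow_ne_top hhtop), mul_one, mul_one]
    _ = _ := by rw [ENNReal.coe_mul]

end Rectangles

/-! ### Passage from finite to locally finite measures by exhaustion. -/

theorem IsOpen.exists_relatively_compact_exhaustion {E : Type*} [TopologicalSpace E] [T2Space E]
    [LocallyCompactSpace E] [SecondCountableTopology E] {D : Set E} (hD : IsOpen D) :
    ∃ U : ℕ → Set E, (∀ n, IsOpen (U n)) ∧ Monotone U ∧ ⋃ n, U n = D ∧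
      ∀ n, ∃ S, IsCompact S ∧ U n ⊆ S ∧ S ⊆ D := by
  have : LocallyCompactSpace D := hD.locallyCompactSpace
  let S : CompactExhaustion D := default
  refine ⟨fun n => Subtype.val '' interior (S n), fun n => hD.isOpenMap_subtype_val _ isOpen_interior,
    fun m n h => image_mono (interior_mono (S.subset h)), ?_, fun n =>
    ⟨Subtype.val '' S n, (S.isCompact n).image continuous_subtype_val,
      image_mono interior_subset, Subtype.coe_image_subset _ _⟩⟩
  refine Subset.antisymm (iUnion_subset fun n => Subtype.coe_image_subset _ _) fun x hx => ?_
  obtain ⟨n, hn⟩ := S.exists_mem_nhds ⟨x, hx⟩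
  exact mem_iUnion.2 ⟨n, ⟨x, hx⟩, mem_interior_iff_mem_nhds.2 hn, rfl⟩

section Exhaustion

variable {X : Type*} [MetricSpace X] {D : Set (ℝ × ℝ)} {f : ℝ × ℝ → X} {μ : Measure (ℝ × ℝ)}
  {C : ℝ≥0}

theorem HorizontalBound.restrict (h : HorizontalBound D f μ C) {U : Set (ℝ × ℝ)} (hU : U ⊆ D) :
    HorizontalBound U f (μ.restrict U) C := fun a b c d hab hcd hR δ hδ => by
  rw [Measure.restrict_eq_self _ hR]
  exact h a b c d hab hcd (hR.trans hU) δ hδ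

theorem upperDensity_restrict {U : Set (ℝ × ℝ)} (hU : IsOpen U) {y : ℝ × ℝ} (hy : y ∈ U) :
    upperDensity (μ.restrict U) y = upperDensity μ y :=
  upperDensity_congr hU (fun _ hS => Measure.restrict_eq_self _ hS) hy

/-- The measure with density `upperDensity μ` on `D` is dominated by `μ`. -/
theorem lintegral_mul_upperDensity_le [SFinite μ] (hD : IsOpen D)
    (hfin : ∀ S ⊆ D, IsCompact S → μ S < ∞) {φ : ℝ × ℝ → ℝ≥0∞} (hφ : Measurable φ) :
    ∫⁻ y in D, φ y * upperDensity μ y ≤ ∫⁻ y, φ y ∂μ := by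
  obtain ⟨U, hUo, hUm, rfl, hUc⟩ := hD.exists_relatively_compact_exhaustion
  rw [setLIntegral_iUnion_of_directed _ hUm.directed_le]
  refine iSup_le fun n => ?_
  obtain ⟨S, hS, hUS, hSD⟩ := hUc n
  have : IsFiniteMeasure (μ.restrict (U n)) :=
    ⟨by rw [Measure.restrict_apply_univ]; exact (measure_mono hUS).trans_lt (hfin S hSD hS)⟩
  calc ∫⁻ y in U n, φ y * upperDensity μ y
      = ∫⁻ y in U n, upperDensity (μ.restrict (U n)) y * φ y :=
        setLIntegral_congr_fun (hUo n).measurableSet fun y hy => by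
          simp only [upperDensity_restrict (hUo n) hy, mul_comm]
    _ ≤ ∫⁻ y, upperDensity (μ.restrict (U n)) y * φ y := setLIntegral_le_lintegral _ _
    _ = ∫⁻ y, φ y ∂volume.withDensity (upperDensity (μ.restrict (U n))) :=
        (lintegral_withDensity_eq_lintegral_mul _ (measurable_upperDensity _) hφ).symm
    _ ≤ ∫⁻ y, φ y ∂μ :=
        lintegral_mono' ((withDensity_upperDensity_le _).trans Measure.restrict_le_self) le_rfl

/-- Each compact arc lies in one member of the exhaustion, on which `μ` is finite and the upper
density is unchanged. The exceptional functions of all members are merged into one. -/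
theorem exists_upper_gradient_along_of_isOpen [SFinite μ] (h : HorizontalBound D f μ C)
    (h' : HorizontalBound (Prod.swap ⁻¹' D) (f ∘ Prod.swap) (μ.map Prod.swap) C)
    (hf : ContinuousOn f D) (hD : IsOpen D) (hfin : ∀ S ⊆ D, IsCompact S → μ S < ∞) :
    ∃ ρ : ℝ × ℝ → ℝ≥0∞, Measurable ρ ∧ ∫⁻ y, ρ y ^ 2 ≠ ∞ ∧
      ∀ c : ℝ → ℝ × ℝ, Continuous c →
        (∀ s t, |(c s).1 - (c t).1| + |(c s).2 - (c t).2| ≤ √2 * |s - t|) →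
        ∀ s s', s ≤ s' → (∀ t ∈ Icc s s', c t ∈ D) → ∫⁻ t in Icc s s', ρ (c t) ≠ ∞ →
          ∫⁻ t in Icc s s', (C * upperDensity μ (c t)) ^ (1 / 2 : ℝ) ≠ ∞ ∧
          edist (f (c s)) (f (c s')) ≤
            ENNReal.ofReal √2 * ∫⁻ t in Icc s s', (C * upperDensity μ (c t)) ^ (1 / 2 : ℝ) := by
  obtain ⟨U, hUo, hUm, hUD, hUc⟩ := hD.exists_relatively_compact_exhaustion
  have hUD' : ∀ n, U n ⊆ D := fun n => hUD ▸ subset_iUnion U n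
  have hfinU : ∀ n, IsFiniteMeasure (μ.restrict (U n)) := fun n => by
    obtain ⟨S, hS, hUS, hSD⟩ := hUc n
    exact ⟨by rw [Measure.restrict_apply_univ]; exact (measure_mono hUS).trans_lt (hfin S hSD hS)⟩
  have hswap : ∀ n, (μ.restrict (U n)).map Prod.swap =
      (μ.map Prod.swap).restrict (Prod.swap ⁻¹' U n) := fun n => by
    rw [Measure.restrict_map measurable_swap (measurable_swap (hUo n).measurableSet)]
    rfl
  have key := fun n => exists_upper_gradient_along (h.restrict (hUD' n))
    (by rw [hswap]; exact h'.restrict (preimage_mono (hUD' n))) (hf.mono (hUD' n)) (hUo n)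
  choose ρ hρm hρfin hρ using key
  obtain ⟨σ, hσm, hσfin, hσ⟩ := exists_sq_integrable_ge_mul (volume : Measure (ℝ × ℝ)) hρm hρfin
  -- `τ` excludes the curves along which the gradient itself is not integrable; finiteness is needed
  -- for images of curves to be rectifiable.
  obtain ⟨τ, hτm, hτfin, hτ⟩ := exists_sq_integrable_ge_mul (volume : Measure (ℝ × ℝ))
    (fun n => measurable_sqrt_upperDensity (μ.restrict (U n)) C)
    (fun n => lintegral_sqrt_upperDensity_sq_ne_top (μ.restrict (U n)) C)
  refine ⟨fun y => max (σ y) (τ y), hσm.max hτm, ?_, fun c hc hcl s s' hs hcD hint => ?_⟩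
  · refine ne_top_of_le_ne_top (ENNReal.add_ne_top.2 ⟨hσfin, hτfin⟩)
      ((lintegral_mono fun y => ?_).trans (lintegral_add_left (hσm.pow_const 2) _).le)
    rcases le_total (σ y) (τ y) with hle | hle
    · simp only [max_eq_right hle]; exact le_add_self
    · simp only [max_eq_left hle]; exact le_self_add
  · obtain ⟨n, hn⟩ := (isCompact_Icc.image hc).elim_directed_cover U hUo
      (by rw [hUD]; rintro _ ⟨t, ht, rfl⟩; exact hcD t ht) hUm.directed_le
    have hcU : ∀ t ∈ Icc s s', c t ∈ U n := fun t ht => hn (mem_image_of_mem _ ht)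
    have hsmall : ∀ {φ : ℝ × ℝ → ℝ≥0∞} {k : ℝ≥0}, 0 < k → (∀ y, k * φ y ≤ max (σ y) (τ y)) →
        ∫⁻ t in Icc s s', φ (c t) ≠ ∞ := fun {φ k} hk hφ htop => by
      have : (k : ℝ≥0∞) * ∫⁻ t in Icc s s', φ (c t) ≤ ∫⁻ t in Icc s s', max (σ (c t)) (τ (c t)) := by
        rw [← lintegral_const_mul' _ _ ENNReal.coe_ne_top]
        exact lintegral_mono fun t => hφ (c t)
      rw [htop, ENNReal.mul_top (by exact_mod_cast hk.ne')] at this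
      exact hint (top_le_iff.1 this)
    have heq : ∫⁻ t in Icc s s', (C * upperDensity (μ.restrict (U n)) (c t)) ^ (1 / 2 : ℝ) =
        ∫⁻ t in Icc s s', (C * upperDensity μ (c t)) ^ (1 / 2 : ℝ) :=
      setLIntegral_congr_fun measurableSet_Icc fun t ht => by
        simp only [upperDensity_restrict (hUo n) (hcU t ht)]
    rw [← heq]
    obtain ⟨k, hk, hk'⟩ := hσ n
    obtain ⟨m, hm, hm'⟩ := hτ n
    exact ⟨hsmall hm fun y => (hm' y).trans (le_max_right _ _),
      hρ n c hc hcl s s' hs hcU (hsmall hk fun y => (hk' y).trans (le_max_left _ _))⟩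

end Exhaustion

/-! ### From unit speed curves to general paths. -/

section CurvewiseUpperGradient

variable {Y X : Type*} [MetricSpace Y] [MetricSpace X]

theorem IntervalPath.LocallyRectifiable.exists_arcLength {γ : IntervalPath Y}
    (hγ : γ.LocallyRectifiable) {a b : ℝ} (ha : a ∈ γ.dom) (hb : b ∈ γ.dom) (hab : a ≤ b) :
    ∃ (c : ℝ → Y) (v : ℝ → ℝ) (l : ℝ), LipschitzWith 1 c ∧ 0 ≤ l ∧ MonotoneOn v (Icc a b) ∧
      v a = 0 ∧ v '' Icc a b = Icc 0 l ∧ (∀ t ∈ Icc a b, c (v t) = γ.toFun t) ∧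
      ∀ ρ : Y → ℝ≥0∞, γ.compactIntegral ρ a b = ∫⁻ t in Icc 0 l, ρ (c t) := by
  have hc := γ.continuousOn.mono (γ.Icc_subset_dom ha hb)
  have hv := hγ.boundedVariationOn ha hb
  obtain ⟨c, hc1, -, hcn, hcv⟩ := exists_arcLength_extension hab hc hv
  refine ⟨c, variationOnFromTo γ.toFun (Icc a b) a, (eVariationOn γ.toFun (Icc a b)).toReal, hc1,
    ENNReal.toReal_nonneg,
    variationOnFromTo.monotoneOn hv.locallyBoundedVariationOn (left_mem_Icc.2 hab),
    variationOnFromTo.self _ _ _, image_variationOnFromTo_Icc hab hc hv, hcv, fun ρ => ?_⟩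
  exact setLIntegral_congr_fun measurableSet_Icc fun t ht => by simp only [hcn t ht]

variable {f : Y → X} {g ρe : Y → ℝ≥0∞}

theorem IntervalPath.edist_le_lineIntegral_of_forall_lipschitz
    (H : ∀ c : ℝ → Y, LipschitzWith 1 c → ∀ s s', s ≤ s' → ∫⁻ t in Icc s s', ρe (c t) ≠ ∞ →
      ∫⁻ t in Icc s s', g (c t) ≠ ∞ ∧ edist (f (c s)) (f (c s')) ≤ ∫⁻ t in Icc s s', g (c t))
    {γ : IntervalPath Y} (hγ : γ.LocallyRectifiable) (hfin : γ.lineIntegral ρe ≠ ∞)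
    {x y : Y} (hx : x ∈ γ.trace) (hy : y ∈ γ.trace) : edist (f x) (f y) ≤ γ.lineIntegral g := by
  obtain ⟨a, ha, rfl⟩ := hx
  obtain ⟨b, hb, rfl⟩ := hy
  wlog hab : a ≤ b generalizing a b
  · rw [edist_comm]
    exact this b hb a ha (le_of_not_ge hab)
  obtain ⟨c, v, l, hc, hl, hvm, hva, him, hcv, hint⟩ := hγ.exists_arcLength ha hb hab
  have hvb : v b = l := by
    have hl' : l ∈ v '' Icc a b := him ▸ right_mem_Icc.2 hl
    obtain ⟨t, ht, rfl⟩ := hl'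
    have h1 : v b ∈ Icc 0 (v t) := him ▸ mem_image_of_mem v (right_mem_Icc.2 hab)
    exact le_antisymm h1.2 (hvm ht (right_mem_Icc.2 hab) ht.2)
  have h1 := (H c hc 0 l hl (by
    rw [← hint]
    exact ne_top_of_le_ne_top hfin (γ.compactIntegral_le_lineIntegral ρe ha hb hab))).2
  rw [← hva, ← hvb, hcv a (left_mem_Icc.2 hab), hcv b (right_mem_Icc.2 hab), hva, hvb, ← hint] at h1
  exact h1.trans (γ.compactIntegral_le_lineIntegral g ha hb hab)

/-- Applied to all subarcs of the arc length parametrization `c`, the upper gradient inequality says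
that `f ∘ c` has metric speed at most `g ∘ c`. The image is thus locally rectifiable, with length
element at most `g ds`. -/
theorem IntervalPath.lineIntegral_map_le_of_forall_lipschitz [MeasurableSpace Y] [BorelSpace Y]
    [MeasurableSpace X] [BorelSpace X] (hf : Continuous f) (hg : Measurable g)
    (H : ∀ c : ℝ → Y, LipschitzWith 1 c → ∀ s s', s ≤ s' → ∫⁻ t in Icc s s', ρe (c t) ≠ ∞ →
      ∫⁻ t in Icc s s', g (c t) ≠ ∞ ∧ edist (f (c s)) (f (c s')) ≤ ∫⁻ t in Icc s s', g (c t))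
    {γ : IntervalPath Y} (hγ : γ.LocallyRectifiable) (hfin : γ.lineIntegral ρe ≠ ∞) :
    (γ.map f hf).LocallyRectifiable ∧ ∀ ρ : X → ℝ≥0∞, Measurable ρ →
      (γ.map f hf).lineIntegral ρ ≤ γ.lineIntegral fun y => ρ (f y) * g y := by
  have key : ∀ a ∈ γ.dom, ∀ b ∈ γ.dom, a ≤ b → BoundedVariationOn (f ∘ γ.toFun) (Icc a b) ∧
      ∀ ρ : X → ℝ≥0∞, Measurable ρ →
        (γ.map f hf).compactIntegral ρ a b ≤ γ.compactIntegral (fun y => ρ (f y) * g y) a b := by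
    intro a ha b hb hab
    obtain ⟨c, v, l, hc, hl, hvm, hva, him, hcv, hint⟩ := hγ.exists_arcLength ha hb hab
    have hfin' : ∫⁻ t in Icc 0 l, ρe (c t) ≠ ∞ := by
      rw [← hint]
      exact ne_top_of_le_ne_top hfin (γ.compactIntegral_le_lineIntegral ρe ha hb hab)
    have hG := (H c hc 0 l hl hfin').1
    have hG' : ∀ x ∈ Icc 0 l, ∀ y ∈ Icc 0 l, x ≤ y →
        edist ((f ∘ c) x) ((f ∘ c) y) ≤ ∫⁻ t in Icc x y, g (c t) := fun x hx y hy hxy =>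
      (H c hc x y hxy (ne_top_of_le_ne_top hfin'
        (lintegral_mono_set (Icc_subset_Icc hx.1 hy.2)))).2
    have heq : EqOn (f ∘ γ.toFun) ((f ∘ c) ∘ v) (Icc a b) := fun t ht => by
      simp only [Function.comp_apply, hcv t ht]
    have hvar : eVariationOn (f ∘ γ.toFun) (Icc a b) = eVariationOn (f ∘ c) (Icc 0 l) := by
      rw [eVariationOn.congr heq, eVariationOn.comp_eq_of_monotoneOn _ _ hvm, him]
    have hbv : BoundedVariationOn (f ∘ c) (Icc 0 l) :=
      ne_top_of_le_ne_top hG (eVariationOn_Icc_le_lintegral hG')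
    refine ⟨by unfold BoundedVariationOn; rw [hvar]; exact hbv, fun ρ hρ => ?_⟩
    rw [hint]
    refine le_trans (le_of_eq ?_) (lintegral_naturalParameterization_le (hf.comp hc.continuous)
      (hg.comp hc.continuous.measurable) hl hG.lt_top hG' hρ)
    change ∫⁻ t in Icc 0 (eVariationOn (f ∘ γ.toFun) (Icc a b)).toReal,
      ρ (naturalParameterization (f ∘ γ.toFun) (Icc a b) a t) = _
    rw [hvar]
    refine setLIntegral_congr_fun measurableSet_Icc fun σ hσ => ?_
    simp only [naturalParameterization_comp_of_monotoneOn hl hab hvm hva him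
      (hf.comp hc.continuous).continuousOn hbv heq hσ]
  refine ⟨fun a b ha hb => ?_, fun ρ hρ => ?_⟩
  · change BoundedVariationOn (f ∘ γ.toFun) (γ.dom ∩ Icc a b)
    rcases le_total a b with hab | hab
    · exact (key a ha b hb hab).1.mono inter_subset_right
    · refine BoundedVariationOn.mono ((key a ha a ha le_rfl).1) (inter_subset_right.trans ?_)
      rintro t ⟨h1, h2⟩
      exact ⟨h1, h2.trans hab⟩
  · exact iSup₂_mono fun a ha => iSup₂_mono fun b hb => iSup_mono fun hab => (key a ha b hb hab).2 ρ hρ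

end CurvewiseUpperGradient

/-- In bounding a modulus, the paths over which a fixed square integrable function has infinite
integral may be disregarded. -/
theorem modulus_le_of_forall_lineIntegral_ne_top {Y : Type*} [MetricSpace Y] [MeasurableSpace Y]
    (μ : Measure Y) {Γ : Set (IntervalPath Y)} {p σ : Y → ℝ≥0∞} (hp : Measurable p)
    (hσ : Measurable σ) (hfin : ∫⁻ y, σ y ^ 2 ∂μ ≠ ∞)
    (h : ∀ γ ∈ Γ, γ.LocallyRectifiable → γ.lineIntegral σ ≠ ∞ → 1 ≤ γ.lineIntegral p) :
    modulus μ Γ ≤ ∫⁻ y, p y ^ 2 ∂μ := by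
  refine ENNReal.le_of_forall_pos_le_add fun ε hε _ => ?_
  set S : ℝ≥0 := (∫⁻ y, σ y ^ 2 ∂μ).toNNReal
  have hS : ∫⁻ y, σ y ^ 2 ∂μ = S := (ENNReal.coe_toNNReal hfin).symm
  set δ : ℝ≥0 := NNReal.sqrt (ε / (S + 1))
  have hδ : 0 < δ := NNReal.sqrt_pos.2 (by positivity)
  have hδS : (δ : ℝ≥0∞) ^ 2 * S ≤ ε := by
    rw [← ENNReal.coe_pow, NNReal.sq_sqrt, ← ENNReal.coe_mul, ENNReal.coe_le_coe,
      div_mul_eq_mul_div, div_le_iff₀ (by positivity)]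
    gcongr
    exact le_self_add
  -- The exceptional paths are served by `δ σ`, at an extra cost of at most `δ² ∫ σ² ≤ ε`.
  have hadm : IsAdmissible Γ fun y => max (p y) (δ * σ y) := by
    refine ⟨hp.max (hσ.const_mul _), fun γ hγ hrect => ?_⟩
    by_cases htop : γ.lineIntegral σ = ∞
    · exact (γ.one_le_lineIntegral_const_mul htop (by exact_mod_cast hδ.ne')
        ENNReal.coe_ne_top).trans (γ.lineIntegral_mono fun y => le_max_right _ _)
    · exact (h γ hγ hrect htop).trans (γ.lineIntegral_mono fun y => le_max_left _ _)
  calc modulus μ Γ ≤ ∫⁻ y, max (p y) (δ * σ y) ^ 2 ∂μ := iInf₂_le _ hadm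
    _ ≤ ∫⁻ y, p y ^ 2 + (δ : ℝ≥0∞) ^ 2 * σ y ^ 2 ∂μ := lintegral_mono fun y => by
        rw [← mul_pow]
        rcases le_total (p y) (δ * σ y) with hle | hle
        · simp only [max_eq_right hle]; exact le_add_self
        · simp only [max_eq_left hle]; exact le_self_add
    _ = ∫⁻ y, p y ^ 2 ∂μ + (δ : ℝ≥0∞) ^ 2 * S := by
        rw [lintegral_add_left (hp.pow_const 2), lintegral_const_mul _ (hσ.pow_const 2), hS]
    _ ≤ _ := by gcongr

/-- Opposite sides of a rectangle have disjoint compact images, hence a positive distance `δ`, and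
`C = 0` would force `δ = 0`. This yields `K ≠ 0`. -/
theorem HorizontalBound.constant_ne_zero {X : Type*} [MetricSpace X] {D : Set (ℝ × ℝ)}
    {f : ℝ × ℝ → X} {μ : Measure (ℝ × ℝ)} {C : ℝ≥0} (h : HorizontalBound D f μ C)
    (hf : ContinuousOn f D) (hinj : InjOn f D) (hDo : IsOpen D) (hD : D.Nonempty) : C ≠ 0 := by
  rintro rfl
  obtain ⟨p, hp⟩ := hD
  obtain ⟨r, hr, hball⟩ := Metric.nhds_basis_closedBall.mem_iff.1 (hDo.mem_nhds hp)
  have hrect : Icc (p.1 - r) (p.1 + r) ×ˢ Icc (p.2 - r) (p.2 + r) ⊆ D := by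
    rw [← Real.closedBall_eq_Icc, ← Real.closedBall_eq_Icc, closedBall_prod_same]
    exact hball
  have hside : ∀ x ∈ Icc (p.1 - r) (p.1 + r), {x} ×ˢ Icc (p.2 - r) (p.2 + r) ⊆ D ∧
      IsCompact (f '' ({x} ×ˢ Icc (p.2 - r) (p.2 + r))) := fun x hx => by
    have hsub : {x} ×ˢ Icc (p.2 - r) (p.2 + r) ⊆ D :=
      (prod_mono (singleton_subset_iff.2 hx) Subset.rfl).trans hrect
    exact ⟨hsub, (isCompact_singleton.prod isCompact_Icc).image_of_continuousOn (hf.mono hsub)⟩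
  have hL := hside (p.1 - r) (left_mem_Icc.2 (by linarith))
  have hR := hside (p.1 + r) (right_mem_Icc.2 (by linarith))
  have hdisj : Disjoint (f '' ({p.1 - r} ×ˢ Icc (p.2 - r) (p.2 + r)))
      (f '' ({p.1 + r} ×ˢ Icc (p.2 - r) (p.2 + r))) := by
    rw [Set.disjoint_left]
    rintro _ ⟨u, hu, rfl⟩ ⟨w, hw, huw⟩
    have h2 : w.1 = p.1 + r := hw.1
    have h3 : u.1 = p.1 - r := hu.1
    rw [hinj (hR.1 hw) (hL.1 hu) huw] at h2
    linarith
  obtain ⟨δ, hδ, hδ'⟩ := Metric.exists_pos_forall_lt_edist hL.2 hR.2.isClosed hdisj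
  have h := h _ _ _ _ (by linarith : p.1 - r < p.1 + r) (by linarith : p.2 - r < p.2 + r)
    hrect δ fun t ht t' ht' => (hδ' _ (mem_image_of_mem f ⟨mem_singleton _, ht⟩) _
      (mem_image_of_mem f ⟨mem_singleton _, ht'⟩)).le
  rw [ENNReal.coe_zero, zero_mul, zero_mul, nonpos_iff_eq_zero, mul_eq_zero,
    ENNReal.ofReal_eq_zero] at h
  rcases h with h | h
  · exact pow_ne_zero 2 (by exact_mod_cast hδ.ne') h
  · linarith

/-! ### The inverse map and its volume derivative in coordinates. -/

section Parametrization

variable {X : Type*} [MetricSpace X] [MeasurableSpace X] [BorelSpace X] {Ω : Set X}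
  {Ω' : Set Plane}

/-- Extension to the plane of the inverse `f` of `F` and of its volume derivative `J`, with the change
of variables inequality for `J` and the upper gradient inequality along curves off a family of
modulus zero, that family being described by `σ`. -/
theorem exists_planar_density
    (hX : Nonempty (X ≃ₜ Plane))
    (hfin : ∀ E : Set X, IsCompact E → hausdorffTwo X E < ∞)
    {κ : ℝ≥0} (hκ : 0 < κ) (hrec : LowerReciprocal X κ)
    (hΩ : IsOpen Ω) (hΩ' : IsOpen Ω') (hne : Ω'.Nonempty) (F : Ω ≃ₜ Ω') {K : ℝ≥0}
    (hK : ∀ Γ : Set (IntervalPath Ω),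
      modulus (hausdorffTwo X) (IntervalPath.map Subtype.val continuous_subtype_val '' Γ) ≤
        K * modulus (volume : Measure Plane)
          (IntervalPath.map (fun x : Ω => (F x : Plane))
            (continuous_subtype_val.comp F.continuous) '' Γ)) :
    K ≠ 0 ∧ ∃ (f : Plane → X) (J σ : Plane → ℝ≥0∞), Measurable f ∧ Measurable J ∧ Measurable σ ∧
      ∫⁻ y, σ y ^ 2 ≠ ∞ ∧ (∀ y : Ω', f y = F.symm y) ∧ (∀ y : Ω', J y = inverseJacobian F y) ∧
      (∀ φ : X → ℝ≥0∞, Measurable φ → ∫⁻ y in Ω', φ (f y) * J y ≤ ∫⁻ x, φ x ∂hausdorffTwo X) ∧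
      ∀ c : ℝ → Plane, LipschitzWith 1 c → ∀ s s', s ≤ s' → (∀ t ∈ Icc s s', c t ∈ Ω') →
        ∫⁻ t in Icc s s', σ (c t) ≠ ∞ →
        ∫⁻ t in Icc s s', (2 * κ * K * J (c t)) ^ (1 / 2 : ℝ) ≠ ∞ ∧
        edist (f (c s)) (f (c s')) ≤ ∫⁻ t in Icc s s', (2 * κ * K * J (c t)) ^ (1 / 2 : ℝ) := by
  obtain ⟨e⟩ := hX
  have : SecondCountableTopology X := e.isInducing.secondCountableTopology
  have : LocallyCompactSpace X := e.isClosedEmbedding.locallyCompactSpace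
  have : IsFiniteMeasureOnCompacts (hausdorffTwo X) := ⟨fun {E} hE => hfin E hE⟩
  have : IsLocallyFiniteMeasure (hausdorffTwo X) :=
    isLocallyFiniteMeasure_of_isFiniteMeasureOnCompacts
  let f : Plane → X := Function.extend Subtype.val (fun y : Ω' => (F.symm y : X)) fun _ => e.symm 0
  let G : X → Plane := Function.extend Subtype.val (fun x : Ω => (F x : Plane)) fun _ => 0
  have hf : ∀ y : Ω', f y = F.symm y := fun y => Subtype.val_injective.extend_apply _ _ y
  have hG : ∀ x : Ω, G x = F x := fun x => Subtype.val_injective.extend_apply _ _ x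
  have hfm : Measurable f := (MeasurableEmbedding.subtype_coe hΩ'.measurableSet).measurable_extend
    (continuous_subtype_val.comp F.symm.continuous).measurable measurable_const
  have hGm : Measurable G := (MeasurableEmbedding.subtype_coe hΩ.measurableSet).measurable_extend
    (continuous_subtype_val.comp F.continuous).measurable measurable_const
  have hfc : ContinuousOn f Ω' := by
    rw [continuousOn_iff_continuous_domRestrict]
    exact (continuous_subtype_val.comp F.symm.continuous).congr fun y => (hf y).symm
  have hpre : ∀ S : Set Plane, G ⁻¹' S ∩ Ω = Subtype.val '' {x : Ω | (F x : Plane) ∈ S} := by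
    intro S
    ext x
    constructor
    · rintro ⟨hx, hxΩ⟩
      refine ⟨⟨x, hxΩ⟩, ?_, rfl⟩
      rw [mem_ofPred_eq, ← hG]; exact hx
    · rintro ⟨x, hx, rfl⟩
      refine ⟨?_, x.2⟩
      rw [mem_preimage, hG]; exact hx
  have himage : ∀ S ⊆ Ω', f '' S = Subtype.val '' {x : Ω | (F x : Plane) ∈ S} := by
    intro S hS
    ext x
    constructor
    · rintro ⟨y, hy, rfl⟩
      refine ⟨F.symm ⟨y, hS hy⟩, ?_, (hf ⟨y, hS hy⟩).symm⟩
      rw [mem_ofPred_eq, F.apply_symm_apply]; exact hy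
    · rintro ⟨x, hx, rfl⟩
      refine ⟨F x, hx, ?_⟩
      rw [hf, F.symm_apply_apply]
  -- The transport of `H²` on `Ω` by `F`; its upper density in coordinates is the volume derivative.
  set ν : Measure Plane := ((hausdorffTwo X).restrict Ω).map G with hν
  have hνapply : ∀ S, MeasurableSet S →
      ν S = hausdorffTwo X (Subtype.val '' {x : Ω | (F x : Plane) ∈ S}) := fun S hS => by
    rw [hν, Measure.map_apply hGm hS, Measure.restrict_apply (hGm hS), hpre]
  have hνimage : ∀ S ⊆ Ω', IsCompact S → hausdorffTwo X (f '' S) = ν S := fun S hS hSc => by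
    rw [hνapply S hSc.measurableSet, himage S hS]
  set μ : Measure (ℝ × ℝ) := ν.map planeCoord with hμ
  have hpm : Measurable planeCoord := planeCoord.continuous.measurable
  set D : Set (ℝ × ℝ) := planeCoord.symm ⁻¹' Ω' with hD
  have hDo : IsOpen D := hΩ'.preimage planeCoord.symm.continuous
  have hbound : HorizontalBound D (f ∘ planeCoord.symm) μ (κ * K) :=
    horizontalBound_of_lowerReciprocal hκ hrec F hK hf (fun S hS hSc => (hνimage S hS hSc).le)
      planeCoord measurePreserving_planeCoord fun y z => abs_coord_sub_le_dist y z 1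
  -- The vertical bound is the horizontal one for the coordinates in reversed order.
  have hbound' : HorizontalBound (Prod.swap ⁻¹' D) ((f ∘ planeCoord.symm) ∘ Prod.swap)
      (μ.map Prod.swap) (κ * K) := by
    have := horizontalBound_of_lowerReciprocal hκ hrec F hK hf
      (fun S hS hSc => (hνimage S hS hSc).le) (planeCoord.trans (Homeomorph.prodComm ℝ ℝ))
      ((Measure.measurePreserving_swap (μ := volume) (ν := volume)).comp
        measurePreserving_planeCoord) fun y z => abs_coord_sub_le_dist y z 0
    rw [hμ, Measure.map_map measurable_swap hpm]
    exact this
  have hfinD : ∀ S ⊆ D, IsCompact S → μ S < ∞ := fun S hS hSc => by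
    have hSc' : IsCompact (planeCoord ⁻¹' S) := planeCoord.isCompact_preimage.2 hSc
    have hSΩ : planeCoord ⁻¹' S ⊆ Ω' := fun y hy => by simpa [D] using hS hy
    rw [hμ, Measure.map_apply hpm hSc.measurableSet, ← hνimage _ hSΩ hSc']
    exact hfin _ (hSc'.image_of_continuousOn (hfc.mono hSΩ))
  have hfD : ContinuousOn (f ∘ planeCoord.symm) D :=
    hfc.comp planeCoord.symm.continuous.continuousOn fun _ h => h
  have hinj : InjOn (f ∘ planeCoord.symm) D := fun u hu w hw huw => by
    have h1 := F.symm.injective (Subtype.ext ((hf ⟨_, hu⟩).symm.trans (huw.trans (hf ⟨_, hw⟩))))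
    exact planeCoord.symm.injective (congr_arg Subtype.val h1)
  have hneD : D.Nonempty := let ⟨y, hy⟩ := hne; ⟨planeCoord y, by simpa [D] using hy⟩
  refine ⟨fun hK0 => hbound.constant_ne_zero hfD hinj hDo hneD (by rw [hK0, mul_zero]), ?_⟩
  obtain ⟨σ, hσm, hσfin, hσ⟩ := exists_upper_gradient_along_of_isOpen hbound hbound' hfD hDo hfinD
  have hJm : Measurable fun y => upperDensity μ (planeCoord y) := (measurable_upperDensity μ).comp hpm
  -- The `√2` from the `ℓ¹` speed enters the square root as the factor `2`.
  have hsqrt : ∀ a : ℝ≥0∞, ENNReal.ofReal √2 * ((κ * K : ℝ≥0) * a) ^ (1 / 2 : ℝ) =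
      (2 * κ * K * a) ^ (1 / 2 : ℝ) := fun a => by
    rw [Real.sqrt_eq_rpow, ← ENNReal.ofReal_rpow_of_pos two_pos,
      ← ENNReal.mul_rpow_of_nonneg _ _ (by norm_num), ENNReal.coe_mul, ENNReal.ofReal_ofNat]
    congr 1
    ring
  have hsquare : ∀ (y : Plane) (r : ℝ), squareDensity μ r (planeCoord y) =
      hausdorffTwo X (Subtype.val '' {x : Ω | (F x : Plane) ∈ planeSquare y r}) /
        ENNReal.ofReal (4 * r ^ 2) := fun y r => by
    have hm : MeasurableSet (planeSquare y r) := by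
      rw [← preimage_planeCoord_closedBall]
      exact hpm Metric.isClosed_closedBall.measurableSet
    rw [squareDensity, hμ, Measure.map_apply hpm Metric.isClosed_closedBall.measurableSet,
      preimage_planeCoord_closedBall, hνapply _ hm]
  refine ⟨f, fun y => upperDensity μ (planeCoord y), fun y => σ (planeCoord y), hfm, hJm,
    hσm.comp hpm, ?_, hf, fun y => ?_, fun φ hφ => ?_, fun c hc s s' hs hcΩ hint => ?_⟩
  · exact (measurePreserving_planeCoord.lintegral_comp (hσm.pow_const 2)).trans_ne hσfin
  · simp only [upperDensity, hsquare]
    rfl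
  · have hφm : Measurable fun z => φ (f (planeCoord.symm z)) :=
      hφ.comp (hfm.comp planeCoord.symm.continuous.measurable)
    have h1 := lintegral_mul_upperDensity_le hDo hfinD hφm
    have hDΩ : planeCoord ⁻¹' D = Ω' := by ext y; simp [D]
    have hφf : Measurable fun y => φ (f y) := hφ.comp hfm
    have h2 : ∫⁻ z, φ (f (planeCoord.symm z)) ∂μ = ∫⁻ x in Ω, φ (f (G x)) ∂hausdorffTwo X := by
      rw [hμ, lintegral_map hφm hpm]
      simp only [Homeomorph.symm_apply_apply]
      rw [hν, lintegral_map hφf hGm]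
    rw [← measurePreserving_planeCoord.setLIntegral_comp_preimage hDo.measurableSet
      (f := fun z => φ (f (planeCoord.symm z)) * upperDensity μ z)
      (hφm.mul (measurable_upperDensity μ)), hDΩ, h2] at h1
    simp only [Homeomorph.symm_apply_apply] at h1
    refine h1.trans (le_trans (le_of_eq ?_) (setLIntegral_le_lintegral Ω φ))
    refine setLIntegral_congr_fun hΩ.measurableSet fun x hx => ?_
    have h2 := hG ⟨x, hx⟩
    simp only at h2
    simp only [h2, hf, F.symm_apply_apply]
  · have h1 := hσ (fun t => planeCoord (c t)) (planeCoord.continuous.comp hc.continuous)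
      (fun t t' => (abs_coord_add_abs_coord_le (c t) (c t')).trans (by
        gcongr
        simpa [Real.dist_eq] using hc.dist_le_mul t t'))
      s s' hs (fun t ht => by simpa [D] using hcΩ t ht) hint
    simp only [Function.comp_apply, Homeomorph.symm_apply_apply] at h1
    rw [← lintegral_const_mul' _ _ ENNReal.ofReal_ne_top] at h1
    simp only [hsqrt] at h1
    refine ⟨?_, h1.2⟩
    simp only [← hsqrt]
    rw [lintegral_const_mul' _ _ ENNReal.ofReal_ne_top]
    exact ENNReal.mul_ne_top ENNReal.ofReal_ne_top h1.1

end Parametrization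

/-! ### The weak upper gradient and the modulus inequality. -/

theorem proposition10p2
    {X : Type*} [MetricSpace X] [MeasurableSpace X] [BorelSpace X]
    (hX : Nonempty (X ≃ₜ Plane))
    (hfin : ∀ E : Set X, IsCompact E → hausdorffTwo X E < ∞)
    (κ : ℝ≥0) (hκ : 0 < κ) (hrec : LowerReciprocal X κ)
    (Ω : Set X) (hΩ : IsOpen Ω) (hΩc : IsConnected Ω)
    (Ω' : Set Plane) (F : Ω ≃ₜ Ω') (K : ℝ≥0)
    (hK : ∀ Γ : Set (IntervalPath Ω),
      modulus (hausdorffTwo X) (IntervalPath.map Subtype.val continuous_subtype_val '' Γ) ≤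
        K * modulus (volume : Measure Plane)
          (IntervalPath.map (fun x : Ω => (F x : Plane))
            (continuous_subtype_val.comp F.continuous) '' Γ)) :
    IsWeakUpperGradientOn (volume : Measure Plane) Ω' (fun y : Ω' => (F.symm y : X))
        (fun y : Ω' => (2 * κ * K * inverseJacobian F y) ^ (1 / 2 : ℝ)) ∧
      ∀ Γ : Set (IntervalPath Ω),
        modulus (volume : Measure Plane)
            (IntervalPath.map (fun x : Ω => (F x : Plane))
              (continuous_subtype_val.comp F.continuous) '' Γ) ≤
          2 * κ * K *
            modulus (hausdorffTwo X)
              (IntervalPath.map Subtype.val continuous_subtype_val '' Γ) := by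
  obtain ⟨e⟩ := hX
  have hΩ' : IsOpen Ω' := isOpen_of_homeomorph_of_isOpen e hΩ F
  obtain ⟨x, hx⟩ := hΩc.nonempty
  obtain ⟨hK0, f, J, σ, hfm, hJm, hσm, hσfin, hf, hJ, hint, hcurve⟩ :=
    exists_planar_density ⟨e⟩ hfin hκ hrec hΩ hΩ' ⟨F ⟨x, hx⟩, Subtype.coe_prop _⟩ F hK
  have hgm : Measurable fun y : Plane => (2 * κ * K * J y) ^ (1 / 2 : ℝ) :=
    (hJm.const_mul _).pow_const _
  have hcont : Continuous fun y : Ω' => (F.symm y : X) :=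
    continuous_subtype_val.comp F.symm.continuous
  have hg : (fun y : Ω' => (2 * κ * K * inverseJacobian F y) ^ (1 / 2 : ℝ)) =
      fun y : Ω' => (2 * κ * K * J y) ^ (1 / 2 : ℝ) := by
    ext y; rw [hJ]
  have hgm' : Measurable fun y : Ω' => (2 * κ * K * J y) ^ (1 / 2 : ℝ) :=
    hgm.comp measurable_subtype_coe
  have H : ∀ c : ℝ → Ω', LipschitzWith 1 c → ∀ s s', s ≤ s' →
      ∫⁻ t in Icc s s', (fun y : Ω' => σ y) (c t) ≠ ∞ →
      ∫⁻ t in Icc s s', (fun y : Ω' => (2 * κ * K * J y) ^ (1 / 2 : ℝ)) (c t) ≠ ∞ ∧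
      edist (F.symm (c s) : X) (F.symm (c s') : X) ≤
        ∫⁻ t in Icc s s', (fun y : Ω' => (2 * κ * K * J y) ^ (1 / 2 : ℝ)) (c t) := by
    intro c hc s s' hs hsfin
    have h := hcurve (fun t => (c t : Plane)) (fun t t' => hc t t') s s' hs
      (fun t _ => (c t).2) hsfin
    simp only [hf] at h
    exact h
  refine ⟨?_, fun Γ => ?_⟩
  · rw [hg]
    refine ⟨hgm', {γ | γ.lineIntegral (fun y : Ω' => σ y) = ∞},
      modulus_eq_zero_of_lineIntegral_eq_top _ hσm hσfin ?_, fun γ hγ hrect y hy z hz =>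
        IntervalPath.edist_le_lineIntegral_of_forall_lipschitz
          (f := fun y : Ω' => (F.symm y : X)) H hrect hγ hy hz⟩
    rintro _ ⟨γ, hγ, rfl⟩
    rw [IntervalPath.lineIntegral_map_val]
    exact hγ
  -- A nonzero finite constant can be moved inside the infimum defining the modulus.
  · have hB0 : (2 * κ * K : ℝ≥0∞) ≠ 0 := by
      simp [hκ.ne', hK0]
    have hBtop : (2 * κ * K : ℝ≥0∞) ≠ ∞ := by finiteness
    unfold modulus
    rw [ENNReal.mul_iInf_of_ne hB0 hBtop]
    refine le_iInf fun ρ => ?_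
    rw [ENNReal.mul_iInf_of_ne hB0 hBtop]
    refine le_iInf fun hρ => ?_
    -- The pullback of `ρ`, weighted by the upper gradient and extended by zero; it is admissible
    -- for the image family off the exceptional paths.
    set p : Plane → ℝ≥0∞ := Ω'.indicator fun y => ρ (f y) * (2 * κ * K * J y) ^ (1 / 2 : ℝ)
    have hpm : Measurable p := ((hρ.1.comp hfm).mul hgm).indicator hΩ'.measurableSet
    refine (modulus_le_of_forall_lineIntegral_ne_top volume hpm hσm hσfin ?_).trans ?_
    · rintro _ ⟨γ, hγ, rfl⟩ hrect hne
      let η : IntervalPath Ω' := γ.map F F.continuous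
      have hη : IntervalPath.map Subtype.val continuous_subtype_val η =
        IntervalPath.map (fun x : Ω => (F x : Plane))
          (continuous_subtype_val.comp F.continuous) γ := rfl
      rw [← hη, IntervalPath.lineIntegral_map_val] at hne ⊢
      obtain ⟨hr, hle⟩ := IntervalPath.lineIntegral_map_le_of_forall_lipschitz
        (f := fun y : Ω' => (F.symm y : X)) hcont hgm' H (γ := η) hrect hne
      have hγX : η.map (fun y : Ω' => (F.symm y : X)) hcont =
          γ.map Subtype.val continuous_subtype_val := by
        simp only [IntervalPath.map, η, IntervalPath.mk.injEq, true_and]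
        ext t
        simp
      rw [hγX] at hr hle
      refine (hρ.2 _ (mem_image_of_mem _ hγ) hr).trans ((hle ρ hρ.1).trans
        (η.lineIntegral_mono fun y => ?_))
      simp only [p, indicator_of_mem y.2, hf, le_refl]
    · calc ∫⁻ y, p y ^ 2 = ∫⁻ y in Ω', 2 * κ * K * (ρ (f y) ^ 2 * J y) := by
            rw [← lintegral_indicator hΩ'.measurableSet]
            refine lintegral_congr fun y => ?_
            by_cases hy : y ∈ Ω'
            · simp only [p, indicator_of_mem hy]
              rw [mul_pow, ← ENNReal.rpow_mul_natCast]
              norm_num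
              ring
            · simp [p, hy]
        _ = 2 * κ * K * ∫⁻ y in Ω', ρ (f y) ^ 2 * J y := lintegral_const_mul' _ _ hBtop
        _ ≤ _ := by
            gcongr
            exact hint (fun x => ρ x ^ 2) (hρ.1.pow_const 2)
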